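/- Let $\mathcal H$ be a complex Hilbert space, with scalar product $\langle\cdot|\cdot\rangle$ linear in the second variable, and let $\Gamma(\mathcal H)$ be the symmetric Fock space over $\mathcal H$: the Hilbert space generated by the symmetric powers $u^n$ ($u\in\mathcal H$, $n\ge 0$), with $\langle u^n|v^m\rangle=\delta_{nm}\,n!\,\langle u|v\rangle^n$. Put $\mathrm e^{u}=\sum_n u^n/n!$. For $u\in\mathcal H$ let $W(u)=\mathrm e^{\mathrm i\phi(u)}$, $\phi(u)=a(u)+a^*(u)$, be the Weyl operator, so that $W(u)\mathrm e^{v}=\mathrm e^{-\|u\|^2/2+\mathrm i\langle u|v\rangle}\,\mathrm e^{v+\mathrm iu}$ for all $v\in\mathcal H$. For a bounded operator $A$ on $\mathcal H$ with $\|A\|\le1$ let $\Gamma(A)$ be the bounded operator on $\Gamma(\mathcal H)$ with $\Gamma(A)u^n=(Au)^n$, and for a self-adjoint operator $h\ge m>0$ on $\mathcal H$ let $\mathrm d\Gamma(h)$ be the self-adjoint operator with $\mathrm e^{-t\,\mathrm d\Gamma(h)}=\Gamma(\mathrm e^{-th})$ for $t>0$. By a $C^*$-algebra of operators we mean a norm-closed,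 not necessarily unital, $*$-algebra of bounded operators; the $C^*$-algebra generated by a family of (possibly unbounded) self-adjoint operators is the smallest one containing all their resolvents. Let $\mathcal O$ be a $C^*$-algebra of operators on $\mathcal H$ and let $$\mathscr F(\mathcal O)=C^*\bigl(W(u)\Gamma(A)\,:\,u\in\mathcal H,\ A\in\mathcal O,\ \|A\|<1\bigr).$$ An elementary quantum field Hamiltonian (QFH) of type $\mathcal O$ is a self-adjoint operator on $\Gamma(\mathcal H)$ of the form $H=\mathrm d\Gamma(h)+V$, where $h$ is a self-adjoint operator on $\mathcal H$ with $h\ge m$ for some real $m>0$ and $h^{-1}\in\mathcal O$, and where $V$ is a symmetric operator of the form $V=W(f)=\int_E f(u)W(u)\,d_Eu$ with $f\in L^1(E)$ for some finite-dimensional linear subspace $E\subset\mathcal H$, $d_Eu$ being the Lebesgue measure of the Euclidean space $E$ (with the scalar product $\operatorname{Re}\langle u|v\rangle$). Suppose that $\mathcal O$ contains a positive injective operator. Then $\mathscr F(\mathcal O)$ is the $C^*$-algebra generated by the elementary QFH of type $\mathcal O$, and moreover $$\mathscr F(\mathcal O)=C^*\bigl(\mathrm e^{-H}\,:\,H\text{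 an elementary QFH of type }\mathcal O\bigr).$$ Both equalities hold when $E$ ranges over the finite-dimensional complex subspaces of $\mathcal H$, and also when $E$ ranges over the finite-dimensional real subspaces. -/

import Mathlib

open Filter Topology MeasureTheory
open scoped ComplexOrder Matrix Nat InnerProductSpace

noncomputable section

namespace QFH

/-! ### Positivity of the scalar product on the symmetric algebra -/

section Kernel

variable {ι : Type*}

theorem inner_linearCombination {E : Type*} [NormedAddCommGroup E] [InnerProductSpace ℂ E]
    (e : ι → E) (x : ι →₀ ℂ) :
    ⟪Finsupp.linearCombination ℂ e x, Finsupp.linearCombination ℂ e x⟫_ℂ =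
      x.sum fun i xi => x.sum fun j xj => star xi * ⟪e i, e j⟫_ℂ * xj := by
  simp only [Finsupp.linearCombination_apply, Finsupp.sum, sum_inner, inner_sum,
    inner_smul_left, inner_smul_right, Finset.mul_sum]
  rw [Finset.sum_comm]
  refine Finset.sum_congr rfl fun i _ => Finset.sum_congr rfl fun j _ => ?_
  simp only [RCLike.star_def]
  ring

theorem posSemidef_gram {E : Type*} [NormedAddCommGroup E] [InnerProductSpace ℂ E] (e : ι → E) :
    (Matrix.gram ℂ e).PosSemidef := by
  refine ⟨Matrix.isHermitian_gram ℂ e, fun x => ?_⟩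
  have h := inner_linearCombination e x
  simp only [Matrix.gram_apply]
  rw [← h, inner_self_eq_norm_sq_to_K]
  norm_cast
  positivity

/-- The entrywise `n`-th power of a matrix. -/
def entryPow (M : Matrix ι ι ℂ) (n : ℕ) : Matrix ι ι ℂ := fun i j => M i j ^ n

theorem entryPow_succ (M : Matrix ι ι ℂ) (n : ℕ) : entryPow M (n + 1) = entryPow M n ⊙ M := by
  ext i j
  simp [entryPow, pow_succ]

theorem posSemidef_ones (ι : Type*) : (Matrix.of fun _ _ : ι => (1 : ℂ)).PosSemidef := by
  have h := posSemidef_gram (fun _ : ι => (1 : ℂ))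
  convert! h using 1
  ext i j
  simp [Matrix.gram_apply]

theorem posSemidef_entryPow {M : Matrix ι ι ℂ} (hM : M.PosSemidef) (n : ℕ) :
    (entryPow M n).PosSemidef := by
  induction n with
  | zero =>
    have : entryPow M 0 = Matrix.of fun _ _ : ι => (1 : ℂ) := by ext i j; simp [entryPow]
    rw [this]
    exact posSemidef_ones ι
  | succ n ih => rw [entryPow_succ]; exact ih.hadamard hM

theorem posSemidef_entryPow_sub {M L : Matrix ι ι ℂ} (hM : M.PosSemidef) (hL : L.PosSemidef)
    (h : (M - L).PosSemidef) (n : ℕ) : (entryPow M n - entryPow L n).PosSemidef := by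
  induction n with
  | zero =>
    have : entryPow M 0 - entryPow L 0 = 0 := by ext i j; simp [entryPow]
    rw [this]
    exact Matrix.PosSemidef.zero
  | succ n ih =>
    have : entryPow M (n + 1) - entryPow L (n + 1) =
        entryPow M n ⊙ (M - L) + (entryPow M n - entryPow L n) ⊙ L := by
      ext i j
      simp [entryPow, pow_succ]
      ring
    rw [this]
    exact ((posSemidef_entryPow hM n).hadamard h).add (ih.hadamard hL)

/-- A block-diagonal matrix with positive blocks is positive. -/
theorem posSemidef_graded (g : ι → ℕ) (N : ℕ → Matrix ι ι ℂ) (hN : ∀ n, (N n).PosSemidef) :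
    (Matrix.of fun i j => if g i = g j then N (g i) i j else 0).PosSemidef := by
  classical
  refine ⟨?_, fun x => ?_⟩
  · ext i j
    rw [Matrix.conjTranspose_apply, Matrix.of_apply, Matrix.of_apply]
    by_cases h : g i = g j
    · simp only [h, if_true]
      exact (hN (g j)).isHermitian.apply i j
    · simp [h, Ne.symm h]
  · simp only [Matrix.of_apply]
    have key : (x.sum fun i xi => x.sum fun j xj =>
        star xi * (if g i = g j then N (g i) i j else 0) * xj) =
        ∑ n ∈ x.support.image g,
          ((x.filter (fun i => g i = n)).sum fun i xi =>
            (x.filter (fun i => g i = n)).sum fun j xj => star xi * N n i j * xj) := by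
      simp only [Finsupp.sum, Finsupp.support_filter]
      rw [← Finset.sum_fiberwise_of_maps_to (g := g) (t := x.support.image g)
        (fun i hi => Finset.mem_image_of_mem g hi)]
      refine Finset.sum_congr rfl fun n _ => Finset.sum_congr rfl fun i hi => ?_
      have hi' : g i = n := (Finset.mem_filter.1 hi).2
      rw [Finset.sum_filter]
      refine Finset.sum_congr rfl fun j _ => ?_
      by_cases hj : g j = n
      · simp [hi', hj]
      · have : ¬ n = g j := fun h => hj h.symm
        simp [hi', hj, this]
    rw [key]
    exact Finset.sum_nonneg fun n _ => (hN n).2 _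

end Kernel

/-! ### The bosonic Fock space -/

section Fock

variable {H : Type*} [NormedAddCommGroup H] [InnerProductSpace ℂ H]

/-- The scalar product `⟨uⁿ | vᵐ⟩ = δₙₘ n! ⟨u | v⟩ⁿ` of symmetric powers; the pair `(n, u)`
stands for `uⁿ`. -/
def powKernel (H : Type*) [NormedAddCommGroup H] [InnerProductSpace ℂ H] :
    Matrix (ℕ × H) (ℕ × H) ℂ :=
  Matrix.of fun p q => if p.1 = q.1 then (p.1 ! : ℂ) * ⟪p.2, q.2⟫_ℂ ^ p.1 else 0

theorem posSemidef_factorial_smul {ι : Type*} {M : Matrix ι ι ℂ} (hM : M.PosSemidef) (n : ℕ) :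
    (Matrix.of fun i j => (n ! : ℂ) * M i j).PosSemidef := by
  have h := (posSemidef_gram (fun _ : ι => ((√(n ! : ℝ) : ℝ) : ℂ))).hadamard hM
  convert! h using 1
  ext i j
  simp only [Matrix.hadamard_apply, Matrix.gram_apply, RCLike.inner_apply, Complex.conj_ofReal]
  rw [← Complex.ofReal_mul, Real.mul_self_sqrt (by positivity)]
  simp

theorem posSemidef_powKernel : (powKernel H).PosSemidef :=
  posSemidef_graded (fun p : ℕ × H => p.1)
    (fun n => Matrix.of fun p q =>
      (n ! : ℂ) * entryPow (Matrix.gram ℂ (fun p : ℕ × H => p.2)) n p q)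
    fun n => posSemidef_factorial_smul (posSemidef_entryPow (posSemidef_gram _) n) n

/-- Formal linear combinations of symmetric powers `uⁿ`. -/
def PreFock (H : Type*) : Type _ := (ℕ × H) →₀ ℂ

instance : AddCommGroup (PreFock H) := inferInstanceAs (AddCommGroup ((ℕ × H) →₀ ℂ))
instance : Module ℂ (PreFock H) := inferInstanceAs (Module ℂ ((ℕ × H) →₀ ℂ))

/-- The semi-scalar product on formal combinations of symmetric powers determined by
`⟨uⁿ | vᵐ⟩ = δₙₘ n! ⟨u | v⟩ⁿ`. -/
abbrev preFockCore (H : Type*) [NormedAddCommGroup H] [InnerProductSpace ℂ H] :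
    PreInnerProductSpace.Core ℂ ((ℕ × H) →₀ ℂ) where
  inner x y := Finsupp.sum x fun i xi => Finsupp.sum y fun j yj => star xi * powKernel H i j * yj
  conj_inner_symm x y := by
    rw [Finsupp.sum_comm]
    simp only [map_finsuppSum]
    refine Finsupp.sum_congr fun i _ => Finsupp.sum_congr fun j _ => ?_
    have := (posSemidef_powKernel (H := H)).isHermitian.apply i j
    simp only [RCLike.star_def, map_mul, RCLike.conj_conj] at this ⊢
    rw [this]
    ring
  re_inner_nonneg x := by
    have := (posSemidef_powKernel (H := H)).2 x
    exact (Complex.nonneg_iff.1 this).1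
  add_left x y z := by
    refine (Finsupp.sum_add_index' (f := x) (g := y) ?_ ?_)
    · simp
    · intro i a b
      rw [← Finsupp.sum_add]
      refine Finsupp.sum_congr fun j _ => ?_
      simp [add_mul]
  smul_left x y r := by
    refine (Finsupp.sum_smul_index (g := x) (b := r) ?_).trans ?_
    · simp
    · rw [Finsupp.mul_sum]
      refine Finsupp.sum_congr fun i _ => ?_
      rw [Finsupp.mul_sum]
      refine Finsupp.sum_congr fun j _ => ?_
      simp [mul_assoc]

instance : PreInnerProductSpace.Core ℂ (PreFock H) := preFockCore H

instance : SeminormedAddCommGroup (PreFock H) :=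
  InnerProductSpace.Core.toSeminormedAddCommGroup (𝕜 := ℂ)

instance : InnerProductSpace ℂ (PreFock H) := .ofCore _

/-- The symmetric (bosonic) Fock space `Γ(H)`: the Hilbert completion of the linear span of the
symmetric powers `uⁿ` for the scalar product with `⟨uⁿ | vᵐ⟩ = δₙₘ n! ⟨u | v⟩ⁿ`. -/
abbrev Fock (H : Type*) [NormedAddCommGroup H] [InnerProductSpace ℂ H] : Type _ :=
  UniformSpace.Completion (PreFock H)

/-- The symmetric power `uⁿ` in Fock space. -/
def symPow (n : ℕ) (u : H) : Fock H :=
  UniformSpace.Completion.coe' (α := PreFock H) (Finsupp.single (n, u) (1 : ℂ))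

theorem inner_pow_pow (n m : ℕ) (u v : H) :
    ⟪symPow n u, symPow m v⟫_ℂ = if n = m then (n ! : ℂ) * ⟪u, v⟫_ℂ ^ n else 0 := by
  refine (UniformSpace.Completion.inner_coe (𝕜 := ℂ) (E := PreFock H) _ _).trans ?_
  change (Finsupp.sum (Finsupp.single (n, u) 1) fun i xi =>
    Finsupp.sum (Finsupp.single (m, v) 1) fun j yj => star xi * powKernel H i j * yj) = _
  simp [powKernel]

theorem norm_pow_sq (n : ℕ) (u : H) : ‖symPow n u‖ ^ 2 = (n ! : ℝ) * (‖u‖ ^ 2) ^ n := by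
  have h := inner_pow_pow n n u u
  rw [if_pos rfl, inner_self_eq_norm_sq_to_K, inner_self_eq_norm_sq_to_K] at h
  apply Complex.ofReal_injective
  push_cast
  exact h

theorem coe_eq_linearCombination (x : PreFock H) :
    (x : Fock H) = Finsupp.linearCombination ℂ (fun p : ℕ × H => symPow p.1 p.2) x := by
  have key : ∀ x : (ℕ × H) →₀ ℂ, UniformSpace.Completion.coe' (α := PreFock H) x =
      Finsupp.linearCombination ℂ (fun p : ℕ × H => symPow p.1 p.2) x := by
    intro x
    induction x using Finsupp.induction_linear with
    | zero => rw [map_zero]; exact UniformSpace.Completion.coe_zero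
    | add x y hx hy =>
      rw [map_add, ← hx, ← hy]
      exact UniformSpace.Completion.coe_add (α := PreFock H) x y
    | single p c =>
      rw [Finsupp.linearCombination_single]
      refine Eq.trans ?_ (UniformSpace.Completion.coe_smul (X := PreFock H) c
        (Finsupp.single p (1 : ℂ) : (ℕ × H) →₀ ℂ))
      refine congrArg _ ?_
      change Finsupp.single p c = c • (Finsupp.single p (1 : ℂ))
      simp
  exact key x

theorem denseRange_pow :
    DenseRange (Finsupp.linearCombination ℂ (fun p : ℕ × H => symPow p.1 p.2)) := by
  have h := UniformSpace.Completion.denseRange_coe (α := PreFock H)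
  have e : (fun x : PreFock H => (x : Fock H)) =
      (Finsupp.linearCombination ℂ (fun p : ℕ × H => symPow p.1 p.2)) :=
    funext coe_eq_linearCombination
  rw [← e]
  exact h

/-! ### The operators `Γ(A)` -/

/-- The second quantization `Γ(A)`, `‖A‖ ≤ 1`: the continuous linear operator on Fock space with
`Γ(A) uⁿ = (A u)ⁿ`. (For `‖A‖ > 1` no such bounded operator exists and the value is irrelevant.) -/
def Gam (A : H →L[ℂ] H) : Fock H →L[ℂ] Fock H :=
  (Finsupp.linearCombination ℂ (fun p : ℕ × H => symPow p.1 (A p.2))).extendOfNorm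
    (Finsupp.linearCombination ℂ (fun p : ℕ × H => symPow p.1 p.2))

theorem norm_linearCombination_le {ι : Type*} (e f : ι → Fock H)
    (h : (Matrix.of fun i j => ⟪e i, e j⟫_ℂ - ⟪f i, f j⟫_ℂ).PosSemidef) (x : ι →₀ ℂ) :
    ‖Finsupp.linearCombination ℂ f x‖ ≤ 1 * ‖Finsupp.linearCombination ℂ e x‖ := by
  have h1 := (Complex.nonneg_iff.1 (h.2 x)).1
  simp only [Matrix.of_apply] at h1
  have h2 : (x.sum fun i xi => x.sum fun j xj =>
      star xi * (⟪e i, e j⟫_ℂ - ⟪f i, f j⟫_ℂ) * xj) =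
      ⟪Finsupp.linearCombination ℂ e x, Finsupp.linearCombination ℂ e x⟫_ℂ -
      ⟪Finsupp.linearCombination ℂ f x, Finsupp.linearCombination ℂ f x⟫_ℂ := by
    rw [inner_linearCombination, inner_linearCombination]
    simp only [Finsupp.sum, ← Finset.sum_sub_distrib]
    refine Finset.sum_congr rfl fun i _ => Finset.sum_congr rfl fun j _ => ?_
    ring
  rw [h2, inner_self_eq_norm_sq_to_K, inner_self_eq_norm_sq_to_K] at h1
  have h3 : ‖Finsupp.linearCombination ℂ f x‖ ^ 2 ≤ ‖Finsupp.linearCombination ℂ e x‖ ^ 2 := by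
    have : (0 : ℝ) ≤ ‖Finsupp.linearCombination ℂ e x‖ ^ 2
        - ‖Finsupp.linearCombination ℂ f x‖ ^ 2 := by
      convert h1 using 1
      norm_cast
    linarith
  rw [one_mul]
  exact (pow_le_pow_iff_left₀ (norm_nonneg _) (norm_nonneg _) two_ne_zero).1 h3

theorem norm_pow_map_le (A : H →L[ℂ] H) (hA : ‖A‖ ≤ 1) (x : (ℕ × H) →₀ ℂ) :
    ‖Finsupp.linearCombination ℂ (fun p : ℕ × H => symPow p.1 (A p.2)) x‖ ≤
      1 * ‖Finsupp.linearCombination ℂ (fun p : ℕ × H => symPow p.1 p.2) x‖ := by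
  refine norm_linearCombination_le _ _ ?_ x
  have hsub : (Matrix.gram ℂ (fun p : ℕ × H => p.2) -
      Matrix.gram ℂ (fun p : ℕ × H => A p.2)).PosSemidef := by
    have h1 := Matrix.posSemidef_opNorm_smul_gram_sub_gram (𝕜 := ℂ) (fun p : ℕ × H => p.2) A
    have h2 : (0 : ℝ) ≤ 1 - ‖A‖ ^ 2 := by nlinarith [norm_nonneg A]
    have h3 := (posSemidef_gram (fun p : ℕ × H => p.2)).smul h2
    convert! h1.add h3 using 1
    ext p q
    simp [Matrix.gram_apply]
    ring
  convert! posSemidef_graded (fun p : ℕ × H => p.1)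
    (fun n => Matrix.of fun p q => (n ! : ℂ) * (entryPow (Matrix.gram ℂ (fun p : ℕ × H => p.2)) n
      - entryPow (Matrix.gram ℂ (fun p : ℕ × H => A p.2)) n) p q)
    (fun n => posSemidef_factorial_smul (posSemidef_entryPow_sub (posSemidef_gram _)
      (posSemidef_gram _) hsub n) n) using 1
  ext p q
  simp only [Matrix.of_apply]
  rw [inner_pow_pow, inner_pow_pow]
  by_cases h : p.1 = q.1
  · simp [h, entryPow, mul_sub]
  · simp [h]

theorem Gam_pow {A : H →L[ℂ] H} (hA : ‖A‖ ≤ 1) (n : ℕ) (u : H) :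
    Gam A (symPow n u) = symPow n (A u) := by
  have h := LinearMap.extendOfNorm_eq (denseRange_pow (H := H)) ⟨1, norm_pow_map_le A hA⟩
    (Finsupp.single (n, u) 1)
  simpa [Gam] using h

/-! ### Exponential vectors and Weyl operators -/

theorem summable_norm_exp (u : H) : Summable fun n : ℕ => ‖((n ! : ℂ)⁻¹) • symPow n u‖ := by
  have h1 : Summable fun n : ℕ => (((1 : ℝ) / 4) ^ n + (4 * ‖u‖ ^ 2) ^ n / (n ! : ℝ)) :=
    (summable_geometric_of_lt_one (by norm_num) (by norm_num)).add
      (Real.summable_pow_div_factorial _)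
  refine Summable.of_nonneg_of_le (fun _ => norm_nonneg _) (fun n => ?_) h1
  have h2 : ‖((n ! : ℂ)⁻¹) • symPow n u‖ ^ 2 = (‖u‖ ^ 2) ^ n / (n ! : ℝ) := by
    rw [norm_smul, mul_pow, norm_pow_sq]
    have : (n ! : ℝ) ≠ 0 := by positivity
    simp
    field_simp
  have h3 : ((1 : ℝ) / 4) ^ n * ((4 * ‖u‖ ^ 2) ^ n / (n ! : ℝ)) = (‖u‖ ^ 2) ^ n / (n ! : ℝ) := by
    rw [mul_div_assoc', ← mul_pow]
    congr 2
    ring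
  set a := ((1 : ℝ) / 4) ^ n
  set b := (4 * ‖u‖ ^ 2) ^ n / (n ! : ℝ)
  have ha : 0 ≤ a := by positivity
  have hb : 0 ≤ b := by positivity
  refine abs_le_of_sq_le_sq' ?_ (by positivity) |>.2
  rw [h2, ← h3]
  nlinarith [mul_nonneg ha hb]

/-- The exponential (coherent) vector `eᵘ = ∑ₙ uⁿ / n!`. -/
def expVec (u : H) : Fock H := ∑' n : ℕ, ((n ! : ℂ)⁻¹) • symPow n u

theorem hasSum_expVec (u : H) : HasSum (fun n : ℕ => ((n ! : ℂ)⁻¹) • symPow n u) (expVec u) :=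
  (summable_norm_exp u).of_norm.hasSum

theorem inner_pow_expVec (n : ℕ) (u v : H) : ⟪symPow n u, expVec v⟫_ℂ = ⟪u, v⟫_ℂ ^ n := by
  have h := (hasSum_expVec v).mapL (innerSL ℂ (symPow n u))
  have h' := hasSum_ite_eq n (⟪u, v⟫_ℂ ^ n)
  refine h.unique ?_
  convert! h' using 1
  ext m
  simp only [innerSL_apply_apply, inner_smul_right, inner_pow_pow]
  have : (n ! : ℂ) ≠ 0 := by exact_mod_cast n.factorial_ne_zero
  by_cases hm : m = n
  · subst hm; simp [this]
  · simp [hm, Ne.symm hm]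

theorem inner_expVec_expVec (u v : H) : ⟪expVec u, expVec v⟫_ℂ = Complex.exp ⟪u, v⟫_ℂ := by
  have h := (hasSum_expVec u).mapL (innerSL ℂ (expVec v))
  have h2 : HasSum (fun n : ℕ => ⟪v, u⟫_ℂ ^ n / (n ! : ℂ)) (Complex.exp ⟪v, u⟫_ℂ) := by
    rw [Complex.exp_eq_exp_ℂ]
    exact NormedSpace.expSeries_div_hasSum_exp _
  have h3 : ⟪expVec v, expVec u⟫_ℂ = Complex.exp ⟪v, u⟫_ℂ := by
    refine h.unique ?_
    convert! h2 using 1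
    ext n
    simp only [innerSL_apply_apply, inner_smul_right]
    rw [← inner_conj_symm, inner_pow_expVec, map_pow, inner_conj_symm]
    ring
  rw [← inner_conj_symm, h3, ← Complex.exp_conj, inner_conj_symm]

theorem pow_smul_right (n : ℕ) (c : ℂ) (u : H) (x : Fock H) :
    ⟪x, symPow n (c • u)⟫_ℂ = c ^ n * ⟪x, symPow n u⟫_ℂ := by
  suffices h : symPow n (c • u) = c ^ n • symPow n u by rw [h, inner_smul_right]
  have h2 : ⟪symPow n (c • u) - c ^ n • symPow n u, symPow n (c • u) - c ^ n • symPow n u⟫_ℂ = 0 := by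
    simp only [inner_sub_left, inner_sub_right, inner_smul_left, inner_smul_right, inner_pow_pow,
      if_true, mul_pow, map_pow]
    ring
  exact sub_eq_zero.1 (inner_self_eq_zero.1 h2)

theorem denseRange_expVec : DenseRange (Finsupp.linearCombination ℂ (expVec (H := H))) := by
  have key : ∀ x : Fock H, (∀ v, ⟪x, expVec v⟫_ℂ = 0) → ∀ n v, ⟪x, symPow n v⟫_ℂ = 0 := by
    intro x hx n v
    let p : FormalMultilinearSeries ℂ ℂ ℂ :=
      FormalMultilinearSeries.ofScalars ℂ fun n => ((n ! : ℂ)⁻¹) * ⟪x, symPow n v⟫_ℂ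
    have hp : HasFPowerSeriesAt (0 : ℂ → ℂ) p 0 := by
      rw [hasFPowerSeriesAt_iff]
      refine Filter.Eventually.of_forall fun z => ?_
      have h := (hasSum_expVec (z • v)).mapL (innerSL ℂ x)
      simp only [innerSL_apply_apply, hx, inner_smul_right, pow_smul_right] at h
      simp only [Pi.zero_apply]
      convert! h using 1
      ext m
      simp only [p, FormalMultilinearSeries.coeff_ofScalars, smul_eq_mul]
      ring
    have h0 := hp.eq_zero
    have hn : p.coeff n = 0 := by rw [h0]; rfl
    simp only [p, FormalMultilinearSeries.coeff_ofScalars, mul_eq_zero, inv_eq_zero,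
      Nat.cast_eq_zero] at hn
    exact hn.resolve_left n.factorial_ne_zero
  have hd := denseRange_pow (H := H)
  rw [DenseRange, ← LinearMap.coe_range, Finsupp.range_linearCombination,
    Submodule.dense_iff_topologicalClosure_eq_top,
    Submodule.topologicalClosure_eq_top_iff] at hd ⊢
  rw [Submodule.eq_bot_iff] at hd ⊢
  intro x hx
  have hx' : ∀ v, ⟪x, expVec v⟫_ℂ = 0 := fun v =>
    (Submodule.mem_orthogonal' _ _).1 hx _ (Submodule.subset_span ⟨v, rfl⟩)
  refine hd x ?_
  have hle : Submodule.span ℂ (Set.range fun p : ℕ × H => symPow p.1 p.2) ≤ (ℂ ∙ x)ᗮ := by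
    rw [Submodule.span_le]
    rintro _ ⟨p, rfl⟩
    exact Submodule.mem_orthogonal_singleton_iff_inner_right.2 (key x hx' p.1 p.2)
  exact (Submodule.mem_orthogonal' _ _).2 fun y hy =>
    Submodule.mem_orthogonal_singleton_iff_inner_right.1 (hle hy)

/-- The Weyl operator `W(u) = exp(i φ(u))`, `φ(u) = a(u) + a*(u)`: the continuous linear operator on
Fock space with `W(u) eᵛ = exp(-‖u‖²/2 + i⟨u | v⟩) e^(v + i u)` for all `v`. -/
def weyl (u : H) : Fock H →L[ℂ] Fock H :=
  (Finsupp.linearCombination ℂ fun v : H =>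
      Complex.exp (-(‖u‖ ^ 2 / 2 : ℝ) + Complex.I * ⟪u, v⟫_ℂ) •
        expVec (v + Complex.I • u)).extendOfNorm
    (Finsupp.linearCombination ℂ (expVec (H := H)))

theorem inner_weylExp (u v w : H) :
    ⟪Complex.exp (-(‖u‖ ^ 2 / 2 : ℝ) + Complex.I * ⟪u, v⟫_ℂ) • expVec (v + Complex.I • u),
      Complex.exp (-(‖u‖ ^ 2 / 2 : ℝ) + Complex.I * ⟪u, w⟫_ℂ) • expVec (w + Complex.I • u)⟫_ℂ =
    ⟪expVec v, expVec w⟫_ℂ := by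
  rw [inner_smul_left, inner_smul_right, inner_expVec_expVec, inner_expVec_expVec,
    ← Complex.exp_conj, ← Complex.exp_add, ← Complex.exp_add]
  congr 1
  simp only [map_add, map_mul, map_neg, Complex.conj_I, inner_conj_symm, inner_add_left,
    inner_add_right, inner_smul_left, inner_smul_right, Complex.conj_ofReal]
  rw [inner_self_eq_norm_sq_to_K]
  push_cast
  ring_nf
  simp
  try ring

theorem weyl_expVec (u v : H) :
    weyl u (expVec v) = Complex.exp (-(‖u‖ ^ 2 / 2 : ℝ) + Complex.I * ⟪u, v⟫_ℂ) •
      expVec (v + Complex.I • u) := by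
  have hb : ∀ x : H →₀ ℂ, ‖Finsupp.linearCombination ℂ (fun v : H =>
      Complex.exp (-(‖u‖ ^ 2 / 2 : ℝ) + Complex.I * ⟪u, v⟫_ℂ) •
        expVec (v + Complex.I • u)) x‖ ≤ 1 * ‖Finsupp.linearCombination ℂ (expVec (H := H)) x‖ := by
    refine norm_linearCombination_le _ _ ?_
    convert! Matrix.PosSemidef.zero using 1
    ext i j
    rw [Matrix.of_apply, inner_weylExp]
    simp
  have h := LinearMap.extendOfNorm_eq (denseRange_expVec (H := H)) ⟨1, hb⟩ (Finsupp.single v 1)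
  simpa [weyl] using h

theorem clm_ext_expVec {S T : Fock H →L[ℂ] Fock H} (h : ∀ v, S (expVec v) = T (expVec v)) :
    S = T := by
  have : (S : Fock H → Fock H) = T := by
    refine denseRange_expVec.equalizer S.continuous T.continuous (funext fun x => ?_)
    simp [Finsupp.linearCombination_apply, Finsupp.sum, map_sum, h]
  exact ContinuousLinearMap.coe_inj.1 (LinearMap.ext (congrFun this))

/-- The Weyl relations. -/
theorem weyl_add (u v : H) :
    weyl (u + v) = Complex.exp (Complex.I * ((⟪u, v⟫_ℂ).im : ℂ)) • (weyl u * weyl v) := by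
  refine clm_ext_expVec fun w => ?_
  simp only [smul_apply, mul_apply_eq_comp, weyl_expVec, map_smul,
    smul_smul, ← Complex.exp_add]
  have h1 : w + Complex.I • (u + v) = w + Complex.I • v + Complex.I • u := by
    rw [smul_add]; abel
  rw [h1]
  congr 2
  have h2 : ((‖u + v‖ ^ 2 / 2 : ℝ) : ℂ) =
      (‖u‖ ^ 2 / 2 : ℝ) + (‖v‖ ^ 2 / 2 : ℝ) + ((⟪u, v⟫_ℂ).re : ℝ) := by
    rw [@norm_add_sq ℂ]
    push_cast
    simp only [RCLike.re_eq_complex_re]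
    ring
  have h3 := Complex.re_add_im ⟪u, v⟫_ℂ
  rw [h2, inner_add_left, inner_add_right, inner_smul_right]
  linear_combination -h3 - ⟪u, v⟫_ℂ * Complex.I_sq

/-- The vacuum vector `Ω = 1`. -/
def vacuum (H : Type*) [NormedAddCommGroup H] [InnerProductSpace ℂ H] : Fock H := expVec 0

/-- `⟨Ω | W(u) Ω⟩ = exp(-‖u‖²/2)`. Together with the Weyl relations and the cyclicity of `Ω` (the
vectors `W(u) Ω` are multiples of the exponential vectors `e^(i u)`, which are total), this
identifies `(Fock H, weyl, vacuum H)` as the Fock representation. -/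
theorem inner_vacuum_weyl_vacuum (u : H) :
    ⟪vacuum H, weyl u (vacuum H)⟫_ℂ = Complex.exp (-(‖u‖ ^ 2 / 2 : ℝ)) := by
  simp [vacuum, weyl_expVec, inner_smul_right, inner_expVec_expVec]

end Fock

/-! ### Unbounded operators -/

section Unbounded

variable {E : Type*} [NormedAddCommGroup E] [InnerProductSpace ℂ E]

/-- `R` is the resolvent `(T - z)⁻¹` of the operator `T` at the point `z`. -/
def IsResolventAt (T : E →ₗ.[ℂ] E) (z : ℂ) (R : E →L[ℂ] E) : Prop :=
  (∀ y : E, ∃ hy : R y ∈ T.domain, T ⟨R y, hy⟩ - z • R y = y) ∧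
    ∀ x : T.domain, R (T x - z • (x : E)) = x

open Classical in
/-- The resolvent `(T - z)⁻¹` (and `0` if `z` is not in the resolvent set). -/
def resolventAt (T : E →ₗ.[ℂ] E) (z : ℂ) : E →L[ℂ] E :=
  if h : ∃ R, IsResolventAt T z R then h.choose else 0

/-- The operator `exp(-t T)` for a self-adjoint operator `T` bounded from below and `t > 0`, given
by the functional calculus of self-adjoint operators: `θ(T) = θ'((T - i)⁻¹)`, where
`θ'((x - i)⁻¹) = θ(x)` for real `x` and `θ'(0) = 0`, the right-hand side being given by the
functional calculus of the bounded normal operator `(T - i)⁻¹`. -/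
def expNeg [CompleteSpace E] (t : ℝ) (T : E →ₗ.[ℂ] E) : E →L[ℂ] E :=
  cfcₙ (fun w : ℂ => if w = 0 then 0 else Complex.exp (-((t : ℂ) * ((w⁻¹).re : ℂ))))
    (resolventAt T Complex.I)

/-- Minus the infinitesimal generator of a semigroup `S`: the operator
`x ↦ lim_{t → 0+} (x - S t x) / t`, defined on all `x` for which the limit exists. -/
def negGenerator (S : ℝ → E →L[ℂ] E) : E →ₗ.[ℂ] E where
  domain :=
    { carrier := {x | ∃ y, Tendsto (fun t : ℝ => (t : ℂ)⁻¹ • (x - S t x)) (𝓝[>] 0) (𝓝 y)}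
      zero_mem' := ⟨0, by simp⟩
      add_mem' := by
        rintro a b ⟨y, hy⟩ ⟨z, hz⟩
        refine ⟨y + z, (hy.add hz).congr fun t => ?_⟩
        rw [← smul_add, map_add]
        congr 1
        abel
      smul_mem' := by
        rintro c x ⟨y, hy⟩
        refine ⟨c • y, (hy.const_smul c).congr fun t => ?_⟩
        rw [map_smul, ← smul_sub, smul_comm] }
  toFun :=
    { toFun := fun x => x.2.choose
      map_add' := fun a b => by
        refine tendsto_nhds_unique (a + b).2.choose_spec
          ((a.2.choose_spec.add b.2.choose_spec).congr fun t => ?_)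
        rw [← smul_add, Submodule.coe_add, map_add]
        congr 1
        abel
      map_smul' := fun c x => by
        refine tendsto_nhds_unique (c • x).2.choose_spec
          ((x.2.choose_spec.const_smul c).congr fun t => ?_)
        rw [Submodule.coe_smul, map_smul, ← smul_sub, smul_comm c] }

end Unbounded

/-! ### Elementary quantum field Hamiltonians -/

section Hamiltonians

variable {H : Type*} [NormedAddCommGroup H] [InnerProductSpace ℂ H]

/-- The second quantization `dΓ(h)` of a strictly positive self-adjoint operator `h`: the operator
with `exp(-t dΓ(h)) = Γ(exp(-t h))`, i.e. minus the generator of this semigroup. -/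
def dGam [CompleteSpace H] (h : H →ₗ.[ℂ] H) : Fock H →ₗ.[ℂ] Fock H :=
  negGenerator fun t => Gam (expNeg t h)

/-- The Lebesgue measure of a finite-dimensional real subspace `E` of `H`, for the Euclidean
structure `Re ⟨u | v⟩` on `E`. -/
def euclideanMeasure (E : Submodule ℝ H) [FiniteDimensional ℝ E] : @Measure E (borel E) :=
  letI : InnerProductSpace ℝ H := InnerProductSpace.complexToReal
  letI : MeasurableSpace E := borel E
  haveI : BorelSpace E := ⟨rfl⟩
  volume

/-- `V = W(f) = ∫_E f(u) W(u) du` (strong integral) with `f ∈ L¹(E)`. -/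
def IsWeylIntegral (E : Submodule ℝ H) [FiniteDimensional ℝ E] (f : E → ℂ)
    (V : Fock H →L[ℂ] Fock H) : Prop :=
  letI : MeasurableSpace E := borel E
  Integrable f (euclideanMeasure E) ∧
    ∀ ψ : Fock H, V ψ = ∫ u : E, f u • weyl (u : H) ψ ∂(euclideanMeasure E)

/-- `K = dΓ(h) + W(f)` is an elementary quantum field Hamiltonian of type `𝒪` with `f ∈ L¹(E)`:
`h` is self-adjoint, `h ≥ m` for some `m > 0`, `h⁻¹ ∈ 𝒪`, and `W(f)` is symmetric. -/
def IsElementaryQFHOn [CompleteSpace H] (𝒪 : NonUnitalStarSubalgebra ℂ (H →L[ℂ] H))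
    (E : Submodule ℝ H) [FiniteDimensional ℝ E] (K : Fock H →ₗ.[ℂ] Fock H) : Prop :=
  IsSelfAdjoint K ∧
  ∃ (h : H →ₗ.[ℂ] H) (f : E → ℂ) (V : Fock H →L[ℂ] Fock H),
    IsSelfAdjoint h ∧
    (∃ m : ℝ, 0 < m ∧ ∀ x : h.domain, m * ‖(x : H)‖ ^ 2 ≤ (⟪(x : H), h x⟫_ℂ).re) ∧
    (∃ B ∈ 𝒪, IsResolventAt h 0 B) ∧
    IsWeylIntegral E f V ∧
    IsSelfAdjoint V ∧
    K = dGam h + (V : Fock H →ₗ[ℂ] Fock H).toPMap ⊤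

/-- The elementary quantum field Hamiltonians of type `𝒪`, the space `E` in `f ∈ L¹(E)` being any
finite-dimensional complex subspace of `H`. -/
def elementaryQFH [CompleteSpace H] (𝒪 : NonUnitalStarSubalgebra ℂ (H →L[ℂ] H)) :
    Set (Fock H →ₗ.[ℂ] Fock H) :=
  {K | ∃ (E : Submodule ℂ H) (_ : FiniteDimensional ℝ (E.restrictScalars ℝ)),
    IsElementaryQFHOn 𝒪 (E.restrictScalars ℝ) K}

/-- The same class with `E` any finite-dimensional real subspace of `H`. -/
def elementaryQFHReal [CompleteSpace H] (𝒪 : NonUnitalStarSubalgebra ℂ (H →L[ℂ] H)) :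
    Set (Fock H →ₗ.[ℂ] Fock H) :=
  {K | ∃ (E : Submodule ℝ H) (_ : FiniteDimensional ℝ E), IsElementaryQFHOn 𝒪 E K}

end Hamiltonians

/-! ### The algebras -/

section Algebras

variable {H : Type*} [NormedAddCommGroup H] [InnerProductSpace ℂ H]

/-- The (not necessarily unital) `C*`-algebra of operators generated by a set of bounded
operators. -/
def cstarGen {E : Type*} [NormedAddCommGroup E] [InnerProductSpace ℂ E] [CompleteSpace E]
    (S : Set (E →L[ℂ] E)) : NonUnitalStarSubalgebra ℂ (E →L[ℂ] E) :=
  (NonUnitalStarAlgebra.adjoin ℂ S).topologicalClosure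

/-- The `C*`-algebra generated by a set of self-adjoint operators: the smallest one that contains
all their resolvents. -/
def cstarGenOps {E : Type*} [NormedAddCommGroup E] [InnerProductSpace ℂ E] [CompleteSpace E]
    (S : Set (E →ₗ.[ℂ] E)) : NonUnitalStarSubalgebra ℂ (E →L[ℂ] E) :=
  cstarGen {R | ∃ T ∈ S, ∃ z : ℂ, IsResolventAt T z R}

/-- The algebra `ℱ(𝒪)`: the `C*`-algebra generated by the operators `W(u) Γ(A)` with `u ∈ H`,
`A ∈ 𝒪`, `‖A‖ < 1`. -/
def fieldAlgebra [CompleteSpace H] (𝒪 : NonUnitalStarSubalgebra ℂ (H →L[ℂ] H)) :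
    NonUnitalStarSubalgebra ℂ (Fock H →L[ℂ] Fock H) :=
  cstarGen {T | ∃ (u : H) (A : H →L[ℂ] H), A ∈ 𝒪 ∧ ‖A‖ < 1 ∧ T = weyl u * Gam A}

end Algebras

end QFH

end

/-! Let `𝒞` be the algebra generated by the resolvents of the elementary Hamiltonians. Two facts
about norms carry everything. If `‖A‖ < 1`, then `W(u)Γ(A)` depends norm continuously on `u`,
although `W(u)` alone is only shown to be strongly continuous. Likewise `Γ(A + zB)` is norm analytic
in `z` as long as the argument has norm `< 1`. Both follow from a Schwarz lemma, because the matrix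
elements between exponential vectors are entire functions of the parameter.

`𝒞 ⊆ ℱ(𝒪)`: put `A = e^{-h}`, which lies in `𝒪` because it is a continuous function of `h⁻¹`
vanishing at `0`. For `r > ‖V‖` the resolvent of `dΓ(h) + V` at `-r` is the Neumann series `R₀(1 +
VR₀)⁻¹`, where `R₀` is a continuous function of `Γ(A)` vanishing at `0`. The product `VΓ(A) = ∫ f(u)
W(u)Γ(A) du` is a norm convergent integral, hence in `ℱ(𝒪)`, and so is `VR₀`. The subspace `E` may
be any real one here (`IsElementaryQFHOn.exists_resolvent`).

`ℱ(𝒪) ⊆ 𝒞`: let `A ∈ 𝒪` be positive and injective with `‖A‖ < 1`, so that `A = e^{-h}` with `h`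
admissible. Differentiating the resolvent of `dΓ(h) + sV` at `s = 0` puts `RVR` in `𝒞`. Since `Γ(A)`
is `R` times another element of `𝒞`, varying `f` in `V = W(f)` isolates `Γ(A)W(u)Γ(A)`
(`Gam_mul_weyl_mul_Gam_mem`); only `E = ℂu` is needed. The left factor is removed by an algebraic
trick: a suitable product of two such operators built on `a = A^{1/4}` is a multiple of `W(x)Γ(a⁴)`,
with `x` running through a dense set (`Gam_mul_weyl_mul_Gam_mul`). A positive `A` is the limit of
the injective `A + sS`, where `S` is the given positive injective element. Arbitrary `A` are reached
by analytic continuation along `P + zN` to `z = -1`, then along `P + zQ` to `z = i`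
(`mul_Gam_mem_of_eventually`).

For operators bounded from below, `e^{-K}` and a resolvent at a real point below the spectrum are
continuous functions of each other, vanishing at `0`. This settles the exponential form of the
theorem (`expNeg_mem_iff`). -/

noncomputable section

namespace QFH

/-- Strong convergence of bounded families can be checked on a dense set. -/
theorem tendsto_apply_of_denseRange {E X α : Type*} [NormedAddCommGroup E] [NormedSpace ℂ E]
    {l : Filter α} {T : α → E →L[ℂ] E} {T₀ : E →L[ℂ] E} {C : ℝ} (hT : ∀ᶠ a in l, ‖T a‖ ≤ C)
    {f : X → E} (hf : DenseRange f) (h : ∀ x, Tendsto (fun a => T a (f x)) l (𝓝 (T₀ (f x))))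
    (ψ : E) : Tendsto (fun a => T a ψ) l (𝓝 (T₀ ψ)) := by
  rw [Metric.tendsto_nhds]
  intro ε hε
  set M := |C| + ‖T₀‖ + 1
  have hM : 0 < M := by positivity
  obtain ⟨x, hx⟩ := hf.exists_dist_lt ψ (show 0 < ε / (2 * M) by positivity)
  filter_upwards [hT, (Metric.tendsto_nhds.1 (h x)) (ε / 2) (by positivity)] with a ha hb
  set y := f x
  rw [dist_eq_norm] at hx hb ⊢
  have h2 : T a ψ - T₀ ψ = T a (ψ - y) - T₀ (ψ - y) + (T a y - T₀ y) := by
    simp only [map_sub]; abel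
  rw [h2]
  have h3 : ‖T a (ψ - y)‖ ≤ |C| * (ε / (2 * M)) :=
    ((T a).le_opNorm _).trans (mul_le_mul (ha.trans (le_abs_self C)) hx.le (norm_nonneg _)
      (abs_nonneg _))
  have h4 : ‖T₀ (ψ - y)‖ ≤ ‖T₀‖ * (ε / (2 * M)) :=
    (T₀.le_opNorm _).trans (mul_le_mul_of_nonneg_left hx.le (norm_nonneg _))
  have h5 : (|C| + ‖T₀‖) * (ε / (2 * M)) ≤ ε / 2 := by
    rw [← mul_div_assoc, div_le_div_iff₀ (by positivity) (by positivity)]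
    simp only [M]
    nlinarith
  calc _ ≤ ‖T a (ψ - y)‖ + ‖T₀ (ψ - y)‖ + ‖T a y - T₀ y‖ :=
        (norm_add_le _ _).trans (add_le_add_left (norm_sub_le _ _) _)
    _ < ε := by linarith

/-! ### Algebra and strong continuity of Weyl operators and second quantizations. -/

section Basics

variable {H : Type*} [NormedAddCommGroup H] [InnerProductSpace ℂ H]

theorem norm_Gam_le {A : H →L[ℂ] H} (hA : ‖A‖ ≤ 1) : ‖Gam A‖ ≤ 1 :=
  LinearMap.opNorm_extendOfNorm_le (denseRange_pow (H := H)) zero_le_one (norm_pow_map_le A hA)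

theorem Gam_expVec {A : H →L[ℂ] H} (hA : ‖A‖ ≤ 1) (u : H) :
    Gam A (expVec u) = expVec (A u) := by
  have h := (hasSum_expVec u).mapL (Gam A)
  simp only [map_smul, Gam_pow hA] at h
  exact h.unique (hasSum_expVec (A u))

/-- By `inner_weylExp` the Gram matrix of the exponential vectors is preserved, and their
combinations are dense. -/
theorem norm_weyl_apply (u : H) (ψ : Fock H) : ‖weyl u ψ‖ = ‖ψ‖ := by
  have key : (fun ψ : Fock H => ‖weyl u ψ‖) = fun ψ => ‖ψ‖ := by
    refine denseRange_expVec.equalizer (by fun_prop) (by fun_prop) (funext fun x => ?_)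
    simp only [Function.comp_apply]
    refine (pow_left_inj₀ (norm_nonneg _) (norm_nonneg _) two_ne_zero).1 ?_
    have h1 : weyl u (Finsupp.linearCombination ℂ (expVec (H := H)) x) =
        Finsupp.linearCombination ℂ (fun v => Complex.exp (-(‖u‖ ^ 2 / 2 : ℝ) +
          Complex.I * ⟪u, v⟫_ℂ) • expVec (v + Complex.I • u)) x := by
      simp [Finsupp.linearCombination_apply, Finsupp.sum, map_sum, weyl_expVec]
    have h2 := inner_linearCombination (fun v => Complex.exp (-(‖u‖ ^ 2 / 2 : ℝ) +
          Complex.I * ⟪u, v⟫_ℂ) • expVec (v + Complex.I • u)) x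
    simp only [inner_weylExp] at h2
    rw [← h1, ← inner_linearCombination, inner_self_eq_norm_sq_to_K,
      inner_self_eq_norm_sq_to_K] at h2
    exact_mod_cast h2
  exact congrFun key ψ

theorem norm_weyl_le (u : H) : ‖weyl u‖ ≤ 1 :=
  ContinuousLinearMap.opNorm_le_bound _ zero_le_one fun ψ => by rw [norm_weyl_apply, one_mul]

theorem weyl_zero : weyl (0 : H) = 1 :=
  clm_ext_expVec fun v => by simp [weyl_expVec]

theorem weyl_neg_mul (u : H) : weyl (-u) * weyl u = 1 := by
  have h := weyl_add (-u) u
  have h2 : (⟪u, u⟫_ℂ).im = 0 := inner_self_im (𝕜 := ℂ) u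
  rw [neg_add_cancel, weyl_zero, inner_neg_left, Complex.neg_im, h2] at h
  simpa using h.symm

theorem weyl_mul_neg (u : H) : weyl u * weyl (-u) = 1 := by
  simpa using weyl_neg_mul (-u)

theorem Gam_mul {A B : H →L[ℂ] H} (hA : ‖A‖ ≤ 1) (hB : ‖B‖ ≤ 1) :
    Gam (A * B) = Gam A * Gam B := by
  have hAB : ‖A * B‖ ≤ 1 := (norm_mul_le A B).trans (mul_le_one₀ hA (norm_nonneg _) hB)
  exact clm_ext_expVec fun v => by simp [Gam_expVec, hA, hB, hAB]

/-- `‖eʷ - eᵛ‖²` expands into exponentials of scalar products, which are continuous and cancel at `w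
= v`. -/
theorem continuous_expVec : Continuous (expVec : H → Fock H) := by
  refine continuous_iff_continuousAt.2 fun v => ?_
  rw [ContinuousAt, tendsto_iff_norm_sub_tendsto_zero]
  have h : Tendsto (fun w : H => ‖expVec w - expVec v‖ ^ 2) (𝓝 v) (𝓝 0) := by
    have h1 : ∀ w : H, ‖expVec w - expVec v‖ ^ 2 =
        (Complex.exp ⟪w, w⟫_ℂ - Complex.exp ⟪w, v⟫_ℂ - Complex.exp ⟪v, w⟫_ℂ +
          Complex.exp ⟪v, v⟫_ℂ).re := by
      intro w
      rw [← inner_expVec_expVec, ← inner_expVec_expVec, ← inner_expVec_expVec,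
        ← inner_expVec_expVec, ← inner_self_eq_norm_sq (𝕜 := ℂ)]
      rw [inner_sub_sub_self]
      rfl
    simp only [h1]
    have h2 : Continuous fun w : H => (Complex.exp ⟪w, w⟫_ℂ - Complex.exp ⟪w, v⟫_ℂ -
        Complex.exp ⟪v, w⟫_ℂ + Complex.exp ⟪v, v⟫_ℂ).re := by fun_prop
    convert! h2.tendsto v using 2
    simp
  have h3 := h.sqrt
  simpa [Real.sqrt_sq] using h3

theorem tendsto_apply_of_expVec {α : Type*} {l : Filter α} {T : α → Fock H →L[ℂ] Fock H}
    {T₀ : Fock H →L[ℂ] Fock H} {C : ℝ} (hT : ∀ᶠ a in l, ‖T a‖ ≤ C)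
    (h : ∀ v, Tendsto (fun a => T a (expVec v)) l (𝓝 (T₀ (expVec v)))) (ψ : Fock H) :
    Tendsto (fun a => T a ψ) l (𝓝 (T₀ ψ)) := by
  refine tendsto_apply_of_denseRange hT denseRange_expVec (fun x => ?_) ψ
  simp only [Finsupp.linearCombination_apply, Finsupp.sum, map_sum, map_smul]
  exact tendsto_finsetSum _ fun v _ => (h v).const_smul _

theorem continuous_weyl_apply (ψ : Fock H) : Continuous fun u : H => weyl u ψ := by
  refine continuous_iff_continuousAt.2 fun u => ?_
  refine tendsto_apply_of_expVec (C := 1) (Eventually.of_forall norm_weyl_le) (fun v => ?_) ψ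
  have h : Continuous fun u : H => weyl u (expVec v) := by
    simp only [weyl_expVec]
    have := continuous_expVec (H := H)
    fun_prop
  exact h.tendsto u

theorem tendsto_Gam_apply {α : Type*} {l : Filter α} {A : α → H →L[ℂ] H} {A₀ : H →L[ℂ] H}
    (hA : ∀ᶠ a in l, ‖A a‖ ≤ 1) (hA₀ : ‖A₀‖ ≤ 1) (h : ∀ v, Tendsto (fun a => A a v) l (𝓝 (A₀ v)))
    (ψ : Fock H) : Tendsto (fun a => Gam (A a) ψ) l (𝓝 (Gam A₀ ψ)) := by
  refine tendsto_apply_of_expVec (hA.mono fun a ha => norm_Gam_le ha) (fun v => ?_) ψ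
  rw [Gam_expVec hA₀]
  refine Tendsto.congr' (hA.mono fun a ha => (Gam_expVec ha v).symm) ?_
  exact (continuous_expVec.tendsto _).comp (h v)

theorem Gam_one : Gam (1 : H →L[ℂ] H) = 1 :=
  clm_ext_expVec fun v => by
    rw [Gam_expVec (A := 1) ContinuousLinearMap.norm_id_le]; simp

theorem clm_ext_inner_expVec {S T : Fock H →L[ℂ] Fock H}
    (h : ∀ v w, ⟪expVec v, S (expVec w)⟫_ℂ = ⟪expVec v, T (expVec w)⟫_ℂ) : S = T := by
  refine clm_ext_expVec fun w => ?_
  have : ∀ ψ : Fock H, ⟪ψ, S (expVec w)⟫_ℂ = ⟪ψ, T (expVec w)⟫_ℂ := by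
    refine congrFun (denseRange_expVec.equalizer (by fun_prop) (by fun_prop) (funext fun x => ?_))
    simp [Finsupp.linearCombination_apply, Finsupp.sum, sum_inner, inner_smul_left, h]
  exact ext_inner_left ℂ this

/-- The isometry property makes the adjoint a left inverse, and `W(-u)` is a right inverse. -/
theorem star_weyl (u : H) : star (weyl u) = weyl (-u) := by
  have h : star (weyl u) * weyl u = 1 := by
    ext1 ψ
    refine ext_inner_left ℂ fun χ => ?_
    have h2 : (weyl u).adjoint ∘L weyl u = 1 :=
      (ContinuousLinearMap.norm_map_iff_adjoint_comp_self (weyl u)).1 (norm_weyl_apply u)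
    exact congrArg (fun T : Fock H →L[ℂ] Fock H => ⟪χ, T ψ⟫_ℂ) h2
  calc star (weyl u) = star (weyl u) * (weyl u * weyl (-u)) := by rw [weyl_mul_neg, mul_one]
    _ = weyl (-u) := by rw [← mul_assoc, h, one_mul]

theorem star_Gam [CompleteSpace H] {A : H →L[ℂ] H} (hA : ‖A‖ ≤ 1) : star (Gam A) = Gam (star A) := by
  refine clm_ext_inner_expVec fun v w => ?_
  have hA' : ‖star A‖ ≤ 1 := by rwa [norm_star]
  rw [ContinuousLinearMap.star_eq_adjoint, ContinuousLinearMap.adjoint_inner_right,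
    Gam_expVec hA, Gam_expVec hA', inner_expVec_expVec, inner_expVec_expVec,
    ContinuousLinearMap.star_eq_adjoint, ContinuousLinearMap.adjoint_inner_right]

end Basics

/-! ### Norm continuity and analyticity of `W(u)Γ(A)` for `‖A‖ < 1`. -/

section AnalyticFamilies

variable {H : Type*} [NormedAddCommGroup H] [InnerProductSpace ℂ H]

theorem norm_le_of_inner_linearCombination_expVec {T : Fock H →L[ℂ] Fock H} {C : ℝ} (hC : 0 ≤ C)
    (h : ∀ x y : H →₀ ℂ, ‖⟪Finsupp.linearCombination ℂ (expVec (H := H)) x,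
        T (Finsupp.linearCombination ℂ (expVec (H := H)) y)⟫_ℂ‖ ≤
      C * ‖Finsupp.linearCombination ℂ (expVec (H := H)) x‖ *
        ‖Finsupp.linearCombination ℂ (expVec (H := H)) y‖) : ‖T‖ ≤ C := by
  have h1 : ∀ ψ χ : Fock H, ‖⟪ψ, T χ⟫_ℂ‖ ≤ C * ‖ψ‖ * ‖χ‖ := by
    intro ψ χ
    refine denseRange_expVec.induction_on₂ ?_ h ψ χ
    exact isClosed_le (by fun_prop) (by fun_prop)
  refine ContinuousLinearMap.opNorm_le_bound _ hC fun χ => ?_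
  by_cases h0 : ‖T χ‖ = 0
  · rw [h0]; positivity
  have h2 := h1 (T χ) χ
  rw [inner_self_eq_norm_sq_to_K, norm_pow, RCLike.norm_ofReal, abs_norm, pow_two, mul_comm C,
    mul_assoc] at h2
  exact le_of_mul_le_mul_left h2 (lt_of_le_of_ne (norm_nonneg _) (Ne.symm h0))

theorem differentiableOn_inner_linearCombination {T : ℂ → Fock H →L[ℂ] Fock H} {U : Set ℂ}
    (h : ∀ v w, DifferentiableOn ℂ (fun z => ⟪expVec v, T z (expVec w)⟫_ℂ) U) (x y : H →₀ ℂ) :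
    DifferentiableOn ℂ (fun z => ⟪Finsupp.linearCombination ℂ (expVec (H := H)) x,
        T z (Finsupp.linearCombination ℂ (expVec (H := H)) y)⟫_ℂ) U := by
  simp only [Finsupp.linearCombination_apply, Finsupp.sum, map_sum, map_smul, sum_inner, inner_sum,
    inner_smul_left, inner_smul_right]
  exact DifferentiableOn.fun_sum fun v _ => (DifferentiableOn.fun_sum fun w _ =>
    ((h w v).const_mul _)).const_mul _

/-- The Schwarz lemma for a weakly analytic bounded family of operators. -/
theorem norm_sub_le_of_weakly_differentiable {T : ℂ → Fock H →L[ℂ] Fock H} {C ρ : ℝ}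
    (hC : ∀ z ∈ Metric.ball (0 : ℂ) ρ, ‖T z‖ ≤ C)
    (h : ∀ v w, DifferentiableOn ℂ (fun z => ⟪expVec v, T z (expVec w)⟫_ℂ) (Metric.ball 0 ρ))
    {z : ℂ} (hz : z ∈ Metric.ball (0 : ℂ) ρ) : ‖T z - T 0‖ ≤ 2 * C / ρ * ‖z‖ := by
  have hρ : 0 < ρ := Metric.nonempty_ball.1 ⟨z, hz⟩
  have h0 : (0 : ℂ) ∈ Metric.ball (0 : ℂ) ρ := Metric.mem_ball_self hρ
  have hC0 : 0 ≤ C := (norm_nonneg _).trans (hC 0 h0)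
  refine norm_le_of_inner_linearCombination_expVec (by positivity) fun x y => ?_
  set ψ := Finsupp.linearCombination ℂ (expVec (H := H)) x
  set χ := Finsupp.linearCombination ℂ (expVec (H := H)) y
  have hb : ∀ w ∈ Metric.ball (0 : ℂ) ρ, ‖⟪ψ, T w χ⟫_ℂ‖ ≤ C * ‖ψ‖ * ‖χ‖ := fun w hw => by
    calc ‖⟪ψ, T w χ⟫_ℂ‖ ≤ ‖ψ‖ * (C * ‖χ‖) := (norm_inner_le_norm _ _).trans
          (mul_le_mul_of_nonneg_left ((T w).le_of_opNorm_le (hC w hw) χ) (norm_nonneg _))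
      _ = C * ‖ψ‖ * ‖χ‖ := by ring
  have key := Complex.dist_le_div_mul_dist_of_mapsTo_ball (R₂ := 2 * (C * ‖ψ‖ * ‖χ‖))
    (differentiableOn_inner_linearCombination h x y) (fun w hw => by
      rw [Metric.mem_closedBall, dist_eq_norm, two_mul]
      exact (norm_sub_le _ _).trans (add_le_add (hb w hw) (hb 0 h0))) hz
  rw [dist_eq_norm, dist_zero_right, ← inner_sub_right] at key
  calc _ ≤ _ := key
    _ = _ := by ring

/-- A norm-continuous weakly analytic family of operators is analytic in norm. -/
theorem differentiableOn_of_weakly_differentiable {T : ℂ → Fock H →L[ℂ] Fock H} {U : Set ℂ}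
    (hU : IsOpen U) (hT : ContinuousOn T U)
    (h : ∀ v w, DifferentiableOn ℂ (fun z => ⟪expVec v, T z (expVec w)⟫_ℂ) U) :
    DifferentiableOn ℂ T U := by
  intro c hc
  obtain ⟨R, hR, hball⟩ := Metric.nhds_basis_closedBall.mem_iff.1 (hU.mem_nhds hc)
  lift R to NNReal using hR.le
  have hi : CircleIntegrable T c R :=
    (hT.mono (Metric.sphere_subset_closedBall.trans hball)).circleIntegrable hR.le
  have hp := hasFPowerSeriesOn_cauchy_integral hi (by exact_mod_cast hR)
  refine DifferentiableAt.differentiableWithinAt ?_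
  refine (hp.hasFPowerSeriesAt.differentiableAt).congr_of_eventuallyEq ?_
  filter_upwards [Metric.ball_mem_nhds c hR] with w hw
  -- The Cauchy integral of `T` is analytic in norm; it equals `T` because the scalar Cauchy formula
  -- holds for every matrix element.
  refine clm_ext_inner_expVec fun v v' => ?_
  let L : (Fock H →L[ℂ] Fock H) →L[ℂ] ℂ :=
    (innerSL ℂ (expVec v)).comp (ContinuousLinearMap.apply ℂ (Fock H) (expVec v'))
  have hL : ∀ S : Fock H →L[ℂ] Fock H, L S = ⟪expVec v, S (expVec v')⟫_ℂ := fun S => rfl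
  rw [← hL, ← hL, map_smul]
  have h1 := Complex.two_pi_I_inv_smul_circleIntegral_sub_inv_smul_of_differentiable_on_off_countable
    (Set.countable_empty) hw ((h v v').mono hball).continuousOn
    (fun x hx => (h v v').differentiableAt
      (hU.mem_nhds (hball (Metric.ball_subset_closedBall hx.1))))
  rw [hL (T w), ← h1]
  congr 1
  simp only [circleIntegral]
  have hi2 : CircleIntegrable (fun z => (z - w)⁻¹ • T z) c R := by
    refine ContinuousOn.circleIntegrable hR.le (ContinuousOn.smul (f := fun z => (z - w)⁻¹) ?_
      (hT.mono (Metric.sphere_subset_closedBall.trans hball)))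
    refine ContinuousOn.inv₀ (by fun_prop) fun z hz h0 => ?_
    rw [sub_eq_zero.1 h0] at hz
    rw [Metric.mem_ball] at hw
    exact hw.ne hz
  have := L.intervalIntegral_comp_comm hi2.out
  rw [← this]
  simp [hL]

theorem inner_Gam {A : H →L[ℂ] H} (hA : ‖A‖ ≤ 1) (v w : H) :
    ⟪expVec v, Gam A (expVec w)⟫_ℂ = Complex.exp ⟪v, A w⟫_ℂ := by
  rw [Gam_expVec hA, inner_expVec_expVec]

/-- Along the complex line through `A` and `B` the operator remains a contraction in a disc of
radius `(1 - q)/‖B - A‖`, and the Schwarz lemma there gives the Lipschitz constant. -/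
theorem norm_Gam_sub_le {A B : H →L[ℂ] H} {q : ℝ} (hq : q < 1) (hA : ‖A‖ ≤ q) (hB : ‖B‖ ≤ q) :
    ‖Gam B - Gam A‖ ≤ 2 / (1 - q) * ‖B - A‖ := by
  have hA1 : ‖A‖ ≤ 1 := hA.trans hq.le
  have hB1 : ‖B‖ ≤ 1 := hB.trans hq.le
  have hq' : 0 < 1 - q := by linarith
  rcases eq_or_ne A B with rfl | hAB
  · simp
  have hd : 0 < ‖B - A‖ := norm_pos_iff.2 (sub_ne_zero.2 hAB.symm)
  -- In this case the parameter `1`, which corresponds to `B`, is not inside the disc, but the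
  -- trivial bound `2` is enough.
  by_cases hle : 1 - q ≤ ‖B - A‖
  · calc ‖Gam B - Gam A‖ ≤ 1 + 1 :=
          (norm_sub_le _ _).trans (add_le_add (norm_Gam_le hB1) (norm_Gam_le hA1))
      _ ≤ 2 / (1 - q) * ‖B - A‖ := by
        rw [div_mul_eq_mul_div, le_div_iff₀ hq']; linarith
  push Not at hle
  set ρ := (1 - q) / ‖B - A‖ with hρ
  have hz : ∀ z ∈ Metric.ball (0 : ℂ) ρ, ‖A + z • (B - A)‖ ≤ 1 := fun z hz => by
    rw [mem_ball_zero_iff, hρ, lt_div_iff₀ hd] at hz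
    calc _ ≤ ‖A‖ + ‖z‖ * ‖B - A‖ := (norm_add_le _ _).trans (by rw [norm_smul])
      _ ≤ 1 := by linarith
  have h1 : (1 : ℂ) ∈ Metric.ball (0 : ℂ) ρ := by
    rw [mem_ball_zero_iff, hρ, lt_div_iff₀ hd]; simpa using hle
  have key := norm_sub_le_of_weakly_differentiable (T := fun z => Gam (A + z • (B - A)))
    (C := 1) (ρ := ρ) (fun z h => norm_Gam_le (hz z h)) (fun v w => by
      refine DifferentiableOn.congr (f := fun z => Complex.exp (⟪v, A w⟫_ℂ + z * ⟪v, (B - A) w⟫_ℂ))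
        (by fun_prop) fun z h => ?_
      rw [inner_Gam (hz z h)]
      simp only [add_apply, smul_apply, inner_add_right,
        inner_smul_right]) h1
  simp only [one_smul, zero_smul, add_zero, add_sub_cancel, norm_one, mul_one] at key
  refine key.trans (le_of_eq ?_)
  rw [hρ]; field_simp

theorem continuousOn_Gam : ContinuousOn (Gam (H := H)) {A | ‖A‖ < 1} := by
  intro A hA
  have hA' : ‖A‖ < 1 := hA
  obtain ⟨q, hq1, hq2⟩ := exists_between hA'
  refine ContinuousAt.continuousWithinAt ?_
  rw [ContinuousAt, tendsto_iff_norm_sub_tendsto_zero]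
  have hev : ∀ᶠ B in 𝓝 A, ‖B‖ ≤ q :=
    (continuous_norm.tendsto A).eventually_le_const hq1
  refine squeeze_zero' (g := fun B => 2 / (1 - q) * ‖B - A‖)
    (Eventually.of_forall fun _ => norm_nonneg _)
    (hev.mono fun B hB => norm_Gam_sub_le hq2 hq1.le hB) ?_
  have : Continuous fun B : H →L[ℂ] H => 2 / (1 - q) * ‖B - A‖ := by fun_prop
  simpa using this.tendsto A

theorem differentiableOn_mul_Gam (S : Fock H →L[ℂ] Fock H) (A B : H →L[ℂ] H) :
    DifferentiableOn ℂ (fun z : ℂ => S * Gam (A + z • B)) {z | ‖A + z • B‖ < 1} := by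
  have hU : IsOpen {z : ℂ | ‖A + z • B‖ < 1} := isOpen_lt (by fun_prop) (by fun_prop)
  have h : DifferentiableOn ℂ (fun z : ℂ => Gam (A + z • B)) {z | ‖A + z • B‖ < 1} := by
    refine differentiableOn_of_weakly_differentiable hU ?_ fun v w => ?_
    · exact continuousOn_Gam.comp (by fun_prop) fun z hz => hz
    · refine DifferentiableOn.congr (f := fun z => Complex.exp (⟪v, A w⟫_ℂ + z * ⟪v, B w⟫_ℂ))
        (by fun_prop) fun z hz => ?_
      rw [inner_Gam (le_of_lt hz)]
      simp only [add_apply, smul_apply, inner_add_right, inner_smul_right]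
  exact h.const_mul S

/-- A Weyl operator sandwiched by second quantizations, on exponential vectors. -/
theorem weyl_Gam_weyl_expVec {A : H →L[ℂ] H} (hA : ‖A‖ ≤ 1) (x y v : H) :
    (weyl x * Gam A * weyl y) (expVec v) =
      Complex.exp (-(‖x‖ ^ 2 / 2 : ℝ) - (‖y‖ ^ 2 / 2 : ℝ) - ⟪x, A y⟫_ℂ +
        Complex.I * (⟪x, A v⟫_ℂ + ⟪y, v⟫_ℂ)) • expVec (A v + Complex.I • (x + A y)) := by
  simp only [mul_apply_eq_comp, weyl_expVec, map_smul, Gam_expVec hA, smul_smul,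
    ← Complex.exp_add]
  have h1 : A (v + Complex.I • y) + Complex.I • x = A v + Complex.I • (x + A y) := by
    rw [map_add, map_smul, smul_add]; abel
  rw [h1]
  congr 2
  simp only [map_add, map_smul, inner_add_right, inner_smul_right]
  linear_combination ⟪x, A y⟫_ℂ * Complex.I_sq

/-- Quantitative norm continuity of `u ↦ W(u) Γ(q)` at `0` for a scalar `q ∈ (0,1)`. -/
theorem norm_weyl_mul_Gam_smul_one_sub_le {q : ℝ} (hq0 : 0 ≤ q) (hq : q < 1) {u : H}
    (hu : ‖u‖ < 1) :
    ‖Complex.exp (‖u‖ ^ 2 / 2 : ℝ) • (weyl u * Gam ((q : ℂ) • (1 : H →L[ℂ] H))) -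
      Gam ((q : ℂ) • (1 : H →L[ℂ] H))‖ ≤ 2 * Real.exp (16 / (1 - q ^ 2) ^ 2) * ‖u‖ := by
  rcases eq_or_ne u 0 with rfl | hu0
  · simp [weyl_zero]
  have hn : 0 < ‖u‖ := norm_pos_iff.2 hu0
  set Q : H →L[ℂ] H := (q : ℂ) • (1 : H →L[ℂ] H) with hQdef
  have hQ : ‖Q‖ ≤ 1 := by
    rw [hQdef, norm_smul]
    have : ‖(1 : H →L[ℂ] H)‖ ≤ 1 := ContinuousLinearMap.norm_id_le
    simp only [Complex.norm_real, Real.norm_eq_abs, abs_of_nonneg hq0]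
    nlinarith
  have hQv : ∀ v, Q v = (q : ℂ) • v := fun v => by simp [Q]
  have hd : 0 < 1 - q ^ 2 := by nlinarith
  set d : ℝ := 1 - q ^ 2 with hd_def
  have hdC : (d : ℂ) ≠ 0 := by exact_mod_cast hd.ne'
  have hdq : (d : ℂ) = 1 - (q : ℂ) ^ 2 := by rw [hd_def]; push_cast; ring
  -- `W(zu)Γ(q)` involves both `z` and its conjugate. The sandwich `W(αu)Γ(q)W(βu)`, suitably
  -- normalized, becomes holomorphic in `z` when `α + qβ = z` and `q conj α + conj β = qz`; these
  -- `al` and `be` solve that system.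
  let al : ℂ → ℂ := fun z => (z - q ^ 2 * (starRingEnd ℂ) z) / d
  let be : ℂ → ℂ := fun z => q * ((starRingEnd ℂ) z - z) / d
  let T : ℂ → Fock H →L[ℂ] Fock H := fun z =>
    Complex.exp ((‖al z • u‖ ^ 2 / 2 : ℝ) + (‖be z • u‖ ^ 2 / 2 : ℝ) + ⟪al z • u, Q (be z • u)⟫_ℂ) •
      (weyl (al z • u) * Gam Q * weyl (be z • u))
  have hT : ∀ z v, T z (expVec v) = Complex.exp (Complex.I * (q * z * ⟪u, v⟫_ℂ)) •
      expVec (Q v + (Complex.I * z) • u) := by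
    intro z v
    simp only [T]
    rw [smul_apply, weyl_Gam_weyl_expVec hQ, smul_smul, ← Complex.exp_add]
    have e1 : al z + q * be z = z := by
      simp only [al, be]
      field_simp
      rw [hdq]; ring
    have e2 : (starRingEnd ℂ) (al z) * q + (starRingEnd ℂ) (be z) = q * z := by
      simp only [al, be, map_div₀, map_sub, map_mul, map_pow, Complex.conj_ofReal, Complex.conj_conj]
      field_simp
      rw [hdq]; ring
    congr 2
    · simp only [hQv, inner_smul_left, inner_smul_right]
      linear_combination Complex.I * ⟪u, v⟫_ℂ * e2
    · rw [hQv (be z • u), smul_smul, ← add_smul, e1, smul_smul]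
  have hal : ∀ z, ‖al z‖ ≤ 2 * ‖z‖ / d := fun z => by
    simp only [al, norm_div, Complex.norm_real, Real.norm_eq_abs, abs_of_pos hd]
    refine div_le_div_of_nonneg_right ?_ hd.le
    refine (norm_sub_le _ _).trans ?_
    simp only [norm_mul, norm_pow, Complex.norm_real, Real.norm_eq_abs, abs_of_nonneg hq0,
      RCLike.norm_conj]
    nlinarith [norm_nonneg z]
  have hbe : ∀ z, ‖be z‖ ≤ 2 * ‖z‖ / d := fun z => by
    simp only [be, norm_div, Complex.norm_real, Real.norm_eq_abs, abs_of_pos hd]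
    refine div_le_div_of_nonneg_right ?_ hd.le
    simp only [norm_mul, Complex.norm_real, Real.norm_eq_abs, abs_of_nonneg hq0]
    have := norm_sub_le ((starRingEnd ℂ) z) z
    rw [RCLike.norm_conj] at this
    nlinarith [norm_nonneg z, norm_nonneg ((starRingEnd ℂ) z - z)]
  -- The sandwich is a contraction, so only the scalar normalization matters; on this disc `αu` and
  -- `βu` have norm at most `2/d`.
  have hbound : ∀ z ∈ Metric.ball (0 : ℂ) (1 / ‖u‖), ‖T z‖ ≤ Real.exp (16 / d ^ 2) := by
    intro z hz
    rw [mem_ball_zero_iff, lt_div_iff₀ hn] at hz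
    have hau : ‖al z • u‖ ≤ 2 / d := by
      rw [norm_smul]
      calc ‖al z‖ * ‖u‖ ≤ 2 * ‖z‖ / d * ‖u‖ := mul_le_mul_of_nonneg_right (hal z) hn.le
        _ = 2 * (‖z‖ * ‖u‖) / d := by ring
        _ ≤ 2 / d := div_le_div_of_nonneg_right (by linarith) hd.le
    have hbu : ‖be z • u‖ ≤ 2 / d := by
      rw [norm_smul]
      calc ‖be z‖ * ‖u‖ ≤ 2 * ‖z‖ / d * ‖u‖ := mul_le_mul_of_nonneg_right (hbe z) hn.le
        _ = 2 * (‖z‖ * ‖u‖) / d := by ring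
        _ ≤ 2 / d := div_le_div_of_nonneg_right (by linarith) hd.le
    have hw : ‖weyl (al z • u) * Gam Q * weyl (be z • u)‖ ≤ 1 := by
      refine (norm_mul_le _ _).trans (mul_le_one₀ ((norm_mul_le _ _).trans
        (mul_le_one₀ (norm_weyl_le _) (norm_nonneg _) (norm_Gam_le hQ))) (norm_nonneg _)
        (norm_weyl_le _))
    have h2d : 0 ≤ 2 / d := by positivity
    have hin : ‖⟪al z • u, Q (be z • u)⟫_ℂ‖ ≤ (2 / d) * (2 / d) := by
      refine (norm_inner_le_norm _ _).trans (mul_le_mul hau ?_ (norm_nonneg _) h2d)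
      exact (Q.le_of_opNorm_le hQ _).trans (by rw [one_mul]; exact hbu)
    simp only [T]
    rw [norm_smul]
    refine (mul_le_of_le_one_right (norm_nonneg _) hw).trans ?_
    rw [Complex.norm_exp]
    refine Real.exp_le_exp.2 ?_
    have hre := (Complex.re_le_norm ⟪al z • u, Q (be z • u)⟫_ℂ).trans hin
    simp only [Complex.add_re, Complex.ofReal_re]
    have s1 : ‖al z • u‖ ^ 2 ≤ (2 / d) ^ 2 := pow_le_pow_left₀ (norm_nonneg _) hau 2
    have s2 : ‖be z • u‖ ^ 2 ≤ (2 / d) ^ 2 := pow_le_pow_left₀ (norm_nonneg _) hbu 2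
    have s3 : (16 : ℝ) / d ^ 2 = 4 * (2 / d) ^ 2 := by rw [div_pow]; ring
    rw [s3]
    nlinarith [sq_nonneg (2 / d)]
  have h1 : (1 : ℂ) ∈ Metric.ball (0 : ℂ) (1 / ‖u‖) := by
    rw [mem_ball_zero_iff, lt_div_iff₀ hn]; simpa using hu
  have key := norm_sub_le_of_weakly_differentiable hbound (fun v w => by
    simp only [hT, inner_smul_right, inner_expVec_expVec, inner_add_right]
    fun_prop) h1
  have hT1 : T 1 = Complex.exp (‖u‖ ^ 2 / 2 : ℝ) • (weyl u * Gam Q) := by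
    refine clm_ext_expVec fun v => ?_
    change _ = Complex.exp (‖u‖ ^ 2 / 2 : ℝ) • weyl u (Gam Q (expVec v))
    rw [hT, Gam_expVec hQ, weyl_expVec, smul_smul, ← Complex.exp_add, hQv, inner_smul_right]
    congr 2
    · push_cast; ring
    · simp
  have hT0 : T 0 = Gam Q := by
    refine clm_ext_expVec fun v => ?_
    rw [hT, Gam_expVec hQ]
    simp
  rw [hT1, hT0] at key
  refine key.trans (le_of_eq ?_)
  simp

/-- The factorization `Γ(A) = Γ(q)Γ(q⁻¹A)` with `‖A‖ < q < 1` reduces the claim to scalar `q`. -/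
theorem tendsto_weyl_mul_Gam_zero {A : H →L[ℂ] H} (hA : ‖A‖ < 1) :
    Tendsto (fun u : H => weyl u * Gam A) (𝓝 0) (𝓝 (Gam A)) := by
  obtain ⟨q, hq1, hq2⟩ := exists_between hA
  have hq0 : 0 < q := (norm_nonneg _).trans_lt hq1
  have hqC : (q : ℂ) ≠ 0 := by exact_mod_cast hq0.ne'
  set Q : H →L[ℂ] H := (q : ℂ) • (1 : H →L[ℂ] H) with hQdef
  have hQ : ‖Q‖ ≤ 1 := by
    rw [hQdef, norm_smul]
    have : ‖(1 : H →L[ℂ] H)‖ ≤ 1 := ContinuousLinearMap.norm_id_le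
    simp only [Complex.norm_real, Real.norm_eq_abs, abs_of_nonneg hq0.le]
    nlinarith
  have hA' : ‖(q : ℂ)⁻¹ • A‖ ≤ 1 := by
    rw [norm_smul, norm_inv, Complex.norm_real, Real.norm_eq_abs, abs_of_pos hq0,
      inv_mul_le_iff₀ hq0]
    linarith
  have hfac : Gam A = Gam Q * Gam ((q : ℂ)⁻¹ • A) := by
    rw [← Gam_mul hQ hA', hQdef, smul_mul_smul_comm, one_mul, mul_inv_cancel₀ hqC, one_smul]
  have h1 : Tendsto (fun u : H => Complex.exp (‖u‖ ^ 2 / 2 : ℝ) • (weyl u * Gam Q)) (𝓝 0)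
      (𝓝 (Gam Q)) := by
    rw [tendsto_iff_norm_sub_tendsto_zero]
    refine squeeze_zero' (g := fun u : H => 2 * Real.exp (16 / (1 - q ^ 2) ^ 2) * ‖u‖)
      (Eventually.of_forall fun _ => norm_nonneg _) ?_ ?_
    · filter_upwards [Metric.ball_mem_nhds (0 : H) one_pos] with u hu
      exact norm_weyl_mul_Gam_smul_one_sub_le hq0.le hq2 (mem_ball_zero_iff.1 hu)
    · have : Continuous fun u : H => 2 * Real.exp (16 / (1 - q ^ 2) ^ 2) * ‖u‖ := by fun_prop
      simpa using this.tendsto 0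
  have h2 : Tendsto (fun u : H => Complex.exp (-(‖u‖ ^ 2 / 2 : ℝ))) (𝓝 0) (𝓝 1) := by
    have : Continuous fun u : H => Complex.exp (-(‖u‖ ^ 2 / 2 : ℝ)) := by fun_prop
    simpa using this.tendsto 0
  have h3 := (h2.smul h1).mul_const (Gam ((q : ℂ)⁻¹ • A))
  rw [one_smul, ← hfac] at h3
  refine h3.congr fun u => ?_
  rw [smul_smul, ← Complex.exp_add, neg_add_cancel, Complex.exp_zero, one_smul, hfac, mul_assoc]

/-- The Weyl relations translate continuity at `0` to any other point, up to a continuous phase. -/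
theorem continuous_weyl_mul_Gam {A : H →L[ℂ] H} (hA : ‖A‖ < 1) :
    Continuous fun u : H => weyl u * Gam A := by
  refine continuous_iff_continuousAt.2 fun u => ?_
  have h1 : Tendsto (fun v : H => weyl (v - u) * Gam A) (𝓝 u) (𝓝 (Gam A)) := by
    refine (tendsto_weyl_mul_Gam_zero hA).comp ?_
    have : Continuous fun v : H => v - u := by fun_prop
    simpa using this.tendsto u
  have h2 : Tendsto (fun v : H => Complex.exp (Complex.I * ((⟪u, v - u⟫_ℂ).im : ℂ))) (𝓝 u) (𝓝 1) := by
    have : Continuous fun v : H => Complex.exp (Complex.I * ((⟪u, v - u⟫_ℂ).im : ℂ)) := by fun_prop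
    simpa using this.tendsto u
  have h3 := h2.smul (h1.const_mul (weyl u))
  rw [one_smul] at h3
  refine h3.congr fun v => ?_
  rw [← mul_assoc, ← smul_mul_assoc, ← weyl_add, add_sub_cancel]

end AnalyticFamilies

/-! ### Resolvents of unbounded operators and the `C*`-algebras they generate. -/

section Resolvents

variable {E : Type*} [NormedAddCommGroup E] [InnerProductSpace ℂ E]

namespace IsResolventAt

variable {T : E →ₗ.[ℂ] E} {z w : ℂ} {R R' : E →L[ℂ] E}

/-- The resolvent identity. -/
theorem sub_eq (h : IsResolventAt T w R) (h' : IsResolventAt T z R') :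
    R' = R + (z - w) • (R * R') := by
  ext1 y
  obtain ⟨hy, e⟩ := h'.1 y
  have h2 := h.2 ⟨R' y, hy⟩
  have e2 : T ⟨R' y, hy⟩ - w • R' y = y + (z - w) • R' y := by
    rw [sub_smul, ← add_sub_assoc, ← sub_eq_iff_eq_add.1 e]
  rw [e2, map_add, map_smul] at h2
  exact h2.symm

theorem unique (h : IsResolventAt T z R) (h' : IsResolventAt T z R') : R = R' := by
  have := h.sub_eq h'
  rw [sub_self, zero_smul, add_zero] at this
  exact this.symm

/-- The inverse is `1 + (z - w)R'`; the resolvent identity, used in both orders, gives the two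
products. -/
theorem isUnit (h : IsResolventAt T w R) (h' : IsResolventAt T z R') :
    IsUnit (1 - (z - w) • R) := by
  have h1 := h.sub_eq h'
  have h2 := h'.sub_eq h
  refine ⟨⟨1 - (z - w) • R, 1 + (z - w) • R', ?_, ?_⟩, rfl⟩
  · have : (1 - (z - w) • R) * (1 + (z - w) • R') =
        1 + (z - w) • (R' - (R + (z - w) • (R * R'))) := by
      simp only [sub_mul, mul_add, one_mul, mul_one, smul_mul_smul_comm, smul_sub, smul_add,
        smul_smul]
      abel
    rw [this, ← h1, sub_self, smul_zero, add_zero]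
  · have : (1 + (z - w) • R') * (1 - (z - w) • R) =
        1 - (z - w) • (R - (R' + (w - z) • (R' * R))) := by
      rw [← neg_sub z w]
      simp only [add_mul, mul_sub, one_mul, mul_one, smul_mul_smul_comm, smul_sub, smul_add,
        smul_smul, neg_smul, smul_neg]
      abel
    rw [this, ← h2, sub_self, smul_zero, sub_zero]

theorem eq_resolventAt (h : IsResolventAt T z R) : resolventAt T z = R := by
  have hex : ∃ R, IsResolventAt T z R := ⟨R, h⟩
  rw [resolventAt, dif_pos hex]
  exact hex.choose_spec.unique h

/-- The resolvent identity characterizes the resolvent: the first form shows that `R'` is a right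
inverse of `T - z` with values in the domain, the second that it is a left inverse. -/
theorem of_mul_eq (h : IsResolventAt T w R) (h1 : R' = R + (z - w) • (R * R'))
    (h2 : R' = R + (z - w) • (R' * R)) : IsResolventAt T z R' := by
  refine ⟨fun y => ?_, fun x => ?_⟩
  · have e : R' y = R (y + (z - w) • R' y) := by
      conv_lhs => rw [h1]
      simp
    obtain ⟨hy, e2⟩ := h.1 (y + (z - w) • R' y)
    have hy' : R' y ∈ T.domain := by rw [e]; exact hy
    refine ⟨hy', ?_⟩
    have e3 : T ⟨R' y, hy'⟩ = T ⟨R (y + (z - w) • R' y), hy⟩ := by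
      congr 1; exact Subtype.ext e
    rw [e3, sub_eq_iff_eq_add.1 e2, ← e, sub_smul]
    abel
  · have e := h.2 x
    have e2 : T x - z • (x : E) = (T x - w • (x : E)) - (z - w) • (x : E) := by
      rw [sub_smul]; abel
    rw [e2, map_sub, map_smul]
    have e3 : R' (T x - w • (x : E)) = x + (z - w) • R' x := by
      conv_lhs => rw [h2]
      simp only [add_apply, smul_apply, mul_apply_eq_comp]
      rw [e]
    rw [e3]; abel

theorem one_sub_mul_ne_zero (h : IsResolventAt T w R) (h' : IsResolventAt T z R') {x : ℂ}
    (hx : x ∈ quasispectrum ℂ R) : 1 - (z - w) * x ≠ 0 := by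
  intro h0
  rw [quasispectrum_eq_spectrum_union_zero] at hx
  rcases hx with hx | hx
  · rw [spectrum.mem_iff] at hx
    refine hx ?_
    have hzw : z - w ≠ 0 := by
      rintro hzw; rw [hzw] at h0; simp at h0
    have hx0 : (z - w) * x = 1 := (sub_eq_zero.1 h0).symm
    have e : algebraMap ℂ (E →L[ℂ] E) x - R = (Units.mk0 _ hzw)⁻¹ • (1 - (z - w) • R) := by
      rw [Units.smul_def, smul_sub, smul_smul]
      simp only [Units.val_inv_eq_inv_val, Units.val_mk0, inv_mul_cancel₀ hzw, one_smul,
        Algebra.algebraMap_eq_smul_one]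
      rw [eq_inv_of_mul_eq_one_right hx0]
    rw [e]
    exact (h.isUnit h').smul _
  · rw [Set.mem_singleton_iff.1 hx] at h0
    simp at h0

variable [CompleteSpace E]

theorem mul_cfcₙ_aux [IsStarNormal R] (hne : ∀ x ∈ quasispectrum ℂ R, 1 - (z - w) * x ≠ 0) :
    cfcₙ (fun x : ℂ => x / (1 - (z - w) * x)) R =
      R + (z - w) • (R * cfcₙ (fun x : ℂ => x / (1 - (z - w) * x)) R) := by
  have hc : ContinuousOn (fun x : ℂ => x / (1 - (z - w) * x)) (quasispectrum ℂ R) :=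
    ContinuousOn.div (by fun_prop) (by fun_prop) hne
  have h1 : R * cfcₙ (fun x : ℂ => x / (1 - (z - w) * x)) R =
      cfcₙ (fun x : ℂ => x * (x / (1 - (z - w) * x))) R := by
    rw [cfcₙ_mul (fun x : ℂ => x) _ R, cfcₙ_id' ℂ R]
  rw [h1, ← cfcₙ_const_mul _ _ R (by fun_prop)]
  conv_rhs => enter [1]; rw [← cfcₙ_id' ℂ R]
  rw [← cfcₙ_add (fun x : ℂ => x) (fun x => (z - w) * (x * (x / (1 - (z - w) * x)))) R
    (by fun_prop) rfl (by fun_prop) (by simp)]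
  refine cfcₙ_congr fun x hx => ?_
  have := hne x hx
  rw [← mul_div_assoc, ← mul_div_assoc, ← sub_eq_iff_eq_add, ← sub_div, eq_comm, eq_div_iff this]
  ring

/-- If `x = (λ - w)⁻¹` then `(λ - z)⁻¹ = x / (1 - (z - w)x)`. The function vanishes at `0`, so the
non-unital calculus applies. -/
theorem cfcₙ_isResolventAt [IsStarNormal R] (h : IsResolventAt T w R)
    (hne : ∀ x ∈ quasispectrum ℂ R, 1 - (z - w) * x ≠ 0) :
    IsResolventAt T z (cfcₙ (fun x : ℂ => x / (1 - (z - w) * x)) R) := by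
  refine h.of_mul_eq (mul_cfcₙ_aux hne) ?_
  conv_lhs => rw [mul_cfcₙ_aux hne]
  congr 2
  conv_lhs => enter [1]; rw [← cfcₙ_id' ℂ R]
  conv_rhs => enter [2]; rw [← cfcₙ_id' ℂ R]
  exact cfcₙ_commute_cfcₙ _ _ R

/-- Reduces every question about all resolvents of an operator to a single normal one. -/
theorem mem_of_mem [IsStarNormal R] (h : IsResolventAt T w R) (h' : IsResolventAt T z R')
    {𝒜 : NonUnitalStarSubalgebra ℂ (E →L[ℂ] E)} (h𝒜 : IsClosed (𝒜 : Set (E →L[ℂ] E)))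
    (hR : R ∈ 𝒜) : R' ∈ 𝒜 := by
  rw [h'.unique (h.cfcₙ_isResolventAt fun x hx => h.one_sub_mul_ne_zero h' hx)]
  have := h𝒜
  exact cfcₙ_mem _ hR

theorem isSelfAdjoint {r : ℝ} (h : IsResolventAt T r R) (hT : IsSelfAdjoint T) :
    IsSelfAdjoint R := by
  have hd := hT.dense_domain
  have hf : T.IsFormalAdjoint T := by
    have := T.adjoint_isFormalAdjoint hd
    rwa [LinearPMap.isSelfAdjoint_def.1 hT] at this
  rw [ContinuousLinearMap.isSelfAdjoint_iff_isSymmetric]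
  intro x y
  obtain ⟨hx, ex⟩ := h.1 x
  obtain ⟨hy, ey⟩ := h.1 y
  have e := hf ⟨R x, hx⟩ ⟨R y, hy⟩
  change ⟪R x, y⟫_ℂ = ⟪x, R y⟫_ℂ
  conv_lhs => rw [← ey]
  conv_rhs => rw [← ex]
  simp only [inner_sub_left, inner_sub_right, inner_smul_left, inner_smul_right,
    Complex.conj_ofReal] at e ⊢
  rw [e]

/-- An operator with a bounded self-adjoint resolvent at a real point is self-adjoint. -/
theorem isSelfAdjoint_of_isSelfAdjoint {r : ℝ} (h : IsResolventAt T r R) (hR : IsSelfAdjoint R) :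
    IsSelfAdjoint T := by
  have hsym := ContinuousLinearMap.isSelfAdjoint_iff_isSymmetric.1 hR
  have hsym' : ∀ x y, ⟪R x, y⟫_ℂ = ⟪x, R y⟫_ℂ := hsym
  have hd : Dense (T.domain : Set E) := by
    rw [Submodule.dense_iff_topologicalClosure_eq_top, Submodule.topologicalClosure_eq_top_iff,
      Submodule.eq_bot_iff]
    intro x hx
    have h1 : R x = 0 := by
      refine ext_inner_left ℂ fun y => ?_
      rw [← hsym', inner_zero_right]
      exact (Submodule.mem_orthogonal _ _).1 hx _ (h.1 y).1
    obtain ⟨h2, h3⟩ := h.1 x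
    have h4 : T ⟨R x, h2⟩ = 0 := by
      have : (⟨R x, h2⟩ : T.domain) = 0 := Subtype.ext h1
      rw [this, LinearPMap.map_zero]
    rw [← h3, h4, h1]; simp
  have hfm : T.IsFormalAdjoint T := by
    intro x y
    have ex := h.2 x
    have ey := h.2 y
    have e := hsym' (T x - (r : ℂ) • (x : E)) (T y - (r : ℂ) • (y : E))
    rw [ex, ey] at e
    simp only [inner_sub_left, inner_sub_right, inner_smul_left, inner_smul_right,
      Complex.conj_ofReal] at e
    exact (sub_left_inj.1 e).symm
  rw [LinearPMap.isSelfAdjoint_def]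
  refine (le_antisymm (hfm.le_adjoint hd) ?_).symm
  have hadj := T.adjoint_isFormalAdjoint hd
  -- Every vector of the domain of `T*` is in the range of `R`, hence in the domain of `T`; this
  -- excludes a proper symmetric extension.
  have hmem : ∀ x : T.adjoint.domain, (x : E) = R (T.adjoint x - (r : ℂ) • (x : E)) := by
    intro x
    refine ext_inner_right ℂ fun y => ?_
    obtain ⟨hy, ey⟩ := h.1 y
    rw [hsym']
    conv_lhs => rw [← ey]
    have e := hadj x ⟨R y, hy⟩
    simp only [inner_sub_left, inner_sub_right, inner_smul_left, inner_smul_right,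
      Complex.conj_ofReal] at e ⊢
    rw [e]
  refine ⟨fun x hx => ?_, fun x y hxy => ?_⟩
  · have := hmem ⟨x, hx⟩
    simp only at this
    rw [this]
    exact (h.1 _).1
  · have e := hmem x
    obtain ⟨h1, h2⟩ := h.1 (T.adjoint x - (r : ℂ) • (x : E))
    have h3 : (⟨R (T.adjoint x - (r : ℂ) • (x : E)), h1⟩ : T.domain) = y :=
      Subtype.ext (e.symm.trans hxy)
    rw [h3, ← e] at h2
    exact (sub_left_inj.1 h2).symm

end IsResolventAt

/-- Positivity of `T` gives `r‖Ry‖² ≤ Re⟨Ry, y⟩`, and Cauchy–Schwarz does the rest. -/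
theorem norm_resolvent_le {T : E →ₗ.[ℂ] E} {r : ℝ} {R : E →L[ℂ] E} (hr : 0 < r)
    (h : IsResolventAt T ((-r : ℝ) : ℂ) R) (hpos : ∀ x : T.domain, 0 ≤ (⟪(x : E), T x⟫_ℂ).re) :
    ‖R‖ ≤ r⁻¹ := by
  refine ContinuousLinearMap.opNorm_le_bound _ (by positivity) fun y => ?_
  obtain ⟨hy, e⟩ := h.1 y
  have h1 : r * ‖R y‖ ^ 2 ≤ (⟪R y, y⟫_ℂ).re := by
    have h2 := hpos ⟨R y, hy⟩
    have h3 : T ⟨R y, hy⟩ = y - (r : ℂ) • R y := by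
      rw [sub_eq_iff_eq_add.1 e]; simp [sub_eq_add_neg]
    rw [h3, inner_sub_right, inner_smul_right, inner_self_eq_norm_sq_to_K, Complex.sub_re] at h2
    have h4 : ((r : ℂ) * ((‖R y‖ : ℝ) : ℂ) ^ 2).re = r * ‖R y‖ ^ 2 := by norm_cast
    simp only [Complex.coe_algebraMap] at h2
    rw [h4] at h2
    linarith
  have h5 : (⟪R y, y⟫_ℂ).re ≤ ‖R y‖ * ‖y‖ := re_inner_le_norm (𝕜 := ℂ) _ _
  by_cases h0 : ‖R y‖ = 0
  · rw [h0]; positivity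
  have h6 : 0 < ‖R y‖ := lt_of_le_of_ne (norm_nonneg _) (Ne.symm h0)
  rw [← div_eq_inv_mul, le_div_iff₀ hr]
  nlinarith

/-! ### Exponentials of operators bounded from below -/

/-- The function `s ↦ exp(-t (r + s⁻¹))`, extended by `0` at `0`. -/
def expInv (r t s : ℝ) : ℝ := if s = 0 then 0 else Real.exp (-(t * (r + s⁻¹)))

@[simp] theorem expInv_zero (r t : ℝ) : expInv r t 0 = 0 := if_pos rfl

theorem expInv_of_ne {r t s : ℝ} (hs : s ≠ 0) : expInv r t s = Real.exp (-(t * (r + s⁻¹))) :=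
  if_neg hs

theorem expInv_nonneg (r t s : ℝ) : 0 ≤ expInv r t s := by
  unfold expInv; split_ifs <;> positivity

theorem expInv_le {r t s : ℝ} (ht : 0 < t) (hs : 0 ≤ s) :
    expInv r t s ≤ Real.exp (-(t * r)) * (s / t) := by
  rcases hs.eq_or_lt with rfl | hs
  · simp
  rw [expInv_of_ne hs.ne', mul_add, neg_add, Real.exp_add]
  refine mul_le_mul_of_nonneg_left ?_ (Real.exp_pos _).le
  rw [Real.exp_neg, ← inv_div]
  refine inv_anti₀ (by positivity) ?_
  rw [← div_eq_mul_inv]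
  linarith [Real.add_one_le_exp (t / s)]

theorem continuousOn_expInv (r : ℝ) {t : ℝ} (ht : 0 < t) :
    ContinuousOn (expInv r t) (Set.Ici 0) := by
  intro s hs
  rcases (Set.mem_Ici.1 hs).eq_or_lt with rfl | hs
  · rw [ContinuousWithinAt, expInv_zero]
    refine squeeze_zero' (g := fun s => Real.exp (-(t * r)) * (s / t))
      (Eventually.of_forall fun s => expInv_nonneg r t s) ?_ ?_
    · filter_upwards [self_mem_nhdsWithin] with s hs using expInv_le ht hs
    · have : Continuous fun s : ℝ => Real.exp (-(t * r)) * (s / t) := by fun_prop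
      simpa using (this.tendsto 0).mono_left nhdsWithin_le_nhds
  · refine ContinuousAt.continuousWithinAt ?_
    have : ContinuousAt (fun s : ℝ => Real.exp (-(t * (r + s⁻¹)))) s := by
      have := hs.ne'
      fun_prop (disch := assumption)
    refine this.congr ?_
    filter_upwards [isOpen_ne.mem_nhds hs.ne'] with x hx
    exact (expInv_of_ne hx).symm

/-- The inverse function `s ↦ (-log s - r)⁻¹` of `expInv r 1`, extended by `0`. -/
def invLog (r s : ℝ) : ℝ := if s ≤ 0 then 0 else (-Real.log s - r)⁻¹

@[simp] theorem invLog_zero (r : ℝ) : invLog r 0 = 0 := if_pos le_rfl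

theorem invLog_of_pos {r s : ℝ} (hs : 0 < s) : invLog r s = (-Real.log s - r)⁻¹ :=
  if_neg hs.not_ge

/-- At `0` the logarithm tends to `-∞`, which matches the value `0`; elsewhere the condition `r <
-log s` keeps the denominator positive. -/
theorem continuousOn_invLog (r : ℝ) :
    ContinuousOn (invLog r) {s | s = 0 ∨ (0 < s ∧ r < -Real.log s)} := by
  rintro s (rfl | ⟨hs, hr⟩)
  · refine ContinuousAt.continuousWithinAt ?_
    rw [continuousAt_iff_continuous_left'_right']
    constructor
    · refine (tendsto_const_nhds (x := (0 : ℝ))).congr' ?_ |>.trans (by simp)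
      filter_upwards [self_mem_nhdsWithin] with x hx
      exact (if_pos (le_of_lt hx)).symm
    · have h1 : Tendsto (fun s : ℝ => (-Real.log s - r)⁻¹) (𝓝[>] 0) (𝓝 0) := by
        refine Tendsto.inv_tendsto_atTop ?_
        refine tendsto_atTop_add_const_right _ _ ?_
        exact tendsto_neg_atBot_atTop.comp Real.tendsto_log_nhdsGT_zero
      rw [ContinuousWithinAt, invLog_zero]
      refine h1.congr' ?_
      filter_upwards [self_mem_nhdsWithin] with x hx
      exact (invLog_of_pos hx).symm
  · refine ContinuousAt.continuousWithinAt ?_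
    have h1 : ContinuousAt (fun s : ℝ => (-Real.log s - r)⁻¹) s := by
      refine ContinuousAt.inv₀ ?_ (by linarith)
      exact ((Real.continuousAt_log hs.ne').neg).sub continuousAt_const
    refine h1.congr ?_
    filter_upwards [lt_mem_nhds hs] with x hx
    exact (invLog_of_pos hx).symm

theorem invLog_expInv {r s : ℝ} (hs : 0 ≤ s) : invLog r (expInv r 1 s) = s := by
  rcases hs.eq_or_lt with rfl | hs
  · simp
  rw [expInv_of_ne hs.ne', invLog_of_pos (Real.exp_pos _), Real.log_exp]
  field_simp
  ring

theorem expInv_mem {r s : ℝ} (hs : 0 ≤ s) :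
    expInv r 1 s ∈ {s | s = 0 ∨ (0 < s ∧ r < -Real.log s)} := by
  rcases hs.eq_or_lt with rfl | hs
  · simp
  rw [expInv_of_ne hs.ne']
  refine Or.inr ⟨Real.exp_pos _, ?_⟩
  rw [Real.log_exp]
  have : 0 < s⁻¹ := by positivity
  linarith

variable [CompleteSpace E]

theorem quasispectrum_nonneg' {R : E →L[ℂ] E} (hR : 0 ≤ R) {s : ℝ} (hs : s ∈ quasispectrum ℝ R) :
    0 ≤ s := quasispectrum_nonneg_of_nonneg R hR s hs

/-- Passes from the resolvent at `i`, on which `expNeg` is based, to one at a real point. Positivity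
of `R` expresses `T ≥ r`: with `s = (λ - r)⁻¹` one has `λ = r + s⁻¹`. -/
theorem expNeg_eq_cfcₙ {T : E →ₗ.[ℂ] E} {r : ℝ} {R : E →L[ℂ] E} (h : IsResolventAt T r R)
    (hR : 0 ≤ R) {t : ℝ} (ht : 0 < t) : expNeg t T = cfcₙ (expInv r t) R := by
  have hsa : IsSelfAdjoint R := .of_nonneg hR
  have hn : IsStarNormal R := hsa.isStarNormal
  have hspec : ∀ x ∈ quasispectrum ℂ R, x = (x.re : ℂ) ∧ 0 ≤ x.re := by
    intro x hx
    have hr := hsa.quasispectrumRestricts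
    have hx' := hr.algebraMap_image ▸ hx
    obtain ⟨s, hs, rfl⟩ := hx'
    exact ⟨by simp, by simpa using quasispectrum_nonneg' hR hs⟩
  have hne : ∀ x ∈ quasispectrum ℂ R, 1 - (Complex.I - (r : ℂ)) * x ≠ 0 := by
    intro x hx h0
    obtain ⟨hx1, hx2⟩ := hspec x hx
    rw [hx1] at h0
    have hi := congrArg Complex.im h0
    have hre := congrArg Complex.re h0
    simp at hi hre
    rw [hi] at hre
    simp at hre
  have hres := h.cfcₙ_isResolventAt hne
  rw [expNeg, hres.eq_resolventAt, cfcₙ_real_eq_complex]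
  have hval : ∀ x ∈ quasispectrum ℂ R, (fun w : ℂ => if w = 0 then 0 else
      Complex.exp (-((t : ℂ) * ((w⁻¹).re : ℂ)))) (x / (1 - (Complex.I - (r : ℂ)) * x)) =
      ((expInv r t x.re : ℝ) : ℂ) := by
    intro x hx
    have h0 := hne x hx
    obtain ⟨hx1, hx2⟩ := hspec x hx
    by_cases hx0 : x.re = 0
    · have : x = 0 := by rw [hx1, hx0]; simp
      subst this
      simp
    · have hxn : x ≠ 0 := by rintro rfl; simp at hx0
      have e : ((x / (1 - (Complex.I - (r : ℂ)) * x))⁻¹).re = r + (x.re)⁻¹ := by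
        rw [inv_div, sub_div, mul_div_cancel_right₀ _ hxn]
        conv_lhs => rw [hx1]
        rw [one_div, ← Complex.ofReal_inv]
        simp
        ring
      simp only [div_eq_zero_iff, hxn, h0, or_self, if_false, e, expInv_of_ne hx0]
      push_cast
      rfl
  have hcont : ContinuousOn (fun x : ℂ => x / (1 - (Complex.I - (r : ℂ)) * x))
      (quasispectrum ℂ R) := ContinuousOn.div (by fun_prop) (by fun_prop) hne
  have hcontE : ContinuousOn (fun x : ℂ => ((expInv r t x.re : ℝ) : ℂ)) (quasispectrum ℂ R) := by
    refine Complex.continuous_ofReal.comp_continuousOn ?_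
    exact (continuousOn_expInv r ht).comp (by fun_prop) fun x hx => (hspec x hx).2
  rw [← cfcₙ_comp' _ (fun x : ℂ => x / (1 - (Complex.I - (r : ℂ)) * x)) R ?_ (by simp) hcont
    (by simp) hn]
  · exact cfcₙ_congr hval
  -- The outer function need only be continuous on the image of the spectrum. There it is continuous
  -- because the composition is: the inner map sends closed parts of the compact spectrum to compact
  -- sets.
  · have hK : IsCompact (quasispectrum ℂ R) :=
      NonUnitalContinuousFunctionalCalculus.isCompact_quasispectrum R
    rw [continuousOn_iff_isClosed]
    intro C hC
    refine ⟨(fun x : ℂ => x / (1 - (Complex.I - (r : ℂ)) * x)) ''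
      (quasispectrum ℂ R ∩ (fun x : ℂ => ((expInv r t x.re : ℝ) : ℂ)) ⁻¹' C), ?_, ?_⟩
    · refine IsCompact.isClosed (IsCompact.image_of_continuousOn ?_
        (hcont.mono Set.inter_subset_left))
      obtain ⟨D, hD, hDe⟩ := continuousOn_iff_isClosed.1 hcontE C hC
      rw [Set.inter_comm, hDe]
      exact hK.inter_left hD
    · ext y
      constructor
      · rintro ⟨hy, x, hx, rfl⟩
        refine ⟨⟨x, ⟨hx, ?_⟩, rfl⟩, ⟨x, hx, rfl⟩⟩
        have := hval x hx
        rw [Set.mem_preimage] at hy ⊢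
        rwa [← this]
      · rintro ⟨⟨x, ⟨hx, hxC⟩, rfl⟩, -⟩
        refine ⟨?_, ⟨x, hx, rfl⟩⟩
        have := hval x hx
        rw [Set.mem_preimage] at hxC ⊢
        rwa [← this] at hxC

theorem invLog_cfcₙ_expNeg {T : E →ₗ.[ℂ] E} {r : ℝ} {R : E →L[ℂ] E} (h : IsResolventAt T r R)
    (hR : 0 ≤ R) : cfcₙ (invLog r) (expNeg 1 T) = R := by
  have hsa : IsSelfAdjoint R := .of_nonneg hR
  rw [expNeg_eq_cfcₙ h hR one_pos, ← cfcₙ_comp' (invLog r) (expInv r 1) R ?_ (by simp) ?_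
    (by simp)]
  · conv_rhs => rw [← cfcₙ_id' ℝ R]
    exact cfcₙ_congr fun s hs => invLog_expInv (quasispectrum_nonneg' hR hs)
  · refine (continuousOn_invLog r).mono ?_
    rintro _ ⟨s, hs, rfl⟩
    exact expInv_mem (quasispectrum_nonneg' hR hs)
  · exact (continuousOn_expInv r one_pos).mono fun s hs => quasispectrum_nonneg' hR hs

/-- The functions `expInv r 1` and `invLog r` carry `R` to the exponential and back, and both vanish
at `0`. -/
theorem expNeg_mem_iff {T : E →ₗ.[ℂ] E} {r : ℝ} {R : E →L[ℂ] E} (h : IsResolventAt T r R)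
    (hR : 0 ≤ R) {𝒜 : NonUnitalStarSubalgebra ℂ (E →L[ℂ] E)}
    (h𝒜 : IsClosed (𝒜 : Set (E →L[ℂ] E))) : expNeg 1 T ∈ 𝒜 ↔ R ∈ 𝒜 := by
  have := h𝒜
  constructor
  · intro h1
    rw [← invLog_cfcₙ_expNeg h hR]
    exact cfcₙ_mem _ h1
  · intro h1
    rw [expNeg_eq_cfcₙ h hR one_pos]
    exact cfcₙ_mem _ h1

theorem isClosed_cstarGen (S : Set (E →L[ℂ] E)) : IsClosed (cstarGen S : Set (E →L[ℂ] E)) :=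
  NonUnitalStarSubalgebra.isClosed_topologicalClosure _

theorem subset_cstarGen (S : Set (E →L[ℂ] E)) : S ⊆ cstarGen S :=
  (NonUnitalStarAlgebra.subset_adjoin ℂ S).trans
    (NonUnitalStarSubalgebra.le_topologicalClosure _)

theorem cstarGen_le {S : Set (E →L[ℂ] E)} {𝒜 : NonUnitalStarSubalgebra ℂ (E →L[ℂ] E)}
    (h𝒜 : IsClosed (𝒜 : Set (E →L[ℂ] E))) (h : S ⊆ 𝒜) : cstarGen S ≤ 𝒜 :=
  NonUnitalStarSubalgebra.topologicalClosure_minimal _ (NonUnitalStarAlgebra.adjoin_le h) h𝒜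

/-- For operators bounded from below the resolvents and the exponentials generate the same
`C*`-algebra. -/
theorem cstarGenOps_eq_cstarGen_expNeg {S : Set (E →ₗ.[ℂ] E)}
    (hS : ∀ T ∈ S, ∃ (r : ℝ) (R : E →L[ℂ] E), IsResolventAt T r R ∧ 0 ≤ R) :
    cstarGenOps S = cstarGen {B | ∃ T ∈ S, B = expNeg 1 T} := by
  apply le_antisymm
  · refine cstarGen_le (isClosed_cstarGen _) ?_
    rintro R' ⟨T, hT, z, hR'⟩
    obtain ⟨r, R, h, hR⟩ := hS T hT
    have hn : IsStarNormal R := (IsSelfAdjoint.of_nonneg hR).isStarNormal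
    refine h.mem_of_mem hR' (isClosed_cstarGen _) ?_
    rw [← expNeg_mem_iff h hR (isClosed_cstarGen _)]
    exact subset_cstarGen _ ⟨T, hT, rfl⟩
  · refine cstarGen_le (isClosed_cstarGen _) ?_
    rintro _ ⟨T, hT, rfl⟩
    obtain ⟨r, R, h, hR⟩ := hS T hT
    refine (expNeg_mem_iff h hR (isClosed_cstarGen _)).2 ?_
    exact subset_cstarGen _ ⟨T, hT, r, h⟩

/-! ### Bounded perturbations -/

/-- A bounded symmetric perturbation of a positive operator: its resolvent at `-r` is
`R₀ (1 + V R₀)⁻¹`, and it is positive if `r > ‖V‖`. -/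
theorem isResolventAt_add {T : E →ₗ.[ℂ] E} {r : ℝ} {R₀ V : E →L[ℂ] E}
    (h : IsResolventAt T ((-r : ℝ) : ℂ) R₀) (hR₀ : IsSelfAdjoint R₀)
    (hpos : ∀ x : T.domain, 0 ≤ (⟪(x : E), T x⟫_ℂ).re) (hV : IsSelfAdjoint V) (hr : ‖V‖ < r) :
    ‖V * R₀‖ < 1 ∧
    IsResolventAt (T + (V : E →ₗ[ℂ] E).toPMap ⊤) ((-r : ℝ) : ℂ) (R₀ * Ring.inverse (1 + V * R₀)) ∧
    0 ≤ R₀ * Ring.inverse (1 + V * R₀) := by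
  have hr0 : 0 < r := (norm_nonneg _).trans_lt hr
  have hn := norm_resolvent_le hr0 h hpos
  have hlt : ‖-(V * R₀)‖ < 1 := by
    rw [norm_neg]
    calc ‖V * R₀‖ ≤ ‖V‖ * ‖R₀‖ := norm_mul_le _ _
      _ ≤ ‖V‖ * r⁻¹ := mul_le_mul_of_nonneg_left hn (norm_nonneg _)
      _ < 1 := by rw [← div_eq_mul_inv, div_lt_one hr0]; exact hr
  have hu : IsUnit (1 + V * R₀) := by
    have := isUnit_one_sub_of_norm_lt_one hlt
    rwa [sub_neg_eq_add] at this
  set X := Ring.inverse (1 + V * R₀) with hX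
  have hX1 : (1 + V * R₀) * X = 1 := Ring.mul_inverse_cancel _ hu
  have hX2 : X * (1 + V * R₀) = 1 := Ring.inverse_mul_cancel _ hu
  have hres : IsResolventAt (T + (V : E →ₗ[ℂ] E).toPMap ⊤) ((-r : ℝ) : ℂ) (R₀ * X) := by
    refine ⟨fun y => ?_, fun x => ?_⟩
    · obtain ⟨hy, e⟩ := h.1 (X y)
      refine ⟨⟨hy, trivial⟩, ?_⟩
      have e2 : X y + V (R₀ (X y)) = y := by
        have := congrArg (fun S : E →L[ℂ] E => S y) hX1
        simpa using this
      change T ⟨R₀ (X y), hy⟩ + V (R₀ (X y)) - _ • R₀ (X y) = y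
      rw [add_sub_right_comm, e, e2]
    · have e := h.2 ⟨x, x.2.1⟩
      simp only at e
      set w := T ⟨x, x.2.1⟩ - ((-r : ℝ) : ℂ) • (x : E) with hw
      have e2 : (T + (V : E →ₗ[ℂ] E).toPMap ⊤) x - ((-r : ℝ) : ℂ) • (x : E) = w + V (R₀ w) := by
        rw [e, hw, ← add_sub_right_comm]
        rfl
      rw [e2]
      have := congrArg (fun S : E →L[ℂ] E => R₀ (S w)) hX2
      simp only [mul_add, mul_one, add_apply, mul_apply_eq_comp, one_apply_eq_self] at this
      rw [mul_apply_eq_comp, map_add, map_add, ← map_add]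
      rw [this, e]
  refine ⟨by rwa [norm_neg] at hlt, hres, ?_⟩
  rw [ContinuousLinearMap.nonneg_iff_isPositive]
  have hsa : IsSelfAdjoint (R₀ * X) := by
    have hXs : star X * (1 + R₀ * V) = 1 := by
      have := congrArg star hX1
      simpa [hR₀.star_eq, hV.star_eq] using this
    rw [isSelfAdjoint_iff, star_mul, hR₀.star_eq]
    -- Uses `R₀(1 + VR₀) = (1 + R₀V)R₀`.
    calc star X * R₀ = star X * (R₀ * ((1 + V * R₀) * X)) := by rw [hX1, mul_one]
      _ = star X * (1 + R₀ * V) * (R₀ * X) := by noncomm_ring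
      _ = R₀ * X := by rw [hXs, one_mul]
  refine (ContinuousLinearMap.isPositive_def' ).2 ⟨hsa, fun y => ?_⟩
  obtain ⟨⟨hy, hy'⟩, e⟩ := hres.1 y
  set x := (R₀ * X) y
  -- Hence `Re⟨x, y⟩ ≥ (r - ‖V‖)‖x‖²`, which is the positivity of the resolvent.
  have e2 : T ⟨x, hy⟩ + V x + (r : ℂ) • x = y := by
    rw [← e]
    change _ = T ⟨x, hy⟩ + V x - ((-r : ℝ) : ℂ) • x
    rw [Complex.ofReal_neg, neg_smul, sub_neg_eq_add]
  rw [ContinuousLinearMap.reApplyInnerSelf_apply]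
  change 0 ≤ (⟪x, y⟫_ℂ).re
  rw [← e2, inner_add_right, inner_add_right, inner_smul_right, inner_self_eq_norm_sq_to_K,
    Complex.add_re, Complex.add_re]
  have h1 := hpos ⟨x, hy⟩
  have h2 : |(⟪x, V x⟫_ℂ).re| ≤ ‖V‖ * ‖x‖ ^ 2 := by
    refine (Complex.abs_re_le_norm _).trans ((norm_inner_le_norm _ _).trans ?_)
    calc ‖x‖ * ‖V x‖ ≤ ‖x‖ * (‖V‖ * ‖x‖) :=
          mul_le_mul_of_nonneg_left (V.le_opNorm x) (norm_nonneg _)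
      _ = ‖V‖ * ‖x‖ ^ 2 := by ring
  have h4 : ((r : ℂ) * ((‖x‖ : ℝ) : ℂ) ^ 2).re = r * ‖x‖ ^ 2 := by norm_cast
  simp only [Complex.coe_algebraMap]
  rw [h4]
  have h5 := neg_abs_le (⟪x, V x⟫_ℂ).re
  have h6 : ‖V‖ * ‖x‖ ^ 2 ≤ r * ‖x‖ ^ 2 := mul_le_mul_of_nonneg_right hr.le (sq_nonneg _)
  simp only at h1
  linarith

end Resolvents

/-! ### Self-adjoint contraction semigroups and their generators. -/

section Semigroups

/-! ### Real powers of a positive contraction -/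

theorem one_sub_rpow_le {s t : ℝ} (hs : 0 < s) : 1 - s ^ t ≤ t * -Real.log s := by
  rw [Real.rpow_def_of_pos hs]
  linarith [Real.add_one_le_exp (Real.log s * t)]

theorem le_one_sub_rpow {s t : ℝ} (hs : 0 < s) (hs1 : s ≤ 1) (ht : 0 ≤ t) :
    t * -Real.log s - (t * -Real.log s) ^ 2 ≤ 1 - s ^ t := by
  rw [Real.rpow_def_of_pos hs]
  set x := t * -Real.log s with hx
  have hx0 : 0 ≤ x := mul_nonneg ht (by linarith [Real.log_nonpos hs.le hs1])
  have e : Real.log s * t = -x := by rw [hx]; ring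
  rw [e, Real.exp_neg]
  have h1 : (Real.exp x)⁻¹ ≤ (1 + x)⁻¹ :=
    inv_anti₀ (by linarith) (by linarith [Real.add_one_le_exp x])
  have h2 : (1 + x)⁻¹ ≤ 1 - x + x ^ 2 := by
    rw [inv_le_iff_one_le_mul₀ (by linarith)]
    nlinarith [pow_nonneg hx0 3]
  linarith

theorem mul_neg_log_le {s : ℝ} (hs : 0 < s) : s * -Real.log s ≤ 1 := by
  have h := Real.one_sub_inv_le_log_of_pos hs
  have : s * (1 - s⁻¹) ≤ s * Real.log s := mul_le_mul_of_nonneg_left h hs.le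
  rw [mul_sub, mul_inv_cancel₀ hs.ne'] at this
  linarith

theorem invLog_nonneg {r s : ℝ} (hr : 0 < r) (hs1 : s ≤ 1) : 0 ≤ invLog (-r) s := by
  unfold invLog
  split_ifs with h
  · exact le_rfl
  · have := Real.log_nonpos (not_le.1 h).le hs1
    exact inv_nonneg.2 (by linarith)

theorem neg_log_mul_invLog_le {r s : ℝ} (hr : 0 < r) (hs : 0 < s) (hs1 : s ≤ 1) :
    -Real.log s * invLog (-r) s ≤ 1 := by
  rw [invLog_of_pos hs, ← div_eq_mul_inv]
  have := Real.log_nonpos hs.le hs1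
  rw [div_le_one (by linarith)]
  linarith

theorem one_sub_mul_invLog {r s : ℝ} (hr : 0 < r) (hs : 0 < s) (hs1 : s ≤ 1) :
    1 - r * invLog (-r) s = -Real.log s * invLog (-r) s := by
  rw [invLog_of_pos hs]
  have h0 := Real.log_nonpos hs.le hs1
  have : -Real.log s - -r ≠ 0 := by linarith
  field_simp
  ring

theorem expInv_invLog {r s : ℝ} (hr : 0 < r) (hs : 0 ≤ s) (hs1 : s ≤ 1) :
    expInv (-r) 1 (invLog (-r) s) = s := by
  rcases hs.eq_or_lt with rfl | hs
  · simp
  have h0 := Real.log_nonpos hs.le hs1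
  have h1 : -Real.log s - -r ≠ 0 := by linarith
  rw [invLog_of_pos hs, expInv_of_ne (inv_ne_zero h1), inv_inv]
  ring_nf
  exact Real.exp_log hs

theorem continuousOn_invLog_Icc {r : ℝ} (hr : 0 < r) :
    ContinuousOn (invLog (-r)) (Set.Icc 0 1) := by
  refine (continuousOn_invLog (-r)).mono fun s hs => ?_
  rcases hs.1.eq_or_lt with h | h
  · exact Or.inl h.symm
  · exact Or.inr ⟨h, by linarith [Real.log_nonpos h.le hs.2]⟩

variable {E : Type*} [NormedAddCommGroup E] [InnerProductSpace ℂ E]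

theorem negGenerator_apply_eq {S : ℝ → E →L[ℂ] E} {x y : E} (hx : x ∈ (negGenerator S).domain)
    (h : Tendsto (fun t : ℝ => (t : ℂ)⁻¹ • (x - S t x)) (𝓝[>] 0) (𝓝 y)) :
    negGenerator S ⟨x, hx⟩ = y :=
  tendsto_nhds_unique (Exists.choose_spec hx) h

theorem tendsto_negGenerator {S : ℝ → E →L[ℂ] E} (x : (negGenerator S).domain) :
    Tendsto (fun t : ℝ => (t : ℂ)⁻¹ • ((x : E) - S t x)) (𝓝[>] 0) (𝓝 (negGenerator S x)) :=
  Exists.choose_spec x.2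

variable [CompleteSpace E]


theorem quasispectrum_subset_Icc {B : E →L[ℂ] E} (hB : 0 ≤ B) {c : ℝ} (hB1 : ‖B‖ ≤ c) :
    quasispectrum ℝ B ⊆ Set.Icc 0 c := fun s hs => by
  have hsa : IsSelfAdjoint B := .of_nonneg hB
  have h := norm_apply_le_norm_cfcₙ (fun x : ℝ => x) B hs
  rw [cfcₙ_id' ℝ B] at h
  exact ⟨quasispectrum_nonneg' hB hs, (le_abs_self s).trans (h.trans hB1)⟩

theorem denseRange_of_isSelfAdjoint {A : E →L[ℂ] E} (hA : IsSelfAdjoint A)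
    (hinj : Function.Injective A) : DenseRange A := by
  change Dense (Set.range A)
  have : Set.range A = (LinearMap.range (A : E →ₗ[ℂ] E) : Set E) := rfl
  rw [this, Submodule.dense_iff_topologicalClosure_eq_top, Submodule.topologicalClosure_eq_top_iff,
    Submodule.eq_bot_iff]
  intro x hx
  have hsym : ∀ y z, ⟪A y, z⟫_ℂ = ⟪y, A z⟫_ℂ :=
    ContinuousLinearMap.isSelfAdjoint_iff_isSymmetric.1 hA
  refine hinj ?_
  rw [map_zero]
  refine ext_inner_left ℂ fun y => ?_
  rw [← hsym, inner_zero_right]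
  exact (Submodule.mem_orthogonal _ _).1 hx _ ⟨y, rfl⟩

/-- The power `Bᵗ`, `t > 0`, of a positive operator. -/
def opPow (B : E →L[ℂ] E) (t : ℝ) : E →L[ℂ] E := cfcₙ (fun s : ℝ => s ^ t) B

theorem continuousOn_rpow {t : ℝ} (ht : 0 < t) (K : Set ℝ) :
    ContinuousOn (fun s : ℝ => s ^ t) K := (Real.continuous_rpow_const ht.le).continuousOn

section opPow

variable {B : E →L[ℂ] E} (hB : 0 ≤ B)

include hB

theorem opPow_add {s t : ℝ} (hs : 0 < s) (ht : 0 < t) :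
    opPow B (s + t) = opPow B s * opPow B t := by
  have hsa : IsSelfAdjoint B := .of_nonneg hB
  rw [opPow, opPow, opPow, ← cfcₙ_mul _ _ B (continuousOn_rpow hs _) (Real.zero_rpow hs.ne')
    (continuousOn_rpow ht _) (Real.zero_rpow ht.ne')]
  exact cfcₙ_congr fun x hx => Real.rpow_add' (quasispectrum_nonneg' hB hx) (by positivity)

theorem opPow_nonneg (t : ℝ) : 0 ≤ opPow B t :=
  cfcₙ_nonneg fun _ hx => Real.rpow_nonneg (quasispectrum_nonneg' hB hx) _

theorem opPow_one : opPow B 1 = B := by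
  have hsa : IsSelfAdjoint B := .of_nonneg hB
  simp only [opPow, Real.rpow_one]
  exact cfcₙ_id' ℝ B

theorem norm_opPow_le {c : ℝ} (hB1 : ‖B‖ ≤ c) {t : ℝ} (ht : 0 < t) : ‖opPow B t‖ ≤ c ^ t := by
  refine norm_cfcₙ_le fun x hx => ?_
  obtain ⟨h0, h1⟩ := quasispectrum_subset_Icc hB hB1 hx
  rw [Real.norm_eq_abs, abs_of_nonneg (Real.rpow_nonneg h0 _)]
  exact Real.rpow_le_rpow h0 h1 ht.le

/-- On the spectrum `s - sᵗs ≤ t · s(-log s) ≤ t`: the factor `B` absorbs the singularity of the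
logarithm. This yields convergence on the range of `B`, which is dense when `B` is injective. -/
theorem norm_opPow_mul_sub_le (hB1 : ‖B‖ ≤ 1) {t : ℝ} (ht : 0 < t) :
    ‖opPow B t * B - B‖ ≤ t := by
  have hsa : IsSelfAdjoint B := .of_nonneg hB
  have e : opPow B t * B - B = cfcₙ (fun s : ℝ => s ^ t * s - s) B := by
    rw [cfcₙ_sub (fun s : ℝ => s ^ t * s) (fun s => s) B
      ((continuousOn_rpow ht _).mul continuousOn_id) (by simp) (by fun_prop) rfl,
      cfcₙ_mul (fun s : ℝ => s ^ t) (fun s => s) B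
      (continuousOn_rpow ht _) (Real.zero_rpow ht.ne') (by fun_prop) rfl, cfcₙ_id' ℝ B, opPow]
  rw [e]
  refine norm_cfcₙ_le fun s hs => ?_
  obtain ⟨h0, h1⟩ := quasispectrum_subset_Icc hB hB1 hs
  rcases h0.eq_or_lt with rfl | h0
  · simpa using ht.le
  have h2 := one_sub_rpow_le (t := t) h0
  have h3 := mul_neg_log_le h0
  have h4 : s ^ t ≤ 1 := Real.rpow_le_one h0.le h1 ht.le
  rw [Real.norm_eq_abs, abs_sub_comm, abs_of_nonneg (by nlinarith)]
  calc s - s ^ t * s = (1 - s ^ t) * s := by ring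
    _ ≤ t * -Real.log s * s := mul_le_mul_of_nonneg_right h2 h0.le
    _ = t * (s * -Real.log s) := by ring
    _ ≤ t := mul_le_of_le_one_right ht.le h3

theorem tendsto_opPow_apply (hB1 : ‖B‖ ≤ 1) (hinj : Function.Injective B) (x : E) :
    Tendsto (fun t : ℝ => opPow B t x) (𝓝[>] 0) (𝓝 x) := by
  refine tendsto_apply_of_denseRange (T₀ := 1) (C := 1) (f := B) ?_
    (denseRange_of_isSelfAdjoint (.of_nonneg hB) hinj) (fun y => ?_) x
  · filter_upwards [self_mem_nhdsWithin] with t ht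
    simpa using norm_opPow_le hB hB1 (Set.mem_Ioi.1 ht)
  · rw [tendsto_iff_norm_sub_tendsto_zero]
    refine squeeze_zero' (g := fun t : ℝ => t * ‖y‖) (Eventually.of_forall fun _ => norm_nonneg _)
      ?_ ?_
    · filter_upwards [self_mem_nhdsWithin] with t ht
      exact (opPow B t * B - B).le_of_opNorm_le (norm_opPow_mul_sub_le hB hB1 ht) y
    · have : Continuous fun t : ℝ => t * ‖y‖ := by fun_prop
      simpa using (this.tendsto 0).mono_left nhdsWithin_le_nhds

end opPow

/-! ### Self-adjoint contraction semigroups -/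

/-- `S` is a strongly continuous semigroup of self-adjoint contractions. -/
structure IsContractionSemigroup (S : ℝ → E →L[ℂ] E) : Prop where
  isSelfAdjoint : ∀ t, 0 < t → IsSelfAdjoint (S t)
  norm_le : ∀ t, 0 < t → ‖S t‖ ≤ 1
  add : ∀ s t, 0 < s → 0 < t → S (s + t) = S s * S t
  tendsto : ∀ x, Tendsto (fun t => S t x) (𝓝[>] 0) (𝓝 x)

namespace IsContractionSemigroup

variable {S : ℝ → E →L[ℂ] E} (hS : IsContractionSemigroup S)

include hS

theorem nonneg {t : ℝ} (ht : 0 < t) : 0 ≤ S t := by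
  have h := hS.add (t / 2) (t / 2) (by positivity) (by positivity)
  rw [add_halves] at h
  rw [h]
  conv_rhs => enter [1]; rw [← (hS.isSelfAdjoint (t / 2) (by positivity)).star_eq]
  exact star_mul_self_nonneg _

/-- Since `‖S(t/2)x‖² = ⟨x, S(t)x⟩`, a kernel vector of `S(t)` is killed by every `S(t/2ⁿ)`, which
tends strongly to `1`. -/
theorem injective {t : ℝ} (ht : 0 < t) : Function.Injective (S t) := by
  have key : ∀ {s : ℝ}, 0 < s → ∀ x, S s x = 0 → S (s / 2) x = 0 := by
    intro s hs x hx
    have h := hS.add (s / 2) (s / 2) (by positivity) (by positivity)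
    rw [add_halves] at h
    have hsym : ∀ y z, ⟪S (s / 2) y, z⟫_ℂ = ⟪y, S (s / 2) z⟫_ℂ :=
      ContinuousLinearMap.isSelfAdjoint_iff_isSymmetric.1 (hS.isSelfAdjoint (s / 2) (by positivity))
    rw [← inner_self_eq_zero (𝕜 := ℂ), hsym]
    have : S (s / 2) (S (s / 2) x) = 0 := by rw [← hx, h]; rfl
    rw [this, inner_zero_right]
  refine (injective_iff_map_eq_zero (S t)).2 fun x hx => ?_
  have h1 : ∀ n : ℕ, S (t / 2 ^ n) x = 0 := by
    intro n
    induction n with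
    | zero => simpa using hx
    | succ n ih =>
      have := key (by positivity) x ih
      rwa [div_div, ← pow_succ] at this
  have h2 : Tendsto (fun n : ℕ => t / 2 ^ n) atTop (𝓝[>] 0) := by
    refine tendsto_nhdsWithin_iff.2 ⟨?_, Eventually.of_forall fun n => Set.mem_Ioi.2 (by positivity)⟩
    exact tendsto_const_nhds.div_atTop (tendsto_pow_atTop_atTop_of_one_lt one_lt_two)
  have h3 := (hS.tendsto x).comp h2
  refine tendsto_nhds_unique h3 ?_
  simp [Function.comp_def, h1]

/-- Uniqueness of positive square roots settles the times `1/2ⁿ`, the semigroup law all positive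
dyadic times, and strong continuity the rest. Everything about `S` then becomes functional calculus
of the single operator `S 1`. -/
theorem eq_opPow {t : ℝ} (ht : 0 < t) : S t = opPow (S 1) t := by
  have hB := hS.nonneg one_pos
  have hB1 := hS.norm_le 1 one_pos
  have h1 : ∀ n : ℕ, S (1 / 2 ^ n) = opPow (S 1) (1 / 2 ^ n) := by
    intro n
    induction n with
    | zero => simp [opPow_one hB]
    | succ n ih =>
      have e : (1 : ℝ) / 2 ^ n = 1 / 2 ^ (n + 1) + 1 / 2 ^ (n + 1) := by
        rw [pow_succ]; field_simp; norm_num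
      rw [e, hS.add _ _ (by positivity) (by positivity),
        opPow_add hB (by positivity) (by positivity)] at ih
      rw [← CFC.sqrt_unique rfl (hS.nonneg (t := 1 / 2 ^ (n + 1)) (by positivity)),
        ← CFC.sqrt_unique rfl (opPow_nonneg hB (1 / 2 ^ (n + 1))), ih]
  have h2 : ∀ n k : ℕ, S (((k : ℝ) + 1) / 2 ^ n) = opPow (S 1) (((k : ℝ) + 1) / 2 ^ n) := by
    intro n k
    induction k with
    | zero => simpa using h1 n
    | succ k ih =>
      have e : ((k + 1 : ℕ) + 1 : ℝ) / 2 ^ n = ((k : ℝ) + 1) / 2 ^ n + 1 / 2 ^ n := by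
        push_cast; ring
      rw [e, hS.add _ _ (by positivity) (by positivity),
        opPow_add hB (by positivity) (by positivity), ih, h1]
  ext1 x
  -- The dyadic approximation lies strictly above `t`, so that `S(t + δ) = S(t)S(δ)` with `δ > 0`
  -- and only continuity at `0+` is used.
  let δ : ℕ → ℝ := fun n => ((⌊t * 2 ^ n⌋₊ : ℝ) + 1) / 2 ^ n - t
  have hδ0 : ∀ n, 0 < δ n := fun n => by
    simp only [δ]
    rw [sub_pos, lt_div_iff₀ (by positivity)]
    exact Nat.lt_floor_add_one _
  have hδ1 : ∀ n, δ n ≤ 1 / 2 ^ n := fun n => by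
    simp only [δ]
    rw [sub_le_iff_le_add, div_add' _ _ _ (by positivity)]
    refine div_le_div_of_nonneg_right ?_ (by positivity)
    linarith [Nat.floor_le (show 0 ≤ t * 2 ^ n by positivity)]
  have hδ : Tendsto δ atTop (𝓝[>] 0) := by
    refine tendsto_nhdsWithin_iff.2 ⟨?_, Eventually.of_forall fun n => hδ0 n⟩
    refine squeeze_zero (fun n => (hδ0 n).le) hδ1 ?_
    exact tendsto_const_nhds.div_atTop (tendsto_pow_atTop_atTop_of_one_lt one_lt_two)
  have h3 := ((S t).continuous.tendsto x).comp ((hS.tendsto x).comp hδ)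
  have h4 := ((opPow (S 1) t).continuous.tendsto x).comp
    ((tendsto_opPow_apply hB hB1 (hS.injective one_pos) x).comp hδ)
  refine tendsto_nhds_unique h3 (h4.congr fun n => ?_)
  have h5 := h2 n ⌊t * 2 ^ n⌋₊
  have h6 : ((⌊t * 2 ^ n⌋₊ : ℝ) + 1) / 2 ^ n = t + δ n := by simp only [δ]; ring
  rw [h6, hS.add _ _ ht (hδ0 n), opPow_add hB ht (hδ0 n)] at h5
  exact (congrArg (fun A : E →L[ℂ] E => A x) h5).symm

/-- The resolvent of minus the generator at `-r`. -/
theorem tendsto_invLog {r : ℝ} (hr : 0 < r) (y : E) :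
    Tendsto (fun t : ℝ => (t : ℂ)⁻¹ • (cfcₙ (invLog (-r)) (S 1) y -
      S t (cfcₙ (invLog (-r)) (S 1) y))) (𝓝[>] 0)
      (𝓝 (y - (r : ℂ) • cfcₙ (invLog (-r)) (S 1) y)) := by
  set B := S 1 with hBdef
  have hB : 0 ≤ B := hS.nonneg one_pos
  have hB1 : ‖B‖ ≤ 1 := hS.norm_le 1 one_pos
  have hsa : IsSelfAdjoint B := .of_nonneg hB
  have hsub : quasispectrum ℝ B ⊆ Set.Icc 0 1 := quasispectrum_subset_Icc hB hB1
  set R := cfcₙ (invLog (-r)) B with hR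
  have hc : ContinuousOn (invLog (-r)) (quasispectrum ℝ B) := (continuousOn_invLog_Icc hr).mono hsub
  have hD : ∀ t : ℝ, 0 < t → R - S t * R = cfcₙ (fun s : ℝ => (1 - s ^ t) * invLog (-r) s) B := by
    intro t ht
    have e : (fun s : ℝ => (1 - s ^ t) * invLog (-r) s) =
        fun s : ℝ => invLog (-r) s - s ^ t * invLog (-r) s := by ext s; ring
    rw [hS.eq_opPow ht, e, cfcₙ_sub (invLog (-r)) (fun s : ℝ => s ^ t * invLog (-r) s) B hc (by simp)
      ((continuousOn_rpow ht _).mul hc) (by simp), cfcₙ_mul (fun s : ℝ => s ^ t) (invLog (-r)) B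
      (continuousOn_rpow ht _) (Real.zero_rpow ht.ne') hc (by simp), opPow]
  -- The difference quotients are uniformly bounded on the range of `R`, so convergence may be
  -- tested on the dense range of `B`.
  have hbound : ∀ t : ℝ, 0 < t → ‖(t : ℂ)⁻¹ • (R - S t * R)‖ ≤ 1 := by
    intro t ht
    rw [norm_smul, hD t ht, norm_inv, Complex.norm_real, Real.norm_eq_abs, abs_of_pos ht,
      inv_mul_le_iff₀ ht, mul_one]
    refine norm_cfcₙ_le fun s hs => ?_
    obtain ⟨h0, h1⟩ := hsub hs
    rcases h0.eq_or_lt with rfl | h0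
    · simpa using ht.le
    have h2 := one_sub_rpow_le (t := t) h0
    have h4 : s ^ t ≤ 1 := Real.rpow_le_one h0.le h1 ht.le
    have h5 := invLog_nonneg hr h1
    rw [Real.norm_eq_abs, abs_of_nonneg (mul_nonneg (by linarith) h5)]
    calc (1 - s ^ t) * invLog (-r) s ≤ t * -Real.log s * invLog (-r) s :=
          mul_le_mul_of_nonneg_right h2 h5
      _ = t * (-Real.log s * invLog (-r) s) := by ring
      _ ≤ t := mul_le_of_le_one_right ht.le (neg_log_mul_invLog_le hr h0 h1)
  -- The second-order error is at most `t (log s)² invLog(-r)(s) s`. One logarithm is absorbed by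
  -- `invLog`, the other by the factor `s` coming from `B`, which leaves `t`.
  have hconv : ∀ t : ℝ, 0 < t →
      ‖(t : ℂ)⁻¹ • (R - S t * R) * B - (1 - (r : ℂ) • R) * B‖ ≤ t := by
    intro t ht
    have htC : (t : ℂ) ≠ 0 := by exact_mod_cast ht.ne'
    have hBc : cfcₙ (fun s : ℝ => s) B = B := cfcₙ_id' ℝ B
    have e1 : (R - S t * R) * B - (t : ℝ) • ((1 - (r : ℝ) • R) * B) =
        cfcₙ (fun s : ℝ => (1 - s ^ t) * invLog (-r) s * s - t * (s - r * (invLog (-r) s * s))) B := by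
      have c0 : ContinuousOn (fun s : ℝ => s) (quasispectrum ℝ B) := continuousOn_id
      have c1 : ContinuousOn (fun s : ℝ => (1 - s ^ t) * invLog (-r) s) (quasispectrum ℝ B) :=
        (continuousOn_const.sub (continuousOn_rpow ht _)).mul hc
      have c2 : ContinuousOn (fun s : ℝ => invLog (-r) s * s) (quasispectrum ℝ B) :=
        hc.mul c0
      have c3 : ContinuousOn (fun s : ℝ => r * (invLog (-r) s * s)) (quasispectrum ℝ B) :=
        continuousOn_const.mul c2
      rw [cfcₙ_sub (fun s : ℝ => (1 - s ^ t) * invLog (-r) s * s)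
          (fun s => t * (s - r * (invLog (-r) s * s))) B (c1.mul c0)
          (by simp) (continuousOn_const.mul (c0.sub c3)) (by simp),
        cfcₙ_const_mul t (fun s : ℝ => s - r * (invLog (-r) s * s)) B (c0.sub c3) (by simp),
        cfcₙ_sub (fun s : ℝ => s) (fun s => r * (invLog (-r) s * s)) B c0 rfl c3 (by simp),
        cfcₙ_const_mul r (fun s : ℝ => invLog (-r) s * s) B c2 (by simp),
        cfcₙ_mul (invLog (-r)) (fun s => s) B hc (by simp) c0 rfl,
        cfcₙ_mul (fun s : ℝ => (1 - s ^ t) * invLog (-r) s) (fun s => s) B c1 (by simp)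
          c0 rfl, ← hD t ht, hBc, sub_mul 1, one_mul, smul_mul_assoc]
    have e2 : (t : ℂ)⁻¹ • (R - S t * R) * B - (1 - (r : ℂ) • R) * B =
        (t : ℂ)⁻¹ • ((R - S t * R) * B - (t : ℝ) • ((1 - (r : ℝ) • R) * B)) := by
      rw [smul_sub (_ : ℂ) (_ * B), ← Complex.coe_smul t, smul_smul, inv_mul_cancel₀ htC, one_smul,
        ← Complex.coe_smul r, smul_mul_assoc]
    rw [e2, e1, norm_smul, norm_inv, Complex.norm_real, Real.norm_eq_abs, abs_of_pos ht,
      inv_mul_le_iff₀ ht]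
    refine norm_cfcₙ_le fun s hs => ?_
    obtain ⟨h0, h1⟩ := hsub hs
    rcases h0.eq_or_lt with rfl | h0
    · simpa using (mul_pos ht ht).le
    have h2 := one_sub_rpow_le (t := t) h0
    have h3 := le_one_sub_rpow h0 h1 ht.le
    have h5 := invLog_nonneg hr h1
    have h6 := neg_log_mul_invLog_le hr h0 h1
    have h7 := mul_neg_log_le h0
    have h8 := one_sub_mul_invLog hr h0 h1
    have hl : 0 ≤ -Real.log s := by linarith [Real.log_nonpos h0.le h1]
    have e3 : (1 - s ^ t) * invLog (-r) s * s - t * (s - r * (invLog (-r) s * s)) =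
        (1 - s ^ t - t * -Real.log s) * (invLog (-r) s * s) := by
      have : s - r * (invLog (-r) s * s) = s * (1 - r * invLog (-r) s) := by ring
      rw [this, h8]; ring
    rw [e3, Real.norm_eq_abs, abs_mul, abs_of_nonneg (mul_nonneg h5 h0.le), abs_sub_comm,
      abs_of_nonneg (by linarith)]
    calc (t * -Real.log s - (1 - s ^ t)) * (invLog (-r) s * s)
        ≤ (t * -Real.log s) ^ 2 * (invLog (-r) s * s) :=
          mul_le_mul_of_nonneg_right (by linarith) (mul_nonneg h5 h0.le)
      _ = t * t * ((-Real.log s * invLog (-r) s) * (s * -Real.log s)) := by ring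
      _ ≤ t * t := mul_le_of_le_one_right (mul_pos ht ht).le
          (mul_le_one₀ h6 (mul_nonneg h0.le hl) h7)
  refine tendsto_apply_of_denseRange (T := fun t : ℝ => (t : ℂ)⁻¹ • (R - S t * R))
    (T₀ := 1 - (r : ℂ) • R) (C := 1) (f := B) ?_
    (denseRange_of_isSelfAdjoint hsa (hS.injective one_pos)) (fun w => ?_) y
  · filter_upwards [self_mem_nhdsWithin] with t ht using hbound t ht
  · rw [tendsto_iff_norm_sub_tendsto_zero]
    refine squeeze_zero' (g := fun t : ℝ => t * ‖w‖) (Eventually.of_forall fun _ => norm_nonneg _)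
      ?_ ?_
    · filter_upwards [self_mem_nhdsWithin] with t ht
      exact ((t : ℂ)⁻¹ • (R - S t * R) * B - (1 - (r : ℂ) • R) * B).le_of_opNorm_le (hconv t ht) w
    · have : Continuous fun t : ℝ => t * ‖w‖ := by fun_prop
      simpa using (this.tendsto 0).mono_left nhdsWithin_le_nhds

theorem isResolventAt {r : ℝ} (hr : 0 < r) :
    IsResolventAt (negGenerator S) ((-r : ℝ) : ℂ) (cfcₙ (invLog (-r)) (S 1)) := by
  refine ⟨fun y => ?_, fun x => ?_⟩
  · have h := hS.tendsto_invLog hr y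
    have hmem : cfcₙ (invLog (-r)) (S 1) y ∈ (negGenerator S).domain := ⟨_, h⟩
    refine ⟨hmem, ?_⟩
    rw [negGenerator_apply_eq hmem h]
    simp
  · have h1 := hS.tendsto_invLog hr (x : E)
    have h2 := ((cfcₙ (invLog (-r)) (S 1)).continuous.tendsto _).comp (tendsto_negGenerator x)
    -- `R` commutes with `S t`, so applying it to the difference quotients of `x` gives the
    -- difference quotients of `Rx`, whose limit is already known.
    have h3 : cfcₙ (invLog (-r)) (S 1) (negGenerator S x) =
        (x : E) - (r : ℂ) • cfcₙ (invLog (-r)) (S 1) (x : E) := by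
      refine tendsto_nhds_unique h2 (h1.congr' ?_)
      filter_upwards [self_mem_nhdsWithin] with t ht
      have hcomm : S t * cfcₙ (invLog (-r)) (S 1) = cfcₙ (invLog (-r)) (S 1) * S t := by
        rw [hS.eq_opPow (Set.mem_Ioi.1 ht)]
        exact cfcₙ_commute_cfcₙ _ _ _
      have hcx := congrArg (fun A : E →L[ℂ] E => A (x : E)) hcomm
      simp only [mul_apply_eq_comp] at hcx
      rw [Function.comp_apply, map_smul, map_sub, hcx]
    rw [map_sub, h3, map_smul]
    simp

theorem cfcₙ_invLog_nonneg {r : ℝ} (hr : 0 < r) : 0 ≤ cfcₙ (invLog (-r)) (S 1) :=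
  cfcₙ_nonneg fun _ hs => invLog_nonneg hr
    (quasispectrum_subset_Icc (hS.nonneg one_pos) (hS.norm_le 1 one_pos) hs).2

/-- The exponential is `expInv (-1) 1` of the resolvent `invLog (-1) (S 1)`, and these two functions
are inverse to each other on `[0, 1]`. -/
theorem expNeg_one_negGenerator : expNeg 1 (negGenerator S) = S 1 := by
  have hB : 0 ≤ S 1 := hS.nonneg one_pos
  have hsub : quasispectrum ℝ (S 1) ⊆ Set.Icc 0 1 :=
    quasispectrum_subset_Icc hB (hS.norm_le 1 one_pos)
  have hsa : IsSelfAdjoint (S 1) := .of_nonneg hB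
  rw [expNeg_eq_cfcₙ (hS.isResolventAt one_pos) (hS.cfcₙ_invLog_nonneg one_pos) one_pos,
    ← cfcₙ_comp' (expInv (-1) 1) (invLog (-1)) (S 1) ?_ (by simp)
      ((continuousOn_invLog_Icc one_pos).mono hsub) (by simp)]
  · conv_rhs => rw [← cfcₙ_id' ℝ (S 1)]
    exact cfcₙ_congr fun s hs => expInv_invLog one_pos (hsub hs).1 (hsub hs).2
  · refine (continuousOn_expInv (-1) one_pos).mono ?_
    rintro _ ⟨s, hs, rfl⟩
    exact invLog_nonneg one_pos (hsub hs).2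

theorem inner_negGenerator_nonneg (x : (negGenerator S).domain) :
    0 ≤ (⟪(x : E), negGenerator S x⟫_ℂ).re := by
  have h : Tendsto (fun t : ℝ => (⟪(x : E), (t : ℂ)⁻¹ • ((x : E) - S t x)⟫_ℂ).re) (𝓝[>] 0)
      (𝓝 (⟪(x : E), negGenerator S x⟫_ℂ).re) :=
    (Complex.continuous_re.tendsto _).comp (tendsto_const_nhds.inner (tendsto_negGenerator x))
  refine ge_of_tendsto h ?_
  filter_upwards [self_mem_nhdsWithin] with t ht
  rw [inner_smul_right, ← Complex.ofReal_inv, Complex.re_ofReal_mul, inner_sub_right,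
    Complex.sub_re]
  refine mul_nonneg (inv_nonneg.2 (le_of_lt ht)) (sub_nonneg.2 ?_)
  calc (⟪(x : E), S t x⟫_ℂ).re ≤ ‖(x : E)‖ * ‖S t x‖ := re_inner_le_norm (𝕜 := ℂ) _ _
    _ ≤ ‖(x : E)‖ * ‖(x : E)‖ := mul_le_mul_of_nonneg_left
        (by simpa using (S t).le_of_opNorm_le (hS.norm_le t ht) (x : E)) (norm_nonneg _)
    _ = (⟪(x : E), (x : E)⟫_ℂ).re := (inner_self_eq_norm_mul_norm (𝕜 := ℂ) (x : E)).symm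

end IsContractionSemigroup

end Semigroups

/-! ### The correspondence between `h` and `e^{-h}`, and its second quantization. -/

section SecondQuantization

variable {E : Type*} [NormedAddCommGroup E] [InnerProductSpace ℂ E] [CompleteSpace E]

/-- The operators that vanish at `x` together with their adjoints. -/
def annihilatorAt (x : E) : NonUnitalStarSubalgebra ℂ (E →L[ℂ] E) where
  carrier := {X | X x = 0 ∧ star X x = 0}
  zero_mem' := by simp
  add_mem' := by rintro a b ⟨h1, h2⟩ ⟨h3, h4⟩; simp [h1, h2, h3, h4]
  smul_mem' := by rintro c a ⟨h1, h2⟩; simp [h1, h2]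
  mul_mem' := by rintro a b ⟨h1, h2⟩ ⟨h3, h4⟩; simp [h2, h3]
  star_mem' := by rintro a ⟨h1, h2⟩; simp [h1, h2]

theorem isClosed_annihilatorAt (x : E) : IsClosed (annihilatorAt x : Set (E →L[ℂ] E)) := by
  have h : (annihilatorAt x : Set (E →L[ℂ] E)) =
      {X : E →L[ℂ] E | X x = 0} ∩ {X : E →L[ℂ] E | star X x = 0} := rfl
  rw [h]
  exact (isClosed_eq (by fun_prop) continuous_const).inter
    (isClosed_eq (by fun_prop) continuous_const)

/-- The operators annihilating `x` together with their adjoints form a closed star algebra, which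
contains `f(A)` as soon as it contains `A`. -/
theorem cfcₙ_apply_eq_zero {A : E →L[ℂ] E} (hA : IsSelfAdjoint A) (f : ℝ → ℝ) {x : E}
    (hx : A x = 0) : cfcₙ f A x = 0 := by
  have := isClosed_annihilatorAt x
  have h : cfcₙ f A ∈ annihilatorAt x :=
    cfcₙ_mem f (show A ∈ annihilatorAt x from ⟨hx, by rw [hA.star_eq]; exact hx⟩)
  exact h.1

/-- Everything but injectivity rests on `m‖By‖² ≤ Re⟨By, y⟩`. -/
theorem IsResolventAt.nonneg_of_le {h : E →ₗ.[ℂ] E} {B : E →L[ℂ] E} (hB : IsResolventAt h 0 B)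
    (hsa : IsSelfAdjoint h) {m : ℝ} (hm : 0 < m)
    (hlow : ∀ x : h.domain, m * ‖(x : E)‖ ^ 2 ≤ (⟪(x : E), h x⟫_ℂ).re) :
    0 ≤ B ∧ ‖B‖ ≤ m⁻¹ ∧ Function.Injective B := by
  have hBsa : IsSelfAdjoint B := by
    have hB' : IsResolventAt h ((0 : ℝ) : ℂ) B := by simpa using hB
    exact hB'.isSelfAdjoint hsa
  have key : ∀ y, m * ‖B y‖ ^ 2 ≤ (⟪B y, y⟫_ℂ).re := fun y => by
    obtain ⟨hy, e⟩ := hB.1 y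
    have := hlow ⟨B y, hy⟩
    rw [zero_smul, sub_zero] at e
    rwa [e] at this
  refine ⟨?_, ?_, ?_⟩
  · rw [ContinuousLinearMap.nonneg_iff_isPositive]
    refine ContinuousLinearMap.isPositive_def'.2 ⟨hBsa, fun y => ?_⟩
    exact (by positivity : 0 ≤ m * ‖B y‖ ^ 2).trans (key y)
  · refine ContinuousLinearMap.opNorm_le_bound _ (by positivity) fun y => ?_
    have h1 : (⟪B y, y⟫_ℂ).re ≤ ‖B y‖ * ‖y‖ := re_inner_le_norm (𝕜 := ℂ) _ _
    by_cases h0 : ‖B y‖ = 0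
    · rw [h0]; positivity
    have h2 : 0 < ‖B y‖ := lt_of_le_of_ne (norm_nonneg _) (Ne.symm h0)
    have h3 := key y
    rw [← div_eq_inv_mul, le_div_iff₀ hm]
    nlinarith
  · refine (injective_iff_map_eq_zero B).2 fun y hy => ?_
    obtain ⟨h1, e⟩ := hB.1 y
    have h2 : h ⟨B y, h1⟩ = 0 := by
      have : (⟨B y, h1⟩ : h.domain) = 0 := Subtype.ext hy
      rw [this, LinearPMap.map_zero]
    rw [← e, h2, zero_smul, sub_zero]

/-- Properties of `A = exp(-h)` for `h` with positive injective inverse `B`. -/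
theorem expNeg_one_properties {h : E →ₗ.[ℂ] E} {B : E →L[ℂ] E} (hB : IsResolventAt h 0 B)
    (hB0 : 0 ≤ B) {m : ℝ} (hm : 0 < m) (hBm : ‖B‖ ≤ m⁻¹) (hinj : Function.Injective B) :
    0 ≤ expNeg 1 h ∧ ‖expNeg 1 h‖ < 1 ∧ Function.Injective (expNeg 1 h) ∧
      (∀ t, 0 < t → expNeg t h = opPow (expNeg 1 h) t) := by
  have hB' : IsResolventAt h ((0 : ℝ) : ℂ) B := by simpa using hB
  have hsa : IsSelfAdjoint B := .of_nonneg hB0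
  have hE : ∀ t, 0 < t → expNeg t h = cfcₙ (expInv 0 t) B := fun t ht => expNeg_eq_cfcₙ hB' hB0 ht
  have hA0 : 0 ≤ expNeg 1 h := by
    rw [hE 1 one_pos]
    exact cfcₙ_nonneg fun _ _ => expInv_nonneg _ _ _
  refine ⟨hA0, ?_, ?_, ?_⟩
  · rw [hE 1 one_pos]
    refine lt_of_le_of_lt (norm_cfcₙ_le (c := Real.exp (-m)) fun s hs => ?_)
      (by rw [← Real.exp_zero]; exact Real.exp_lt_exp.2 (by linarith))
    obtain ⟨h0, h1⟩ := quasispectrum_subset_Icc hB0 hBm hs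
    rw [Real.norm_eq_abs, abs_of_nonneg (expInv_nonneg _ _ _)]
    rcases h0.eq_or_lt with rfl | h0
    · simpa using (Real.exp_pos _).le
    rw [expInv_of_ne h0.ne']
    refine Real.exp_le_exp.2 ?_
    have : m ≤ s⁻¹ := by rwa [le_inv_comm₀ hm h0]
    linarith
  -- `B` is a function of `e^{-h}` vanishing at `0`, so it kills every vector that `e^{-h}` kills.
  · refine (injective_iff_map_eq_zero _).2 fun x hx => ?_
    have h1 := cfcₙ_apply_eq_zero (IsSelfAdjoint.of_nonneg hA0) (invLog 0) hx
    rw [invLog_cfcₙ_expNeg hB' hB0] at h1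
    exact hinj (by rw [h1, map_zero])
  · intro t ht
    rw [hE t ht, hE 1 one_pos, opPow, ← cfcₙ_comp' (fun s : ℝ => s ^ t) (expInv 0 1) B
      (continuousOn_rpow ht _) (Real.zero_rpow ht.ne')
      ((continuousOn_expInv 0 one_pos).mono fun s hs => quasispectrum_nonneg' hB0 hs) (by simp)]
    refine cfcₙ_congr fun s hs => ?_
    rcases (quasispectrum_nonneg' hB0 hs).eq_or_lt with rfl | h0
    · simp [Real.zero_rpow ht.ne']
    rw [expInv_of_ne h0.ne', expInv_of_ne h0.ne', ← Real.exp_mul]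
    congr 1
    ring

theorem isContractionSemigroup_opPow {A : E →L[ℂ] E} (hA : 0 ≤ A) (hA1 : ‖A‖ ≤ 1)
    (hinj : Function.Injective A) : IsContractionSemigroup (opPow A) where
  isSelfAdjoint t _ := .of_nonneg (opPow_nonneg hA t)
  norm_le t ht := by simpa using norm_opPow_le hA hA1 ht
  add s t hs ht := opPow_add hA hs ht
  tendsto x := tendsto_opPow_apply hA hA1 hinj x

/-- Every positive injective `A` of norm `< 1` is of the form `exp(-h)` with `h ≥ m > 0`. -/
theorem exists_expNeg_eq {A : E →L[ℂ] E} (hA : 0 ≤ A) (hA1 : ‖A‖ < 1)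
    (hinj : Function.Injective A) :
    ∃ h : E →ₗ.[ℂ] E, IsSelfAdjoint h ∧
      (∃ m : ℝ, 0 < m ∧ ∀ x : h.domain, m * ‖(x : E)‖ ^ 2 ≤ (⟪(x : E), h x⟫_ℂ).re) ∧
      IsResolventAt h 0 (cfcₙ (invLog 0) A) ∧ expNeg 1 h = A := by
  have hS := isContractionSemigroup_opPow hA hA1.le hinj
  have hAsa : IsSelfAdjoint A := .of_nonneg hA
  have hres := hS.isResolventAt one_pos
  have hres0 := hS.cfcₙ_invLog_nonneg one_pos
  have hexp := hS.expNeg_one_negGenerator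
  rw [opPow_one hA] at hres hres0 hexp
  -- The lower bound will be `m = -log c`; choosing `c > ‖A‖` keeps the logarithm meaningful even if
  -- `A = 0`.
  obtain ⟨c, hc0, hc1⟩ : ∃ c, ‖A‖ < c ∧ c < 1 := exists_between hA1
  have hcpos : 0 < c := (norm_nonneg _).trans_lt hc0
  have hlog : 0 < -Real.log c := by linarith [Real.log_neg hcpos hc1]
  refine ⟨negGenerator (opPow A), hres.isSelfAdjoint_of_isSelfAdjoint (.of_nonneg hres0),
    ⟨-Real.log c, hlog, fun x => ?_⟩, ?_, hexp⟩
  · have h1 : Tendsto (fun t : ℝ => (⟪(x : E), (t : ℂ)⁻¹ • ((x : E) - opPow A t x)⟫_ℂ).re)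
        (𝓝[>] 0) (𝓝 (⟪(x : E), negGenerator (opPow A) x⟫_ℂ).re) :=
      (Complex.continuous_re.tendsto _).comp (tendsto_const_nhds.inner (tendsto_negGenerator x))
    have h2 : Tendsto (fun t : ℝ => (-Real.log c - t * (-Real.log c) ^ 2) * ‖(x : E)‖ ^ 2)
        (𝓝[>] 0) (𝓝 (-Real.log c * ‖(x : E)‖ ^ 2)) := by
      have : Continuous fun t : ℝ => (-Real.log c - t * (-Real.log c) ^ 2) * ‖(x : E)‖ ^ 2 := by
        fun_prop
      simpa using (this.tendsto 0).mono_left nhdsWithin_le_nhds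
    refine le_of_tendsto_of_tendsto h2 h1 ?_
    filter_upwards [self_mem_nhdsWithin] with t ht
    have ht' : 0 < t := ht
    rw [inner_smul_right, ← Complex.ofReal_inv, Complex.re_ofReal_mul, inner_sub_right,
      Complex.sub_re, ← div_eq_inv_mul, le_div_iff₀ ht']
    have h3 : (⟪(x : E), opPow A t x⟫_ℂ).re ≤ c ^ t * ‖(x : E)‖ ^ 2 := by
      calc _ ≤ ‖(x : E)‖ * ‖opPow A t x‖ := re_inner_le_norm (𝕜 := ℂ) _ _
        _ ≤ ‖(x : E)‖ * (c ^ t * ‖(x : E)‖) := mul_le_mul_of_nonneg_left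
          ((opPow A t).le_of_opNorm_le (norm_opPow_le hA hc0.le ht') _) (norm_nonneg _)
        _ = _ := by ring
    have h4 : (⟪(x : E), (x : E)⟫_ℂ).re = ‖(x : E)‖ ^ 2 := inner_self_eq_norm_sq (𝕜 := ℂ) (x : E)
    have h5 := le_one_sub_rpow hcpos hc1.le ht'.le
    rw [h4]
    nlinarith [mul_le_mul_of_nonneg_right h5 (sq_nonneg ‖(x : E)‖)]
  · have hsub := quasispectrum_subset_Icc hA hc0.le
    have hlt : ∀ s ∈ quasispectrum ℝ A, s = 0 ∨ (0 < s ∧ 0 < -Real.log s) := by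
      intro s hs
      obtain ⟨h0, h1⟩ := hsub hs
      rcases h0.eq_or_lt with h0 | h0
      · exact Or.inl h0.symm
      · exact Or.inr ⟨h0, by linarith [Real.log_neg h0 (h1.trans_lt hc1)]⟩
    have c0 : ContinuousOn (invLog 0) (quasispectrum ℝ A) := (continuousOn_invLog 0).mono hlt
    have c1 : ContinuousOn (invLog (-1)) (quasispectrum ℝ A) :=
      (continuousOn_invLog_Icc one_pos).mono fun s hs => ⟨(hsub hs).1, (hsub hs).2.trans hc1.le⟩
    -- The general semigroup result reaches only strictly negative points. The scalar identity `1/l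
    -- = 1/(l+1) + 1/((l+1)l)` with `l = -log s` moves the resolvent from `-1` to `0`.
    have e : cfcₙ (invLog 0) A = cfcₙ (invLog (-1)) A +
        cfcₙ (invLog (-1)) A * cfcₙ (invLog 0) A := by
      rw [← cfcₙ_mul (invLog (-1)) (invLog 0) A c1 (by simp) c0 (by simp),
        ← cfcₙ_add (invLog (-1)) (fun s => invLog (-1) s * invLog 0 s) A c1 (by simp) (c1.mul c0)
        (by simp)]
      refine cfcₙ_congr fun s hs => ?_
      rcases hlt s hs with rfl | ⟨h0, h1⟩
      · simp
      rw [invLog_of_pos h0, invLog_of_pos h0, sub_zero]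
      have h2 : Real.log s ≠ 0 := by linarith
      have h3 : -Real.log s - -1 ≠ 0 := by linarith
      field_simp
      ring
    have hz : (0 : ℂ) - ((-1 : ℝ) : ℂ) = 1 := by simp
    refine hres.of_mul_eq ?_ ?_
    · rw [hz, one_smul]; exact e
    · rw [hz, one_smul, (cfcₙ_commute_cfcₙ (invLog 0) (invLog (-1)) A).eq]; exact e

variable {H : Type*} [NormedAddCommGroup H] [InnerProductSpace ℂ H] [CompleteSpace H]

/-- The semigroup `Γ(exp(-t h))`. -/
theorem isContractionSemigroup_Gam {h : H →ₗ.[ℂ] H} (hA : 0 ≤ expNeg 1 h)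
    (hA1 : ‖expNeg 1 h‖ < 1) (hinj : Function.Injective (expNeg 1 h))
    (hpow : ∀ t, 0 < t → expNeg t h = opPow (expNeg 1 h) t) :
    IsContractionSemigroup fun t => Gam (expNeg t h) := by
  have hS := isContractionSemigroup_opPow hA hA1.le hinj
  refine ⟨fun t ht => ?_, fun t ht => ?_, fun s t hs ht => ?_, fun x => ?_⟩
  · rw [hpow t ht, isSelfAdjoint_iff, star_Gam (hS.norm_le t ht), (hS.isSelfAdjoint t ht).star_eq]
  · rw [hpow t ht]; exact norm_Gam_le (hS.norm_le t ht)
  · rw [hpow t ht, hpow s hs, hpow _ (add_pos hs ht), hS.add s t hs ht,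
      Gam_mul (hS.norm_le s hs) (hS.norm_le t ht)]
  · have h1 : Tendsto (fun t => Gam (opPow (expNeg 1 h) t) x) (𝓝[>] 0) (𝓝 (Gam 1 x)) := by
      refine tendsto_Gam_apply ?_ ContinuousLinearMap.norm_id_le (fun v => hS.tendsto v) x
      filter_upwards [self_mem_nhdsWithin] with t ht using hS.norm_le t ht
    rw [Gam_one] at h1
    refine h1.congr' ?_
    filter_upwards [self_mem_nhdsWithin] with t ht
    rw [hpow t ht]

/-- Properties of `dΓ(h)` for `h ≥ m > 0`. -/
theorem dGam_properties {h : H →ₗ.[ℂ] H} {B : H →L[ℂ] H} (hB : IsResolventAt h 0 B)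
    (hsa : IsSelfAdjoint h)
    (hlow : ∃ m : ℝ, 0 < m ∧ ∀ x : h.domain, m * ‖(x : H)‖ ^ 2 ≤ (⟪(x : H), h x⟫_ℂ).re)
    {𝒪 : NonUnitalStarSubalgebra ℂ (H →L[ℂ] H)} (h𝒪 : IsClosed (𝒪 : Set (H →L[ℂ] H)))
    (hBO : B ∈ 𝒪) :
    expNeg 1 h ∈ 𝒪 ∧ ‖expNeg 1 h‖ < 1 ∧ 0 ≤ Gam (expNeg 1 h) ∧ ‖Gam (expNeg 1 h)‖ ≤ 1 ∧
    (∀ x : (dGam h).domain, 0 ≤ (⟪(x : Fock H), dGam h x⟫_ℂ).re) ∧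
    expNeg 1 (dGam h) = Gam (expNeg 1 h) ∧
    ∀ r : ℝ, 0 < r → IsResolventAt (dGam h) ((-r : ℝ) : ℂ) (cfcₙ (invLog (-r)) (Gam (expNeg 1 h))) ∧
      0 ≤ cfcₙ (invLog (-r)) (Gam (expNeg 1 h)) := by
  obtain ⟨m, hm, hlow⟩ := hlow
  obtain ⟨hB0, hBm, hBi⟩ := hB.nonneg_of_le hsa hm hlow
  obtain ⟨hA0, hA1, hAi, hpow⟩ := expNeg_one_properties hB hB0 hm hBm hBi
  have hS := isContractionSemigroup_Gam hA0 hA1 hAi hpow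
  have hB' : IsResolventAt h ((0 : ℝ) : ℂ) B := by simpa using hB
  exact ⟨(expNeg_mem_iff hB' hB0 h𝒪).2 hBO, hA1, hS.nonneg one_pos, hS.norm_le 1 one_pos,
    hS.inner_negGenerator_nonneg, hS.expNeg_one_negGenerator,
    fun r hr => ⟨hS.isResolventAt hr, hS.cfcₙ_invLog_nonneg hr⟩⟩

end SecondQuantization

/-! ### Resolvents of elementary Hamiltonians belong to the field algebra. -/

section ResolventsInFieldAlgebra

theorem mkQ_eq_zero_of_mem {G : Type*} [AddCommGroup G] [Module ℂ G] {p : Submodule ℂ G} {x : G}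
    (hx : x ∈ p) : p.mkQ x = 0 := by simpa using hx

/-- A Bochner integral of a function with values in a closed subspace lies in that subspace. -/
theorem integral_mem_of_isClosed {X G : Type*} [MeasurableSpace X] {μ : Measure X}
    [NormedAddCommGroup G] [NormedSpace ℂ G] [CompleteSpace G] {p : Submodule ℂ G}
    (hp : IsClosed (p : Set G)) {g : X → G} (hg : Integrable g μ) (h : ∀ x, g x ∈ p) :
    ∫ x, g x ∂μ ∈ p := by
  have := hp
  have h1 := (p.mkQL).integral_comp_comm hg
  have h2 : (fun x => p.mkQL (g x)) = fun _ => 0 := funext fun x => mkQ_eq_zero_of_mem (h x)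
  rw [h2, integral_zero] at h1
  simpa using h1.symm

variable {E : Type*} [NormedAddCommGroup E] [InnerProductSpace ℂ E] [CompleteSpace E]

/-- The elements `X` of an algebra such that `V X` and `V X*` are in the algebra. -/
def mulPreimage (𝒜 : NonUnitalStarSubalgebra ℂ (E →L[ℂ] E)) (V : E →L[ℂ] E) :
    NonUnitalStarSubalgebra ℂ (E →L[ℂ] E) where
  carrier := {X | X ∈ 𝒜 ∧ V * X ∈ 𝒜 ∧ V * star X ∈ 𝒜}
  zero_mem' := by simp [zero_mem]
  add_mem' := by
    rintro a b ⟨h1, h2, h3⟩ ⟨h4, h5, h6⟩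
    refine ⟨add_mem h1 h4, ?_, ?_⟩
    · rw [mul_add]; exact add_mem h2 h5
    · rw [star_add, mul_add]; exact add_mem h3 h6
  smul_mem' := by
    rintro c a ⟨h1, h2, h3⟩
    refine ⟨SMulMemClass.smul_mem c h1, ?_, ?_⟩
    · rw [mul_smul_comm]; exact SMulMemClass.smul_mem c h2
    · rw [star_smul, mul_smul_comm]; exact SMulMemClass.smul_mem _ h3
  mul_mem' := by
    rintro a b ⟨h1, h2, h3⟩ ⟨h4, h5, h6⟩
    refine ⟨mul_mem h1 h4, ?_, ?_⟩
    · rw [← mul_assoc]; exact mul_mem h2 h4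
    · rw [star_mul, ← mul_assoc]; exact mul_mem h6 (star_mem h1)
  star_mem' := by
    rintro a ⟨h1, h2, h3⟩
    exact ⟨star_mem h1, h3, by rwa [star_star]⟩

theorem isClosed_mulPreimage {𝒜 : NonUnitalStarSubalgebra ℂ (E →L[ℂ] E)}
    (h𝒜 : IsClosed (𝒜 : Set (E →L[ℂ] E))) (V : E →L[ℂ] E) :
    IsClosed (mulPreimage 𝒜 V : Set (E →L[ℂ] E)) := by
  have h : (mulPreimage 𝒜 V : Set (E →L[ℂ] E)) = (𝒜 : Set (E →L[ℂ] E)) ∩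
      ((fun X : E →L[ℂ] E => V * X) ⁻¹' (𝒜 : Set (E →L[ℂ] E)) ∩
        (fun X : E →L[ℂ] E => V * star X) ⁻¹' (𝒜 : Set (E →L[ℂ] E))) := rfl
  rw [h]
  exact h𝒜.inter ((h𝒜.preimage (by fun_prop)).inter (h𝒜.preimage (by fun_prop)))

/-- `V` itself need not lie in `𝒜`. The elements that `V` multiplies into `𝒜`, adjoints included,
form a closed star algebra, and that algebra is stable under functional calculus. -/
theorem mul_cfcₙ_mem {𝒜 : NonUnitalStarSubalgebra ℂ (E →L[ℂ] E)}
    (h𝒜 : IsClosed (𝒜 : Set (E →L[ℂ] E))) {V B : E →L[ℂ] E} (hB : IsSelfAdjoint B)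
    (hBm : B ∈ 𝒜) (hVB : V * B ∈ 𝒜) (f : ℝ → ℝ) : V * cfcₙ f B ∈ 𝒜 := by
  have := isClosed_mulPreimage h𝒜 V
  have h : cfcₙ f B ∈ mulPreimage 𝒜 V :=
    cfcₙ_mem f (show B ∈ mulPreimage 𝒜 V from ⟨hBm, hVB, by rwa [hB.star_eq]⟩)
  exact h.2.1

/-- Neumann series; the factor `R` brings its zeroth term into the non-unital algebra. -/
theorem mul_inverse_one_add_mem {𝒜 : NonUnitalStarSubalgebra ℂ (E →L[ℂ] E)}
    (h𝒜 : IsClosed (𝒜 : Set (E →L[ℂ] E))) {R X : E →L[ℂ] E} (hR : R ∈ 𝒜) (hX : X ∈ 𝒜)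
    (hX1 : ‖X‖ < 1) : R * Ring.inverse (1 + X) ∈ 𝒜 := by
  have hlt : ‖-X‖ < 1 := by rwa [norm_neg]
  have h1 := (summable_geometric_of_norm_lt_one hlt).hasSum.mul_left R
  rw [geom_series_eq_inverse _ hlt, sub_neg_eq_add] at h1
  have hpow : ∀ n : ℕ, R * (-X) ^ n ∈ 𝒜 := by
    intro n
    induction n with
    | zero => simpa using hR
    | succ n ih => rw [pow_succ, ← mul_assoc]; exact mul_mem ih (neg_mem hX)
  exact h𝒜.mem_of_tendsto h1 (Eventually.of_forall fun s => sum_mem fun i _ => hpow i)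

variable {H : Type*} [NormedAddCommGroup H] [InnerProductSpace ℂ H]

theorem borel_secondCountable (E : Submodule ℝ H) [FiniteDimensional ℝ E] :
    SecondCountableTopology E := by
  have : ProperSpace E := FiniteDimensional.proper ℝ E
  infer_instance

/-- `W(f) Γ(A)` is a norm convergent integral. -/
theorem IsWeylIntegral.mul_Gam {E : Submodule ℝ H} [FiniteDimensional ℝ E] {f : E → ℂ}
    {V : Fock H →L[ℂ] Fock H} (hV : IsWeylIntegral E f V) {A : H →L[ℂ] H} (hA : ‖A‖ < 1) :
    letI : MeasurableSpace E := borel E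
    Integrable (fun u : E => f u • (weyl (u : H) * Gam A)) (euclideanMeasure E) ∧
    V * Gam A = ∫ u : E, f u • (weyl (u : H) * Gam A) ∂(euclideanMeasure E) := by
  let _ : MeasurableSpace E := borel E
  have : BorelSpace E := ⟨rfl⟩
  have := borel_secondCountable E
  obtain ⟨hf, hV⟩ := hV
  have hi : Integrable (fun u : E => f u • (weyl (u : H) * Gam A)) (euclideanMeasure E) := by
    refine hf.smul_bdd (f := fun u : E => weyl (u : H) * Gam A) 1 ?_
      (Eventually.of_forall fun u => ?_)
    -- Norm continuity, obtained from the factor `Γ(A)`, makes the integrand Bochner measurable in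
    -- operator norm.
    · exact ((continuous_weyl_mul_Gam hA).comp continuous_subtype_val).aestronglyMeasurable
    · exact (norm_mul_le _ _).trans (mul_le_one₀ (norm_weyl_le _) (norm_nonneg _)
        (norm_Gam_le hA.le))
  refine ⟨hi, ?_⟩
  ext1 ψ
  rw [ContinuousLinearMap.integral_apply hi, mul_apply_eq_comp, hV]
  rfl

variable [CompleteSpace H]

theorem weyl_mul_Gam_mem_fieldAlgebra {𝒪 : NonUnitalStarSubalgebra ℂ (H →L[ℂ] H)}
    {A : H →L[ℂ] H} (hA : A ∈ 𝒪) (hA1 : ‖A‖ < 1) (u : H) : weyl u * Gam A ∈ fieldAlgebra 𝒪 :=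
  subset_cstarGen _ ⟨u, A, hA, hA1, rfl⟩

theorem IsWeylIntegral.mul_Gam_mem {𝒪 : NonUnitalStarSubalgebra ℂ (H →L[ℂ] H)}
    {E : Submodule ℝ H} [FiniteDimensional ℝ E] {f : E → ℂ}
    {V : Fock H →L[ℂ] Fock H} (hV : IsWeylIntegral E f V) {A : H →L[ℂ] H} (hA : A ∈ 𝒪)
    (hA1 : ‖A‖ < 1) : V * Gam A ∈ fieldAlgebra 𝒪 := by
  let _ : MeasurableSpace E := borel E
  obtain ⟨h1, h2⟩ := hV.mul_Gam hA1
  rw [h2]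
  refine integral_mem_of_isClosed (p := (fieldAlgebra 𝒪).toNonUnitalSubalgebra.toSubmodule)
    (isClosed_cstarGen _) h1 fun u => ?_
  exact SMulMemClass.smul_mem (s := fieldAlgebra 𝒪) (f u) (weyl_mul_Gam_mem_fieldAlgebra hA hA1 _)

/-- An elementary quantum field Hamiltonian is bounded from below and its resolvents are in the
field algebra. -/
theorem IsElementaryQFHOn.exists_resolvent {𝒪 : NonUnitalStarSubalgebra ℂ (H →L[ℂ] H)}
    (h𝒪 : IsClosed (𝒪 : Set (H →L[ℂ] H))) {E : Submodule ℝ H} [FiniteDimensional ℝ E]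
    {K : Fock H →ₗ.[ℂ] Fock H} (hK : IsElementaryQFHOn 𝒪 E K) :
    ∃ (r : ℝ) (R : Fock H →L[ℂ] Fock H), IsResolventAt K r R ∧ 0 ≤ R ∧ R ∈ fieldAlgebra 𝒪 := by
  obtain ⟨-, h, f, V, hsa, hlow, ⟨B, hBO, hB⟩, hVf, hV, rfl⟩ := hK
  obtain ⟨hA, hA1, hG0, -, hpos, -, hres⟩ := dGam_properties hB hsa hlow h𝒪 hBO
  set A := expNeg 1 h
  -- Any `r > ‖V‖` serves: the Neumann series converges and the resolvent at `-r` is positive.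
  set r := ‖V‖ + 1
  have hr : 0 < r := by positivity
  obtain ⟨hR0, hR0pos⟩ := hres r hr
  set R₀ := cfcₙ (invLog (-r)) (Gam A)
  obtain ⟨h1, h2, h3⟩ := isResolventAt_add hR0 (.of_nonneg hR0pos) hpos hV (lt_add_one ‖V‖)
  have hF : IsClosed (fieldAlgebra 𝒪 : Set (Fock H →L[ℂ] Fock H)) := isClosed_cstarGen _
  have hGA : Gam A ∈ fieldAlgebra 𝒪 := by
    simpa [weyl_zero] using weyl_mul_Gam_mem_fieldAlgebra hA hA1 0
  refine ⟨-r, _, h2, h3, mul_inverse_one_add_mem hF ?_ ?_ h1⟩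
  · have := hF
    exact cfcₙ_mem (s := fieldAlgebra 𝒪) _ hGA
  · exact mul_cfcₙ_mem hF (.of_nonneg hG0) hGA (hVf.mul_Gam_mem hA hA1) _

end ResolventsInFieldAlgebra

/-! ### Calculus of the integrals `W(f)`. -/

section WeylIntegrals

variable {H : Type*} [NormedAddCommGroup H] [InnerProductSpace ℂ H]
  {E : Submodule ℝ H} [FiniteDimensional ℝ E]

theorem integrable_smul_weyl_apply {f : E → ℂ} (ψ : Fock H) :
    letI : MeasurableSpace E := borel E
    Integrable f (euclideanMeasure E) →
      Integrable (fun u : E => f u • weyl (u : H) ψ) (euclideanMeasure E) := by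
  intro hf
  let _ : MeasurableSpace E := borel E
  have : BorelSpace E := ⟨rfl⟩
  have := borel_secondCountable E
  refine hf.smul_bdd (f := fun u : E => weyl (u : H) ψ) ‖ψ‖ ?_
    (Eventually.of_forall fun u => (norm_weyl_apply _ _).le)
  exact ((continuous_weyl_apply ψ).comp continuous_subtype_val).aestronglyMeasurable

theorem exists_isWeylIntegral {f : E → ℂ} :
    letI : MeasurableSpace E := borel E
    Integrable f (euclideanMeasure E) → ∃ V, IsWeylIntegral E f V := by
  intro hf
  let _ : MeasurableSpace E := borel E
  have hi := fun ψ : Fock H => integrable_smul_weyl_apply ψ hf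
  refine ⟨LinearMap.mkContinuous
    { toFun := fun ψ => ∫ u : E, f u • weyl (u : H) ψ ∂(euclideanMeasure E)
      map_add' := fun x y => by
        rw [← integral_add (hi x) (hi y)]
        simp only [map_add, smul_add]
      map_smul' := fun c x => by
        rw [RingHom.id_apply, ← integral_smul]
        simp only [map_smul, smul_comm c] } (∫ u : E, ‖f u‖ ∂(euclideanMeasure E))
    fun ψ => ?_, hf, fun ψ => rfl⟩
  refine (norm_integral_le_integral_norm _).trans (le_of_eq ?_)
  rw [← integral_mul_const]
  simp only [norm_smul, norm_weyl_apply]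

theorem IsWeylIntegral.add {f g : E → ℂ} {V W : Fock H →L[ℂ] Fock H} (hV : IsWeylIntegral E f V)
    (hW : IsWeylIntegral E g W) : IsWeylIntegral E (f + g) (V + W) := by
  refine ⟨hV.1.add hW.1, fun ψ => ?_⟩
  rw [add_apply, hV.2, hW.2, ← integral_add (integrable_smul_weyl_apply ψ hV.1)
    (integrable_smul_weyl_apply ψ hW.1)]
  simp only [Pi.add_apply, add_smul]

theorem IsWeylIntegral.smul {f : E → ℂ} {V : Fock H →L[ℂ] Fock H} (hV : IsWeylIntegral E f V)
    (c : ℂ) : IsWeylIntegral E (c • f) (c • V) := by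
  refine ⟨hV.1.smul c, fun ψ => ?_⟩
  rw [smul_apply, hV.2, ← integral_smul]
  simp only [Pi.smul_apply, smul_assoc]

/-- `W(u)* = W(-u)` and Lebesgue measure is invariant under `u ↦ -u`. Thus the real and imaginary
parts of `W(f)` are again of this form. -/
theorem IsWeylIntegral.star {f : E → ℂ} {V : Fock H →L[ℂ] Fock H} (hV : IsWeylIntegral E f V) :
    IsWeylIntegral E (fun u => star (f (-u))) (star V) := by
  let _ : InnerProductSpace ℝ H := InnerProductSpace.complexToReal
  let _ : MeasurableSpace E := borel E
  have : BorelSpace E := ⟨rfl⟩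
  have hneg : MeasurePreserving (fun u : E => -u) (euclideanMeasure E) (euclideanMeasure E) :=
    (LinearIsometryEquiv.neg ℝ (E := E)).measurePreserving
  have hemb : MeasurableEmbedding (fun u : E => -u) := (Homeomorph.neg E).measurableEmbedding
  have h1 : Integrable (fun u : E => Star.star (f (-u))) (euclideanMeasure E) := by
    have := (hneg.integrable_comp_emb hemb).2 hV.1
    exact Complex.conjLIE.toContinuousLinearEquiv.toContinuousLinearMap.integrable_comp this
  refine ⟨h1, fun ψ => ?_⟩
  refine ext_inner_left ℂ fun η => ?_
  rw [ContinuousLinearMap.star_eq_adjoint, ContinuousLinearMap.adjoint_inner_right, hV.2,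
    ← integral_inner (integrable_smul_weyl_apply ψ h1), ← inner_conj_symm,
    ← integral_inner (integrable_smul_weyl_apply η hV.1), ← integral_conj,
    ← hneg.integral_comp hemb]
  refine integral_congr_ae (Eventually.of_forall fun u => ?_)
  simp only [inner_smul_right, map_mul, inner_conj_symm, Submodule.coe_neg, ← star_weyl,
    ContinuousLinearMap.star_eq_adjoint, ContinuousLinearMap.adjoint_inner_left]
  rfl

/-- A continuous function all of whose integrals against integrable functions lie in a closed
subspace has its values in that subspace. -/
theorem mem_of_integral_smul_mem {G : Type*} [NormedAddCommGroup G] [NormedSpace ℂ G]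
    [CompleteSpace G] {p : Submodule ℂ G} (hp : IsClosed (p : Set G)) {g : E → G}
    (hg : Continuous g) {C : ℝ} (hC : ∀ u, ‖g u‖ ≤ C) :
    letI : MeasurableSpace E := borel E
    (∀ f : E → ℂ, Integrable f (euclideanMeasure E) →
      ∫ u : E, f u • g u ∂(euclideanMeasure E) ∈ p) → ∀ u, g u ∈ p := by
  intro h u
  let _ : MeasurableSpace E := borel E
  have := hp
  let _ : InnerProductSpace ℝ H := InnerProductSpace.complexToReal
  have : BorelSpace E := ⟨rfl⟩
  have := borel_secondCountable E
  have hopen : (euclideanMeasure E).IsOpenPosMeasure :=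
    inferInstanceAs (volume : Measure E).IsOpenPosMeasure
  have hsf : SigmaFinite (euclideanMeasure E) :=
    inferInstanceAs (SigmaFinite (volume : Measure E))
  have hint : ∀ f : E → ℂ, Integrable f (euclideanMeasure E) →
      Integrable (fun u => f u • g u) (euclideanMeasure E) := fun f hf =>
    hf.smul_bdd (f := g) C hg.aestronglyMeasurable (Eventually.of_forall hC)
  have hind : ∀ s : Set E, MeasurableSet s → euclideanMeasure E s < ⊤ →
      Integrable (s.indicator fun _ => (1 : ℂ)) (euclideanMeasure E) := fun s hs hs' =>
    (integrable_indicator_iff hs).2 (integrableOn_const hs'.ne)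
  have hfun : ∀ s : Set E, (fun u => (s.indicator (fun _ => (1 : ℂ)) u) • g u) =
      s.indicator g := by
    intro s
    ext u
    by_cases hu : u ∈ s <;> simp [hu]
  -- Modulo the subspace, `g` has zero integral over every set of finite measure, hence vanishes
  -- almost everywhere; by continuity and positivity of the measure on open sets it vanishes
  -- everywhere.
  have key : (fun u => p.mkQL (g u)) =ᵐ[euclideanMeasure E] 0 := by
    refine ae_eq_zero_of_forall_setIntegral_eq_of_sigmaFinite (fun s hs hs' => ?_)
      fun s hs hs' => ?_
    · have := hint _ (hind s hs hs')
      rw [hfun, integrable_indicator_iff hs] at this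
      exact p.mkQL.integrable_comp this
    · have h1 := h _ (hind s hs hs')
      have h2 := hint _ (hind s hs hs')
      rw [hfun, integrable_indicator_iff hs] at h2
      rw [hfun, integral_indicator hs] at h1
      rw [p.mkQL.integral_comp_comm h2]
      exact mkQ_eq_zero_of_mem h1
  have h2 := (Continuous.ae_eq_iff_eq (euclideanMeasure E) (p.mkQL.continuous.comp hg)
    continuous_zero).1 key
  simpa using congrFun h2 u

end WeylIntegrals
-- From resolvents to `Γ(A)W(u)Γ(A)`.
section FieldAlgebraInResolvents

/-- Up to sign, `RVR` is the derivative at `s = 0` of the perturbed resolvent `R(1 + sVR)⁻¹`. -/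
theorem mul_mul_mem_of_mul_inverse_mem {E : Type*} [NormedAddCommGroup E] [InnerProductSpace ℂ E]
    [CompleteSpace E] {𝒜 : NonUnitalStarSubalgebra ℂ (E →L[ℂ] E)}
    (h𝒜 : IsClosed (𝒜 : Set (E →L[ℂ] E))) {R V : E →L[ℂ] E} (hR : R ∈ 𝒜)
    (h : ∀ᶠ s : ℝ in 𝓝[≠] 0, R * Ring.inverse (1 + ((s : ℂ) • V) * R) ∈ 𝒜) : R * V * R ∈ 𝒜 := by
  have hc : Continuous fun s : ℝ => 1 + ((s : ℂ) • V) * R := by fun_prop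
  have h0 : Tendsto (fun s : ℝ => 1 + ((s : ℂ) • V) * R) (𝓝[≠] 0) (𝓝 1) := by
    simpa using (hc.tendsto 0).mono_left nhdsWithin_le_nhds
  have hinv : Tendsto (fun s : ℝ => Ring.inverse (1 + ((s : ℂ) • V) * R)) (𝓝[≠] 0) (𝓝 1) := by
    have := (NormedRing.inverse_continuousAt (1 : (E →L[ℂ] E)ˣ)).tendsto
    rw [Units.val_one, Ring.inverse_one] at this
    exact this.comp h0
  have hlim : Tendsto (fun s : ℝ => R * V * R * Ring.inverse (1 + ((s : ℂ) • V) * R)) (𝓝[≠] 0)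
      (𝓝 (R * V * R)) := by
    simpa using hinv.const_mul (R * V * R)
  refine h𝒜.mem_of_tendsto hlim ?_
  have hu : ∀ᶠ s : ℝ in 𝓝[≠] 0, IsUnit (1 + ((s : ℂ) • V) * R) :=
    h0.eventually (Units.isOpen.mem_nhds isUnit_one)
  filter_upwards [h, hu, self_mem_nhdsWithin] with s hs hu hs0
  have hs0' : (s : ℂ) ≠ 0 := Complex.ofReal_ne_zero.2 hs0
  set X := Ring.inverse (1 + ((s : ℂ) • V) * R)
  have hX : (1 + ((s : ℂ) • V) * R) * X = 1 := Ring.mul_inverse_cancel _ hu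
  -- The difference quotient lies in the algebra, and `X → 1` in norm turns the left side into
  -- `RVR`.
  have e : R * V * R * X = (s : ℂ)⁻¹ • (R - R * X) := by
    have h1 : R = R * X + (s : ℂ) • (R * V * R * X) := by
      nth_rewrite 1 [← mul_one R, ← hX]
      rw [add_mul, one_mul, mul_add, smul_mul_assoc, smul_mul_assoc, mul_smul_comm]
      simp only [mul_assoc]
    rw [eq_inv_smul_iff₀ hs0']
    exact eq_sub_of_add_eq' h1.symm
  rw [e]
  exact SMulMemClass.smul_mem _ (sub_mem hR hs)

variable {H : Type*} [NormedAddCommGroup H] [InnerProductSpace ℂ H] [CompleteSpace H]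
  {𝒪 : NonUnitalStarSubalgebra ℂ (H →L[ℂ] H)}

theorem isClosed_cstarGenOps {E : Type*} [NormedAddCommGroup E] [InnerProductSpace ℂ E]
    [CompleteSpace E] (S : Set (E →ₗ.[ℂ] E)) : IsClosed (cstarGenOps S : Set (E →L[ℂ] E)) :=
  isClosed_cstarGen _

/-- `dΓ(h) + V` is an elementary quantum field Hamiltonian; its resolvent at `-1` for `‖V‖ < 1`. -/
theorem mul_inverse_one_add_mem_cstarGenOps {A : H →L[ℂ] H} (h𝒪 : IsClosed (𝒪 : Set (H →L[ℂ] H)))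
    (hAO : A ∈ 𝒪) (hA : 0 ≤ A) (hA1 : ‖A‖ < 1) (hinj : Function.Injective A)
    {E : Submodule ℂ H} [FiniteDimensional ℝ (E.restrictScalars ℝ)] {f : E.restrictScalars ℝ → ℂ}
    {V : Fock H →L[ℂ] Fock H} (hf : IsWeylIntegral (E.restrictScalars ℝ) f V)
    (hV : IsSelfAdjoint V) (hV1 : ‖V‖ < 1) :
    cfcₙ (invLog (-1)) (Gam A) * Ring.inverse (1 + V * cfcₙ (invLog (-1)) (Gam A)) ∈
      cstarGenOps (elementaryQFH 𝒪) := by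
  obtain ⟨h, hsa, hlow, hB, rfl⟩ := exists_expNeg_eq hA hA1 hinj
  have hBO : cfcₙ (invLog 0) (expNeg 1 h) ∈ 𝒪 := by
    have := h𝒪
    exact cfcₙ_mem _ hAO
  obtain ⟨-, -, -, -, hpos, -, hres⟩ := dGam_properties hB hsa hlow h𝒪 hBO
  obtain ⟨h1, h2⟩ := hres 1 one_pos
  obtain ⟨-, h3, h4⟩ := isResolventAt_add h1 (.of_nonneg h2) hpos hV hV1
  exact subset_cstarGen _ ⟨_, ⟨E, inferInstance, h3.isSelfAdjoint_of_isSelfAdjoint (.of_nonneg h4),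
    h, f, V, hsa, hlow, ⟨_, hBO, hB⟩, hf, hV, rfl⟩, _, h3⟩

/-- Splits the resolvent `(1 - log s)⁻¹` off `s`. The cofactor `s(1 - log s)` is continuous and
vanishes at `0`, so it stays in any closed star algebra containing `T`. -/
theorem eq_cfcₙ_invLog_mul {E : Type*} [NormedAddCommGroup E] [InnerProductSpace ℂ E]
    [CompleteSpace E] {T : E →L[ℂ] E} (hT : 0 ≤ T) (hT1 : ‖T‖ ≤ 1) :
    T = cfcₙ (invLog (-1)) T * cfcₙ (fun s => s * (1 - Real.log s)) T ∧
      T = cfcₙ (fun s => s * (1 - Real.log s)) T * cfcₙ (invLog (-1)) T := by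
  have hsub := quasispectrum_subset_Icc hT hT1
  have c1 : ContinuousOn (invLog (-1)) (quasispectrum ℝ T) :=
    (continuousOn_invLog_Icc one_pos).mono hsub
  have c2 : Continuous fun s : ℝ => s * (1 - Real.log s) := by
    simp only [mul_sub, mul_one]
    exact continuous_id.sub Real.continuous_mul_log
  have e : T = cfcₙ (invLog (-1)) T * cfcₙ (fun s => s * (1 - Real.log s)) T := by
    rw [← cfcₙ_mul (invLog (-1)) _ T c1 (by simp) c2.continuousOn (by simp)]
    nth_rewrite 1 [← cfcₙ_id' ℝ T]
    refine cfcₙ_congr fun s hs => ?_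
    obtain ⟨h0, h1⟩ := hsub hs
    rcases h0.eq_or_lt with rfl | h0
    · simp
    have h2 := Real.log_nonpos h0.le h1
    have h3 : -Real.log s - -1 ≠ 0 := by linarith
    simp only [invLog_of_pos h0]
    field_simp
    ring
  exact ⟨e, e.trans (cfcₙ_commute_cfcₙ _ _ T).eq⟩

/-- Perturbation theory gives `RVR` for all `V = W(f)` over `E = ℂu`. Multiplying by `G`, where `RG
= GR = Γ(A)`, turns the resolvents into `Γ(A)`, and varying `f` replaces `V` by a single Weyl
operator. -/
theorem Gam_mul_weyl_mul_Gam_mem {A : H →L[ℂ] H} (h𝒪 : IsClosed (𝒪 : Set (H →L[ℂ] H)))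
    (hAO : A ∈ 𝒪) (hA : 0 ≤ A) (hA1 : ‖A‖ < 1) (hinj : Function.Injective A) (u : H) :
    Gam A * weyl u * Gam A ∈ cstarGenOps (elementaryQFH 𝒪) := by
  set 𝒞 := cstarGenOps (elementaryQFH 𝒪)
  have h𝒞 : IsClosed (𝒞 : Set (Fock H →L[ℂ] Fock H)) := isClosed_cstarGenOps _
  obtain ⟨h, hsa, hlow, hB, hAh⟩ := exists_expNeg_eq hA hA1 hinj
  have hBO : cfcₙ (invLog 0) A ∈ 𝒪 := by
    have := h𝒪
    exact cfcₙ_mem _ hAO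
  obtain ⟨-, -, hG0, hG1, -, hexp, hres⟩ := dGam_properties hB hsa hlow h𝒪 hBO
  obtain ⟨hR1, hR0⟩ := hres 1 one_pos
  rw [hAh] at hG0 hG1 hexp hR0 hR1
  have hfin : FiniteDimensional ℝ ((ℂ ∙ u).restrictScalars ℝ) :=
    inferInstanceAs (FiniteDimensional ℝ (ℂ ∙ u))
  set E := (ℂ ∙ u).restrictScalars ℝ
  set R := cfcₙ (invLog (-1)) (Gam A)
  obtain ⟨hG, hG'⟩ := eq_cfcₙ_invLog_mul hG0 hG1
  set G := cfcₙ (fun s => s * (1 - Real.log s)) (Gam A)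
  have hmem := fun {f : E → ℂ} {V : Fock H →L[ℂ] Fock H} (hf : IsWeylIntegral E f V) =>
    mul_inverse_one_add_mem_cstarGenOps h𝒪 hAO hA hA1 hinj (E := ℂ ∙ u) hf
  have h0 : IsWeylIntegral E (fun _ => 0) 0 := ⟨integrable_zero _ _ _, by simp⟩
  -- The case `V = 0`.
  have hR : R ∈ 𝒞 := by simpa using hmem h0 (IsSelfAdjoint.zero _) (by simp)
  have hGam : Gam A ∈ 𝒞 := by
    rw [← hexp]
    exact (expNeg_mem_iff hR1 hR0 h𝒞).2 hR
  have hGm : G ∈ 𝒞 := by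
    have := h𝒞
    exact cfcₙ_mem _ hGam
  have hsymm : ∀ (f : E → ℂ) (V : Fock H →L[ℂ] Fock H), IsWeylIntegral E f V → IsSelfAdjoint V →
      R * V * R ∈ 𝒞 := by
    intro f V hf hV
    refine mul_mul_mem_of_mul_inverse_mem h𝒞 hR ?_
    have hc : Continuous fun s : ℝ => ‖(s : ℂ) • V‖ := by fun_prop
    have hlt : ∀ᶠ s : ℝ in 𝓝[≠] 0, ‖(s : ℂ) • V‖ < 1 :=
      nhdsWithin_le_nhds (hc.continuousAt.eventually_lt_const (by simp))
    filter_upwards [hlt] with s hs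
    exact hmem (hf.smul s) (by simp [isSelfAdjoint_iff, star_smul, hV.star_eq]) hs
  have hall : ∀ (f : E → ℂ) (V : Fock H →L[ℂ] Fock H), IsWeylIntegral E f V → R * V * R ∈ 𝒞 := by
    intro f V hf
    have h1 := hsymm _ _ ((hf.add hf.star).smul (1 / 2)) (by
      rw [isSelfAdjoint_iff]
      simp [add_comm])
    have h2 := hsymm _ _ ((hf.star.smul (Complex.I / 2)).add (hf.smul (-(Complex.I / 2)))) (by
      rw [isSelfAdjoint_iff]
      simp [add_comm, neg_div])
    have e : R * V * R = R * ((1 / 2 : ℂ) • (V + star V)) * R + Complex.I •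
        (R * ((Complex.I / 2) • star V + (-(Complex.I / 2)) • V) * R) := by
      rw [← smul_mul_assoc, ← mul_smul_comm, ← add_mul, ← mul_add]
      congr 2
      have hI : Complex.I * (Complex.I / 2) = -(1 / 2) := by
        rw [← mul_div_assoc, Complex.I_mul_I]; ring
      rw [smul_add, smul_add, smul_smul, smul_smul, mul_neg, hI]
      module
    rw [e]
    exact add_mem h1 (SMulMemClass.smul_mem _ h2)
  have hcont : Continuous fun x : E => R * (weyl (x : H) * Gam A) :=
    continuous_const.mul ((continuous_weyl_mul_Gam hA1).comp continuous_subtype_val)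
  have hbdd : ∀ x : E, ‖R * (weyl (x : H) * Gam A)‖ ≤ ‖R‖ := fun x =>
    (norm_mul_le _ _).trans (mul_le_of_le_one_right (norm_nonneg _) ((norm_mul_le _ _).trans
      (mul_le_one₀ (norm_weyl_le _) (norm_nonneg _) hG1)))
  -- The integral of `f(x) R W(x)Γ(A)` is `RVΓ(A) = (RVR)G`. Keeping `Γ(A)` on the right makes the
  -- integrand norm continuous, so its values can be recovered.
  have h1 := mem_of_integral_smul_mem (p := 𝒞.toNonUnitalSubalgebra.toSubmodule) h𝒞 hcont hbdd
    (fun f hf => by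
      obtain ⟨V, hV⟩ := exists_isWeylIntegral hf
      obtain ⟨hi, hVG⟩ := hV.mul_Gam hA1
      let _ : MeasurableSpace E := borel E
      have e : (fun x : E => f x • (R * (weyl (x : H) * Gam A))) =
          fun x : E => R * (f x • (weyl (x : H) * Gam A)) :=
        funext fun x => (mul_smul_comm _ _ _).symm
      rw [e, integral_const_mul_of_integrable hi, ← hVG, hG, ← mul_assoc, ← mul_assoc]
      change _ ∈ 𝒞
      exact mul_mem (hall f V hV) hGm) ⟨u, Submodule.mem_span_singleton_self u⟩
  have h2 := mul_mem hGm h1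
  rw [← mul_assoc, ← hG', ← mul_assoc] at h2
  exact h2
-- Removing the left factor `Γ(A)` for positive `A`.
/-- The product of two operators `Γ(a) W(u) Γ(a)` is a multiple of some `W(x) Γ(a⁴)`. -/
theorem Gam_mul_weyl_mul_Gam_mul {a : H →L[ℂ] H} (ha : IsSelfAdjoint a) (ha1 : ‖a‖ ≤ 1) (w : H) :
    ∃ (u v : H) (c : ℂ), c ≠ 0 ∧ (Gam a * weyl u * Gam a) * (Gam a * weyl v * Gam a) =
      c • (weyl ((a * (1 - a ^ 4) : H →L[ℂ] H) w) * Gam (a ^ 4)) := by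
  have hpow : ∀ n : ℕ, ‖a ^ n‖ ≤ 1 := fun n => by
    rcases Nat.eq_zero_or_pos n with rfl | hn
    · exact ContinuousLinearMap.norm_id_le
    · exact (norm_pow_le' a hn).trans (pow_le_one₀ (norm_nonneg _) ha1)
  have hin : ∀ (n : ℕ) (x y : H), ⟪(a ^ n) x, y⟫_ℂ = ⟪x, (a ^ n) y⟫_ℂ := fun n x y => by
    rw [← ContinuousLinearMap.adjoint_inner_right, ← ContinuousLinearMap.star_eq_adjoint,
      (ha.pow n).star_eq]
  -- Comparing the actions on exponential vectors, the product has the desired form exactly when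
  -- `a(u + a²v) = x` and `a³u + av = a⁴x`. The choices of `u`, `v`, `x` solve both equations
  -- polynomially in `a`.
  set u := (1 - a ^ 6 : H →L[ℂ] H) w with hu
  set v := -((a ^ 2 * (1 - a ^ 2) : H →L[ℂ] H) w) with hv
  set x := (a * (1 - a ^ 4) : H →L[ℂ] H) w with hx
  refine ⟨u, v, Complex.exp (-(‖u‖ ^ 2 / 2 : ℝ) - (‖v‖ ^ 2 / 2 : ℝ) - ⟪u, (a ^ 2) v⟫_ℂ +
    (‖x‖ ^ 2 / 2 : ℝ)), Complex.exp_ne_zero _, ?_⟩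
  have hG : Gam a * Gam a = Gam (a ^ 2) := by rw [pow_two, Gam_mul ha1 ha1]
  have h1 : (Gam a * weyl u * Gam a) * (Gam a * weyl v * Gam a) =
      Gam a * (weyl u * Gam (a ^ 2) * weyl v) * Gam a := by
    rw [← hG]; simp only [mul_assoc]
  rw [h1]
  refine clm_ext_expVec fun y => ?_
  have e1 : a ((a ^ 2) (a y)) = (a ^ 4) y := by
    simp only [← mul_apply_eq_comp]
    congr 1
  have e2 : a (u + (a ^ 2) v) = x := by
    rw [hu, hv, hx, map_neg, ← sub_eq_add_neg]
    simp only [← mul_apply_eq_comp, ← sub_apply]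
    congr 1
    noncomm_ring
  have e3 : ⟪u, (a ^ 2) (a y)⟫_ℂ + ⟪v, a y⟫_ℂ = ⟪x, (a ^ 4) y⟫_ℂ := by
    have h3 := hin 3 u y
    have h4 := hin 1 v y
    have h5 := hin 4 x y
    have e4 : (a ^ 2) (a y) = (a ^ 3) y := by
      simp only [← mul_apply_eq_comp]
      congr 1
    rw [pow_one] at h4
    rw [e4, ← h3, ← h4, ← h5, ← inner_add_left]
    congr 1
    rw [hu, hv, hx, map_neg, ← sub_eq_add_neg]
    simp only [← mul_apply_eq_comp, ← sub_apply]
    congr 1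
    noncomm_ring
  simp only [mul_apply_eq_comp, smul_apply]
  rw [Gam_expVec ha1, Gam_expVec (hpow 4), weyl_expVec x]
  have h2 := weyl_Gam_weyl_expVec (hpow 2) u v (a y)
  simp only [mul_apply_eq_comp] at h2
  rw [h2, map_smul, Gam_expVec ha1, e3, map_add, map_smul, e1, e2, smul_smul, ← Complex.exp_add]
  congr 2
  push_cast
  ring

/-- The vectors `a(1 - a⁴)w` are dense since this operator is self-adjoint and injective; norm
continuity in `x` then covers all `x`. -/
theorem weyl_mul_Gam_pow_four_mem {a : H →L[ℂ] H} (h𝒪 : IsClosed (𝒪 : Set (H →L[ℂ] H)))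
    (haO : a ∈ 𝒪) (ha : 0 ≤ a) (ha1 : ‖a‖ < 1) (hinj : Function.Injective a) (x : H) :
    weyl x * Gam (a ^ 4) ∈ cstarGenOps (elementaryQFH 𝒪) := by
  have hsa : IsSelfAdjoint a := .of_nonneg ha
  have ha4 : ‖a ^ 4‖ < 1 :=
    (norm_pow_le' a four_pos).trans_lt (pow_lt_one₀ (norm_nonneg _) ha1 four_ne_zero)
  have hdense : DenseRange (a * (1 - a ^ 4) : H →L[ℂ] H) := by
    refine denseRange_of_isSelfAdjoint ?_ ?_
    · exact (hsa.commute_iff ((IsSelfAdjoint.one _).sub (hsa.pow 4))).1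
        ((Commute.one_right a).sub_right (Commute.pow_right rfl 4))
    · refine (injective_iff_map_eq_zero _).2 fun y hy => ?_
      have h1 : (1 - a ^ 4 : H →L[ℂ] H) y = 0 := hinj (by rw [map_zero]; exact hy)
      have h2 : y = (a ^ 4) y := sub_eq_zero.1 h1
      by_contra h0
      have h3 := (a ^ 4).le_opNorm y
      rw [← h2] at h3
      nlinarith [norm_pos_iff.2 h0]
  refine hdense.induction_on x ?_ fun w => ?_
  · exact (isClosed_cstarGenOps _).preimage (continuous_weyl_mul_Gam ha4)
  · obtain ⟨u, v, c, hc, h⟩ := Gam_mul_weyl_mul_Gam_mul hsa ha1.le w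
    have h1 := mul_mem (Gam_mul_weyl_mul_Gam_mem h𝒪 haO ha ha1 hinj u)
      (Gam_mul_weyl_mul_Gam_mem h𝒪 haO ha ha1 hinj v)
    rw [h] at h1
    have h2 := SMulMemClass.smul_mem (s := cstarGenOps (elementaryQFH 𝒪)) c⁻¹ h1
    rwa [inv_smul_smul₀ hc] at h2

theorem weyl_mul_Gam_mem_of_injective {A : H →L[ℂ] H} (h𝒪 : IsClosed (𝒪 : Set (H →L[ℂ] H)))
    (hAO : A ∈ 𝒪) (hA : 0 ≤ A) (hA1 : ‖A‖ < 1) (hinj : Function.Injective A) (x : H) :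
    weyl x * Gam A ∈ cstarGenOps (elementaryQFH 𝒪) := by
  have h4 : opPow A (1 / 4) ^ 4 = A := by
    have h : opPow A (1 / 2) = opPow A (1 / 4) * opPow A (1 / 4) := by
      rw [← opPow_add hA (by norm_num) (by norm_num)]; norm_num
    have h' : A = opPow A (1 / 2) * opPow A (1 / 2) := by
      rw [← opPow_add hA (by norm_num) (by norm_num)]; norm_num [opPow_one hA]
    conv_rhs => rw [h', h]
    noncomm_ring
  have hO : opPow A (1 / 4) ∈ 𝒪 := by
    have := h𝒪
    exact cfcₙ_mem _ hAO
  have h := weyl_mul_Gam_pow_four_mem h𝒪 hO (opPow_nonneg hA _)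
    ((norm_opPow_le hA le_rfl (by norm_num)).trans_lt
      (Real.rpow_lt_one (norm_nonneg _) hA1 (by norm_num)))
    ((injective_iff_map_eq_zero _).2 fun y hy => hinj (by
      rw [← h4, pow_succ, mul_apply_eq_comp, hy, map_zero, map_zero])) x
  rwa [h4] at h

/-- `⟨(A + S)y, y⟩ = ‖A^{1/2}y‖² + ‖S^{1/2}y‖²`, so a kernel vector is annihilated by `S^{1/2}`. -/
theorem injective_add_of_nonneg {A S : H →L[ℂ] H} (hA : 0 ≤ A) (hS : 0 ≤ S)
    (hinj : Function.Injective S) : Function.Injective (A + S) := by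
  have key : ∀ T : H →L[ℂ] H, 0 ≤ T → ∀ y, (⟪T y, y⟫_ℂ).re = ‖opPow T (1 / 2) y‖ ^ 2 := by
    intro T hT y
    have h : T = opPow T (1 / 2) * opPow T (1 / 2) := by
      rw [← opPow_add hT (by norm_num) (by norm_num)]; norm_num [opPow_one hT]
    nth_rewrite 1 [h]
    have hs : IsSelfAdjoint (opPow T (1 / 2)) := .of_nonneg (opPow_nonneg hT _)
    rw [mul_apply_eq_comp, ← ContinuousLinearMap.adjoint_inner_right,
      ← ContinuousLinearMap.star_eq_adjoint, hs.star_eq]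
    exact inner_self_eq_norm_sq (𝕜 := ℂ) _
  refine (injective_iff_map_eq_zero _).2 fun y hy => hinj ?_
  have h1 : (⟪A y, y⟫_ℂ).re + (⟪S y, y⟫_ℂ).re = 0 := by
    rw [← Complex.add_re, ← inner_add_left, ← add_apply, hy, inner_zero_left, Complex.zero_re]
  rw [key A hA, key S hS] at h1
  have h2 : opPow S (1 / 2) y = 0 := by
    rw [← norm_eq_zero, ← sq_eq_zero_iff]
    nlinarith [sq_nonneg ‖opPow A (1 / 2) y‖, sq_nonneg ‖opPow S (1 / 2) y‖]
  have h : S = opPow S (1 / 2) * opPow S (1 / 2) := by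
    rw [← opPow_add hS (by norm_num) (by norm_num)]; norm_num [opPow_one hS]
  rw [h, mul_apply_eq_comp, h2, map_zero, map_zero]

/-- Here the positive injective `S ∈ 𝒪` enters: `A + sS` is injective for `s > 0` and tends to `A`,
and `Γ` is norm continuous on the open unit ball. -/
theorem weyl_mul_Gam_mem_of_nonneg {A : H →L[ℂ] H} (h𝒪 : IsClosed (𝒪 : Set (H →L[ℂ] H)))
    (hpos : ∃ S ∈ 𝒪, S.IsPositive ∧ Function.Injective S)
    (hAO : A ∈ 𝒪) (hA : 0 ≤ A) (hA1 : ‖A‖ < 1) (x : H) :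
    weyl x * Gam A ∈ cstarGenOps (elementaryQFH 𝒪) := by
  obtain ⟨S, hSO, hS, hSi⟩ := hpos
  rw [← ContinuousLinearMap.nonneg_iff_isPositive] at hS
  have hc : Continuous fun s : ℝ => A + (s : ℂ) • S := by fun_prop
  have h0 : Tendsto (fun s : ℝ => A + (s : ℂ) • S) (𝓝[>] 0) (𝓝 A) := by
    simpa using (hc.tendsto 0).mono_left nhdsWithin_le_nhds
  have hopen : IsOpen {A : H →L[ℂ] H | ‖A‖ < 1} := isOpen_lt continuous_norm continuous_const
  have h1 : Tendsto (fun s : ℝ => weyl x * Gam (A + (s : ℂ) • S)) (𝓝[>] 0)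
      (𝓝 (weyl x * Gam A)) :=
    ((continuousOn_Gam.continuousAt (hopen.mem_nhds hA1)).tendsto.comp h0).const_mul _
  refine (isClosed_cstarGenOps _).mem_of_tendsto h1 ?_
  filter_upwards [h0.eventually (hopen.mem_nhds hA1), self_mem_nhdsWithin] with s hs hs0
  have hs0' : (0 : ℝ) < s := hs0
  have hsS : 0 ≤ (s : ℂ) • S := smul_nonneg (by exact_mod_cast hs0'.le) hS
  refine weyl_mul_Gam_mem_of_injective h𝒪 (add_mem hAO (SMulMemClass.smul_mem _ hSO))
    (add_nonneg hA hsS) hs (injective_add_of_nonneg hA hsS fun y z hyz => hSi ?_) x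
  exact smul_right_injective H (Complex.ofReal_ne_zero.2 hs0'.ne') hyz

/-! ### Analytic continuation to arbitrary `A`. -/

/-- The identity theorem for functions with values in a normed space modulo a closed subspace. -/
theorem mem_of_frequently_mem {G : Type*} [NormedAddCommGroup G] [NormedSpace ℂ G]
    [CompleteSpace G] {p : Submodule ℂ G} (hp : IsClosed (p : Set G)) {U : Set ℂ} (hU : IsOpen U)
    (hconn : IsPreconnected U) {g : ℂ → G} (hg : DifferentiableOn ℂ g U) {z₀ z : ℂ} (hz₀ : z₀ ∈ U)
    (hz : z ∈ U) (h : ∃ᶠ w in 𝓝[≠] z₀, g w ∈ p) : g z ∈ p := by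
  have := hp
  have hd : DifferentiableOn ℂ (fun z => p.mkQL (g z)) U :=
    p.mkQL.differentiable.comp_differentiableOn hg
  have h1 := (hd.analyticOnNhd hU).eqOn_zero_of_preconnected_of_frequently_eq_zero
    hconn hz₀ (h.mono fun w hw => mkQ_eq_zero_of_mem hw) hz
  simpa using h1

/-- Analytic continuation from small positive parameters. -/
theorem mul_Gam_mem_of_eventually {p : Submodule ℂ (Fock H →L[ℂ] Fock H)}
    (hp : IsClosed (p : Set (Fock H →L[ℂ] Fock H))) (S : Fock H →L[ℂ] Fock H) {A B : H →L[ℂ] H}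
    (hA : ‖A‖ < 1) {z : ℂ} (hz : ‖A + z • B‖ < 1)
    (h : ∀ᶠ s : ℝ in 𝓝[>] 0, ‖A + (s : ℂ) • B‖ < 1 → S * Gam (A + (s : ℂ) • B) ∈ p) :
    S * Gam (A + z • B) ∈ p := by
  set U := {z : ℂ | ‖A + z • B‖ < 1}
  have hcont : Continuous fun z : ℂ => A + z • B := by fun_prop
  have hU : IsOpen U := isOpen_lt hcont.norm continuous_const
  -- The set of admissible parameters is convex, hence connected, so the identity theorem reaches
  -- every `z` in it.
  have hconv : Convex ℝ U := by
    have : U = ((LinearMap.toSpanSingleton ℂ (H →L[ℂ] H) B).restrictScalars ℝ) ⁻¹'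
        ((fun T => A + T) ⁻¹' Metric.ball 0 1) := by
      ext z
      simp only [U, Set.mem_preimage, mem_ball_zero_iff]
      rfl
    rw [this]
    exact ((convex_ball _ _).translate_preimage_right A).linear_preimage _
  have h0U : (0 : ℂ) ∈ U := by simpa [U] using hA
  have hfreq : ∃ᶠ w in 𝓝[≠] (0 : ℂ), S * Gam (A + w • B) ∈ p := by
    have ht : Tendsto (fun s : ℝ => (s : ℂ)) (𝓝[>] 0) (𝓝[≠] 0) := by
      refine tendsto_nhdsWithin_iff.2 ⟨?_, ?_⟩
      · exact (Complex.continuous_ofReal.tendsto' 0 0 (by simp)).mono_left nhdsWithin_le_nhds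
      · filter_upwards [self_mem_nhdsWithin] with s hs
        exact Complex.ofReal_ne_zero.2 (ne_of_gt hs)
    refine ht.frequently (Eventually.frequently ?_)
    have hU0 : ∀ᶠ s : ℝ in 𝓝[>] 0, (s : ℂ) ∈ U :=
      (ht.mono_right nhdsWithin_le_nhds).eventually (hU.mem_nhds h0U)
    filter_upwards [h, hU0] with s hs hsU
    exact hs hsU
  exact mem_of_frequently_mem hp hU hconv.isPreconnected (differentiableOn_mul_Gam S A B) h0U hz
    hfreq

theorem weyl_mul_Gam_mem_of_isSelfAdjoint {A : H →L[ℂ] H} (h𝒪 : IsClosed (𝒪 : Set (H →L[ℂ] H)))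
    (hpos : ∃ S ∈ 𝒪, S.IsPositive ∧ Function.Injective S)
    (hAO : A ∈ 𝒪) (hA : IsSelfAdjoint A) (hA1 : ‖A‖ < 1) (x : H) :
    weyl x * Gam A ∈ cstarGenOps (elementaryQFH 𝒪) := by
  have hP0 : 0 ≤ cfcₙ (fun s : ℝ => max s 0) A := cfcₙ_nonneg fun _ _ => le_max_right _ _
  have hN0 : 0 ≤ cfcₙ (fun s : ℝ => max (-s) 0) A := cfcₙ_nonneg fun _ _ => le_max_right _ _
  have hPO : cfcₙ (fun s : ℝ => max s 0) A ∈ 𝒪 := by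
    have := h𝒪
    exact cfcₙ_mem _ hAO
  have hNO : cfcₙ (fun s : ℝ => max (-s) 0) A ∈ 𝒪 := by
    have := h𝒪
    exact cfcₙ_mem _ hAO
  have hP1 : ‖cfcₙ (fun s : ℝ => max s 0) A‖ < 1 := by
    refine (norm_cfcₙ_le fun s hs => ?_).trans_lt hA1
    have h1 : ‖s‖ ≤ ‖A‖ := by
      simpa [cfcₙ_id' ℝ A] using norm_apply_le_norm_cfcₙ (fun s : ℝ => s) A hs
    rw [Real.norm_eq_abs] at h1 ⊢
    rw [abs_of_nonneg (le_max_right _ _)]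
    exact max_le ((le_abs_self s).trans h1) (norm_nonneg _)
  set P := cfcₙ (fun s : ℝ => max s 0) A with hP
  set N := cfcₙ (fun s : ℝ => max (-s) 0) A with hN
  have e : A = P + (-1 : ℂ) • N := by
    rw [neg_one_smul, ← sub_eq_add_neg, hP, hN, ← cfcₙ_sub _ _ A]
    nth_rewrite 1 [← cfcₙ_id' ℝ A]
    refine cfcₙ_congr fun s _ => ?_
    rcases le_total 0 s with h | h
    · simp [h]
    · simp [h]
  rw [e] at hA1 ⊢
  -- With `P`, `N` the positive and negative parts, `P + sN` is positive for `s > 0`; continuation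
  -- to `z = -1` gives `A = P - N`.
  refine mul_Gam_mem_of_eventually
    (p := (cstarGenOps (elementaryQFH 𝒪)).toNonUnitalSubalgebra.toSubmodule)
    (isClosed_cstarGenOps _) _ hP1 hA1 ?_
  filter_upwards [self_mem_nhdsWithin] with s hs0 hs
  have hs0' : (0 : ℝ) < s := hs0
  exact weyl_mul_Gam_mem_of_nonneg h𝒪 hpos (add_mem hPO (SMulMemClass.smul_mem _ hNO))
    (add_nonneg hP0 (smul_nonneg (by exact_mod_cast hs0'.le) hN0)) hs x

theorem weyl_mul_Gam_mem {A : H →L[ℂ] H} (h𝒪 : IsClosed (𝒪 : Set (H →L[ℂ] H)))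
    (hpos : ∃ S ∈ 𝒪, S.IsPositive ∧ Function.Injective S)
    (hAO : A ∈ 𝒪) (hA1 : ‖A‖ < 1) (x : H) :
    weyl x * Gam A ∈ cstarGenOps (elementaryQFH 𝒪) := by
  have e : A = (1 / 2 : ℂ) • (A + star A) +
      Complex.I • ((Complex.I / 2) • star A + (-(Complex.I / 2)) • A) := by
    have hI : Complex.I * (Complex.I / 2) = -(1 / 2) := by
      rw [← mul_div_assoc, Complex.I_mul_I]; ring
    rw [smul_add Complex.I, smul_smul, smul_smul, mul_neg, hI]
    module
  have hP : IsSelfAdjoint ((1 / 2 : ℂ) • (A + star A)) := by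
    rw [isSelfAdjoint_iff]
    simp [add_comm]
  have hQ : IsSelfAdjoint ((Complex.I / 2) • star A + (-(Complex.I / 2)) • A) := by
    rw [isSelfAdjoint_iff]
    simp [add_comm, neg_div]
  have hPO : (1 / 2 : ℂ) • (A + star A) ∈ 𝒪 :=
    SMulMemClass.smul_mem _ (add_mem hAO (star_mem hAO))
  have hQO : (Complex.I / 2) • star A + (-(Complex.I / 2)) • A ∈ 𝒪 :=
    add_mem (SMulMemClass.smul_mem _ (star_mem hAO)) (SMulMemClass.smul_mem _ hAO)
  have hP1 : ‖(1 / 2 : ℂ) • (A + star A)‖ < 1 := by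
    rw [norm_smul]
    have := norm_add_le A (star A)
    rw [norm_star] at this
    norm_num
    linarith
  set P := (1 / 2 : ℂ) • (A + star A)
  set Q := (Complex.I / 2) • star A + (-(Complex.I / 2)) • A
  rw [e] at hA1 ⊢
  -- With `P`, `Q` the real and imaginary parts, `P + sQ` is self-adjoint for real `s`; continuation
  -- to `z = i` gives `A = P + iQ`.
  refine mul_Gam_mem_of_eventually
    (p := (cstarGenOps (elementaryQFH 𝒪)).toNonUnitalSubalgebra.toSubmodule)
    (isClosed_cstarGenOps _) _ hP1 hA1 (Eventually.of_forall fun s hs => ?_)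
  refine weyl_mul_Gam_mem_of_isSelfAdjoint h𝒪 hpos
    (add_mem hPO (SMulMemClass.smul_mem _ hQO)) (hP.add ?_) hs x
  simp [isSelfAdjoint_iff, star_smul, hQ.star_eq]

/-! ### The two inclusions and the conclusion. -/

theorem fieldAlgebra_le_cstarGenOps (h𝒪 : IsClosed (𝒪 : Set (H →L[ℂ] H)))
    (hpos : ∃ S ∈ 𝒪, S.IsPositive ∧ Function.Injective S) :
    fieldAlgebra 𝒪 ≤ cstarGenOps (elementaryQFH 𝒪) := by
  refine cstarGen_le (isClosed_cstarGenOps _) ?_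
  rintro _ ⟨u, A, hA, hA1, rfl⟩
  exact weyl_mul_Gam_mem h𝒪 hpos hA hA1 u

theorem elementaryQFH_subset : elementaryQFH 𝒪 ⊆ elementaryQFHReal 𝒪 := by
  rintro K ⟨E, hE, hK⟩
  exact ⟨_, hE, hK⟩

theorem elementaryQFHReal_exists_resolvent (h𝒪 : IsClosed (𝒪 : Set (H →L[ℂ] H)))
    {K : Fock H →ₗ.[ℂ] Fock H} (hK : K ∈ elementaryQFHReal 𝒪) :
    ∃ (r : ℝ) (R : Fock H →L[ℂ] Fock H), IsResolventAt K r R ∧ 0 ≤ R ∧ R ∈ fieldAlgebra 𝒪 := by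
  obtain ⟨E, hE, hK⟩ := hK
  exact hK.exists_resolvent h𝒪

theorem cstarGenOps_elementaryQFHReal_le (h𝒪 : IsClosed (𝒪 : Set (H →L[ℂ] H))) :
    cstarGenOps (elementaryQFHReal 𝒪) ≤ fieldAlgebra 𝒪 := by
  refine cstarGen_le (isClosed_cstarGen _) ?_
  rintro R' ⟨K, hK, z, hR'⟩
  obtain ⟨r, R, hR, hR0, hRm⟩ := elementaryQFHReal_exists_resolvent h𝒪 hK
  have : IsStarNormal R := (IsSelfAdjoint.of_nonneg hR0).isStarNormal
  exact hR.mem_of_mem hR' (isClosed_cstarGen _) hRm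

theorem cstarGenOps_mono {E : Type*} [NormedAddCommGroup E] [InnerProductSpace ℂ E]
    [CompleteSpace E] {S T : Set (E →ₗ.[ℂ] E)} (h : S ⊆ T) : cstarGenOps S ≤ cstarGenOps T :=
  cstarGen_le (isClosed_cstarGen _) fun _ ⟨K, hK, z, hR⟩ => subset_cstarGen _ ⟨K, h hK, z, hR⟩

end FieldAlgebraInResolvents

end QFH

end

theorem mainTheorem8 {H : Type*} [NormedAddCommGroup H] [InnerProductSpace ℂ H] [CompleteSpace H]
    (𝒪 : NonUnitalStarSubalgebra ℂ (H →L[ℂ] H)) (h𝒪 : IsClosed (𝒪 : Set (H →L[ℂ] H)))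
    (hpos : ∃ S ∈ 𝒪, S.IsPositive ∧ Function.Injective S) :
    (QFH.fieldAlgebra 𝒪 = QFH.cstarGenOps (QFH.elementaryQFH 𝒪) ∧
      QFH.fieldAlgebra 𝒪 = QFH.cstarGen {B | ∃ K ∈ QFH.elementaryQFH 𝒪, B = QFH.expNeg 1 K}) ∧
    (QFH.fieldAlgebra 𝒪 = QFH.cstarGenOps (QFH.elementaryQFHReal 𝒪) ∧
      QFH.fieldAlgebra 𝒪 =
        QFH.cstarGen {B | ∃ K ∈ QFH.elementaryQFHReal 𝒪, B = QFH.expNeg 1 K}) := by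
  have hbelow : ∀ K ∈ QFH.elementaryQFHReal 𝒪, ∃ (r : ℝ) (R : QFH.Fock H →L[ℂ] QFH.Fock H),
      QFH.IsResolventAt K r R ∧ 0 ≤ R := fun K hK => by
    obtain ⟨r, R, h1, h2, -⟩ := QFH.elementaryQFHReal_exists_resolvent h𝒪 hK
    exact ⟨r, R, h1, h2⟩
  have hle := QFH.fieldAlgebra_le_cstarGenOps h𝒪 hpos
  have hmono := QFH.cstarGenOps_mono (QFH.elementaryQFH_subset (𝒪 := 𝒪))
  have hge := QFH.cstarGenOps_elementaryQFHReal_le h𝒪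
  -- The cycle `ℱ(𝒪) ≤` complex case `≤` real case `≤ ℱ(𝒪)` collapses to equalities.
  have hcplx := le_antisymm hle (hmono.trans hge)
  have hreal := le_antisymm (hle.trans hmono) hge
  rw [← QFH.cstarGenOps_eq_cstarGen_expNeg hbelow,
    ← QFH.cstarGenOps_eq_cstarGen_expNeg fun K hK => hbelow K (QFH.elementaryQFH_subset hK)]
  exact ⟨⟨hcplx, hcplx⟩, hreal, hreal⟩
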